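/- Fix finite sets of $\mathsf a$ agents and $\mathsf p$ atoms. Formulas are $\varphi ::= \top \mid q \mid \neg\varphi \mid \varphi\wedge\varphi \mid \Box_i\varphi$, with modal depth $\mathrm{md}$. A state $s=((W,R,L),w_d)$ is a finite pointed Kripke model; an action $\alpha=((E,Q,\mathrm{pre},\mathrm{post}),e_d)$ is a finite pointed event model with a precondition $\mathrm{pre}(e)$ and postconditions $\mathrm{post}(e)(q)$; $\mathrm{md}(\alpha)$ is the maximal modal depth of these formulas. $\alpha$ is applicable in $s$ if $s\models\mathrm{pre}(e_d)$, and $s\otimes\alpha$ is the product update. A planning task $T=(s_0,\mathcal A,\varphi_g)$ consists of a state, a finite set of actions and a goal formula; a solution is a sequence of actions of $\mathcal A$ that are successively applicable from $s_0$ and lead to a state satisfying $\varphi_g$. $|T|$ is the total size of $T$ (numbers of worlds, events, edges and true atoms, and lengths of the formulas). Put $\mathsf c=\max_{\alpha\in\mathcal A}\mathrm{md}(\alpha)$ and $\mathsf o=\mathrm{md}(\varphi_g)$. Let $\exp_2^{n}x$ be the $n$-fold iterated exponential: $\exp_2^0x=x$, $\exp_2^{n+1}x=2^{\exp_2^{n}x}$.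 The $h$-signature of a world is $\sigma_0(w)=(L(w),\varnothing)$, $\sigma_{h+1}(w)=(L(w),\,i\mapsto\{\sigma_h(v): wR_iv\})$; two worlds are $h$-bisimilar iff their $h$-signatures agree. Let $b(w)=b-d(w)$, with $d(w)$ the distance of $w$ from $w_d$. The canonical $b$-contraction $\lfloor s\rfloor_b$ has as worlds the signatures $\sigma_{b(w)}(w)$ of the worlds $w$ with $b(w)\ge 0$ for which no world $v$ satisfies both $b(v)>b(w)$ and $\sigma_{b(w)}(v)=\sigma_{b(w)}(w)$; $\sigma_{b(w)}(w)$ has the label of $w$; if $b(w)>0$ then for each $v$ with $wR_iv$ it has an $i$-edge to the least world $\sigma_{b(u)}(u)$ of the contraction (in a fixed total order of signatures) with $b(u)\ge b(w)-1$ and $\sigma_{b(w)-1}(u)=\sigma_{b(w)-1}(v)$; the designated world is $\sigma_b(w_d)$. $\textsc{BoundedGraphSearch}(T,b)$ is the following breadth-first search on nodes $(s,b',\beta)$ (state, depth bound, Boolean). Let $\textsc{InitNode}(s,b',\beta)=(\lfloor s\rfloor_{b'},\,b',\,\beta\wedge[\lfloor s\rfloor_{b'}\text{ is bisimilar to }s])$.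 The root is $\textsc{InitNode}(s_0,b,\mathrm{true})$. When a node $(s,b',\beta)$ is taken from the queue, the path to it is returned if $s\models\varphi_g$. Otherwise, for every $\alpha\in\mathcal A$ that is applicable in $s$ with $\mathrm{md}(\alpha)\le b'$, the child is $\textsc{InitNode}(s\otimes\alpha,b',\mathrm{true})$ if $\beta$ holds; it is $\textsc{InitNode}(s\otimes\alpha,b'-\mathrm{md}(\alpha),\mathrm{false})$ if $\beta$ fails and $b'-\mathrm{md}(\alpha)\ge\mathrm{md}(\varphi_g)$; else there is none. A child joins the queue unless its contracted state, with the same bound, has been generated before. If the queue is empty, failure is returned. Running times are numbers of elementary steps of a fixed implementation on lists, trees and unary numbers (model checking by computing truth values of subformulas in all worlds, bisimilarity by iterated refinement, signatures level by level). **Theorem.** 1. $\textsc{BoundedGraphSearch}(T,b)$ always halts and runs in time $|T|^{O(1)}\exp_2^{b+1}O(\mathsf a+\mathsf p)$: there are constants $C,k\in\mathbb N$ such that for all $\mathsf a,\mathsf p$, all planning tasks $T$ and all $b\in\mathbb N$ it halts after at most $|T|^{k}\cdot\exp_2^{b+1}\bigl(C(\mathsf a+\mathsf p)\bigr)$ steps.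 2. Consequently epistemic planning is fixed-parameter tractable in the parameters $\mathsf a,\mathsf c,\mathsf o,\mathsf p,\mathsf u$, where $\mathsf u$ is the maximal allowed solution length: there are a computable function $f:\mathbb N^5\to\mathbb N$ and a constant $k$ such that for all $T$ and $\mathsf u$, the algorithm that runs $\textsc{BoundedGraphSearch}(T,\mathsf c\mathsf u+\mathsf o)$ and rejects plans longer than $\mathsf u$ halts after at most $f(\mathsf a,\mathsf c,\mathsf o,\mathsf p,\mathsf u)\cdot|T|^{k}$ steps; every plan it returns is a solution of $T$ of length at most $\mathsf u$, and if it returns none, then $T$ has no solution of length at most $\mathsf u$. -/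

import Mathlib

namespace DEL

/-! Dynamic epistemic logic, for `a` agents and `p` propositional atoms. -/

/-- Formulas of the multi-agent epistemic language. -/
inductive Form (a p : ℕ) where
  | top : Form a p
  | atom (q : Fin p) : Form a p
  | neg (φ : Form a p) : Form a p
  | and (φ ψ : Form a p) : Form a p
  | box (i : Fin a) (φ : Form a p) : Form a p

/-- Modal depth. -/
def Form.md {a p : ℕ} : Form a p → ℕ
  | .top => 0
  | .atom _ => 0
  | .neg φ => φ.md
  | .and φ ψ => max φ.md ψ.md
  | .box _ φ => φ.md + 1

/-- Length of a formula: the number of nodes of its syntax tree. -/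
def Form.size {a p : ℕ} : Form a p → ℕ
  | .top => 1
  | .atom _ => 1
  | .neg φ => φ.size + 1
  | .and φ ψ => φ.size + ψ.size + 1
  | .box _ φ => φ.size + 1

/-- Epistemic states: finite pointed Kripke models. -/
structure State (a p : ℕ) where
  W : Type
  finite : Finite W
  R : Fin a → W → W → Prop
  L : W → Set (Fin p)
  des : W

/-- Truth of a formula in a world. -/
def State.Sat {a p : ℕ} (s : State a p) : s.W → Form a p → Prop
  | _, .top => True
  | w, .atom q => q ∈ s.L w
  | w, .neg φ => ¬ s.Sat w φ
  | w, .and φ ψ => s.Sat w φ ∧ s.Sat w ψ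
  | w, .box i φ => ∀ v, s.R i w v → s.Sat v φ

/-- Actions: finite pointed event models with events `0, …, m - 1`, preconditions and
postconditions. -/
structure Action (a p : ℕ) where
  m : ℕ
  Q : Fin a → Fin m → Fin m → Bool
  pre : Fin m → Form a p
  post : Fin m → Fin p → Form a p
  des : Fin m

/-- Maximal modal depth of the pre- and postconditions of an action. -/
def Action.md {a p : ℕ} (α : Action a p) : ℕ :=
  max (Finset.univ.sup fun e => (α.pre e).md)
    (Finset.univ.sup fun e => Finset.univ.sup fun q => (α.post e q).md)

/-- `|E| + ∑ |Q_i| + ∑ |pre(e)| + ∑ |post(e)(q)|`. -/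
def Action.size {a p : ℕ} (α : Action a p) : ℕ :=
  α.m + (∑ i, ∑ e, ∑ f, if α.Q i e f then 1 else 0)
    + (∑ e, (α.pre e).size) + ∑ e, ∑ q, (α.post e q).size

def State.Applicable {a p : ℕ} (s : State a p) (α : Action a p) : Prop :=
  s.Sat s.des (α.pre α.des)

/-- The product update `s ⊗ α` with an applicable action. -/
def State.update {a p : ℕ} (s : State a p) (α : Action a p) (h : s.Applicable α) :
    State a p where
  W := {x : s.W × Fin α.m // s.Sat x.1 (α.pre x.2)}
  finite := by
    have := s.finite
    infer_instance
  R i x y := s.R i x.1.1 y.1.1 ∧ α.Q i x.1.2 y.1.2 = true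
  L x := {q | s.Sat x.1.1 (α.post x.1.2 q)}
  des := ⟨(s.des, α.des), h⟩

/-- The actions are successively applicable, and `φ` holds in the state that results. -/
def State.Achieves {a p : ℕ} (φ : Form a p) : State a p → List (Action a p) → Prop
  | s, [] => s.Sat s.des φ
  | s, α :: π => ∃ h : s.Applicable α, State.Achieves φ (s.update α h) π

/-- Planning tasks `T = (s₀, 𝒜, φ_g)`; the worlds of `s₀` are `0, …, n - 1`. -/
structure Task (a p : ℕ) where
  n : ℕ
  R : Fin a → Fin n → Fin n → Bool
  L : Fin n → Fin p → Bool
  des : Fin n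
  actions : List (Action a p)
  goal : Form a p

def Task.init {a p : ℕ} (T : Task a p) : State a p where
  W := Fin T.n
  finite := inferInstance
  R i w v := T.R i w v = true
  L w := {q | T.L w q = true}
  des := T.des

/-- The size `|T|`: the sum of the sizes of the initial state (worlds, edges, labels), of the
actions and of the goal. -/
def Task.size {a p : ℕ} (T : Task a p) : ℕ :=
  (T.n + (∑ i, ∑ w, ∑ v, if T.R i w v then 1 else 0) + ∑ w, ∑ q, if T.L w q then 1 else 0)
    + (T.actions.map Action.size).sum + T.goal.size

/-- The parameter `c`: maximal modal depth of the pre- and postconditions. -/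
def Task.c {a p : ℕ} (T : Task a p) : ℕ := (T.actions.map Action.md).foldr max 0

/-- The parameter `o`: modal depth of the goal. -/
def Task.o {a p : ℕ} (T : Task a p) : ℕ := T.goal.md

/-- A plan is a list of positions in the list of actions; it is a solution if the actions at
these positions lead from the initial state to a state in which the goal holds. -/
def Task.IsSolution {a p : ℕ} (T : Task a p) (π : List ℕ) : Prop :=
  ∃ αs : List (Action a p), List.Forall₂ (fun j α => T.actions[j]? = some α) π αs ∧
    State.Achieves T.goal T.init αs

/-- `exp2 n x` is the `n`-fold iterated exponential `2 ^ 2 ^ ⋯ ^ 2 ^ x`. -/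
def exp2 : ℕ → ℕ → ℕ
  | 0, x => x
  | n + 1, x => 2 ^ exp2 n x

/-! ### Step counting

A program is a function with values in `Timed`, which records the result and the number of
steps. The data are first-order: Booleans, pairs, lists, formulas, unary natural numbers (a number
is built by successors and taken apart by matching), and binary trees. Every (recursive) call of a
program costs one step, by a `tick`; apart from calls of other programs its body performs only a
bounded number of constructor applications, pattern matchings, projections and Boolean
connectives. -/

structure Timed (α : Type) where
  val : α
  time : ℕ

instance : Monad Timed where
  pure x := ⟨x, 0⟩
  bind x f := ⟨(f x.val).val, x.time + (f x.val).time⟩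

def tick : Timed Unit := ⟨(), 1⟩

/-! #### Numbers and lists -/

def addT : ℕ → ℕ → Timed ℕ
  | m, 0 => do tick; pure m
  | m, n + 1 => do
      tick
      let r ← addT m n
      pure (r + 1)

def mulT : ℕ → ℕ → Timed ℕ
  | _, 0 => do tick; pure 0
  | m, n + 1 => do
      tick
      let r ← mulT m n
      addT r m

def subT : ℕ → ℕ → Timed ℕ
  | m, 0 => do tick; pure m
  | 0, _ + 1 => do tick; pure 0
  | m + 1, n + 1 => do tick; subT m n

def leT : ℕ → ℕ → Timed Bool
  | 0, _ => do tick; pure true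
  | _ + 1, 0 => do tick; pure false
  | m + 1, n + 1 => do tick; leT m n

def eqNatT : ℕ → ℕ → Timed Bool
  | 0, 0 => do tick; pure true
  | 0, _ + 1 => do tick; pure false
  | _ + 1, 0 => do tick; pure false
  | m + 1, n + 1 => do tick; eqNatT m n

def maxT (m n : ℕ) : Timed ℕ := do
  tick
  let r ← leT m n
  pure (if r then n else m)

/-- The list `n, …, 1, 0`. -/
def downT : ℕ → Timed (List ℕ)
  | 0 => do tick; pure [0]
  | n + 1 => do
      tick
      let r ← downT n
      pure ((n + 1) :: r)

def mapT {α β : Type} (f : α → Timed β) : List α → Timed (List β)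
  | [] => do tick; pure []
  | x :: xs => do
      tick
      let y ← f x
      let ys ← mapT f xs
      pure (y :: ys)

def zipWithT {α β γ : Type} (f : α → β → Timed γ) : List α → List β → Timed (List γ)
  | [], _ => do tick; pure []
  | _ :: _, [] => do tick; pure []
  | x :: xs, y :: ys => do
      tick
      let z ← f x y
      let zs ← zipWithT f xs ys
      pure (z :: zs)

def filterT {α : Type} (f : α → Timed Bool) : List α → Timed (List α)
  | [] => do tick; pure []
  | x :: xs => do
      tick
      let c ← f x
      let ys ← filterT f xs
      pure (if c then x :: ys else ys)

def anyT {α : Type} (f : α → Timed Bool) : List α → Timed Bool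
  | [] => do tick; pure false
  | x :: xs => do
      tick
      let c ← f x
      if c then pure true else anyT f xs

def allT {α : Type} (f : α → Timed Bool) : List α → Timed Bool
  | [] => do tick; pure true
  | x :: xs => do
      tick
      let c ← f x
      if c then allT f xs else pure false

/-- Left fold. -/
def foldT {α σ : Type} (f : σ → α → Timed σ) : σ → List α → Timed σ
  | z, [] => do tick; pure z
  | z, x :: xs => do
      tick
      let z₁ ← f z x
      foldT f z₁ xs

def appendT {α : Type} : List α → List α → Timed (List α)
  | [], ys => do tick; pure ys
  | x :: xs, ys => do
      tick
      let r ← appendT xs ys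
      pure (x :: r)

def flatMapT {α β : Type} (f : α → Timed (List β)) : List α → Timed (List β)
  | [] => do tick; pure []
  | x :: xs => do
      tick
      let y ← f x
      let ys ← flatMapT f xs
      appendT y ys

/-- `revT l acc` is the reversal of `l`, followed by `acc`. -/
def revT {α : Type} : List α → List α → Timed (List α)
  | [], acc => do tick; pure acc
  | x :: xs, acc => do tick; revT xs (x :: acc)

/-- The entry at position `j`, or `d` if there is none. -/
def nthT {α : Type} (d : α) : List α → ℕ → Timed α
  | [], _ => do tick; pure d
  | x :: _, 0 => do tick; pure x
  | _ :: xs, j + 1 => do tick; nthT d xs j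

/-- The entry of a matrix in row `j` and column `k`, or `d` if there is none. -/
def nth₂T {α : Type} (d : α) (M : List (List α)) (j k : ℕ) : Timed α := do
  tick
  let row ← nthT [] M j
  nthT d row k

/-- The positions `j, j + 1, …` of the entries of a list, counted from `j`. -/
def idxT {α : Type} : List α → ℕ → Timed (List ℕ)
  | [], _ => do tick; pure []
  | _ :: xs, j => do
      tick
      let r ← idxT xs (j + 1)
      pure (j :: r)

/-- The position, counted from `j`, of the first entry that passes the test `f`. -/
def findT {α : Type} (f : α → Timed Bool) : List α → ℕ → Timed ℕ
  | [], j => do tick; pure j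
  | x :: xs, j => do
      tick
      let c ← f x
      if c then pure j else findT f xs (j + 1)

/-- The entries of the second list at whose positions the first list has `true`. -/
def selectT {α : Type} : List Bool → List α → Timed (List α)
  | [], _ => do tick; pure []
  | _ :: _, [] => do tick; pure []
  | c :: cs, x :: xs => do
      tick
      let r ← selectT cs xs
      pure (if c then x :: r else r)

def eqListT {α : Type} (f : α → α → Timed Bool) : List α → List α → Timed Bool
  | [], [] => do tick; pure true
  | [], _ :: _ => do tick; pure false
  | _ :: _, [] => do tick; pure false
  | x :: xs, y :: ys => do
      tick
      let c ← f x y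
      if c then eqListT f xs ys else pure false

def eqBoolT (x y : Bool) : Timed Bool := do
  tick
  pure ((x && y) || (!x && !y))

/-! #### Representation of the input -/

/-- A state as data. `lab` lists the labels of the worlds (rows of `p` bits); `rel` lists, for each
agent, the adjacency matrix of its relation (row `w`, column `v` is `true` iff `w R_i v`); `des`
is the position of the designated world. -/
structure DState where
  lab : List (List Bool)
  rel : List (List (List Bool))
  des : ℕ

/-- An action as data, in the same format. -/
structure DAction (a p : ℕ) where
  rel : List (List (List Bool))
  pre : List (Form a p)
  post : List (List (Form a p))
  des : ℕ

structure DTask (a p : ℕ) where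
  init : DState
  actions : List (DAction a p)
  goal : Form a p

def Action.encode {a p : ℕ} (α : Action a p) : DAction a p where
  rel := List.ofFn fun i => List.ofFn fun e => List.ofFn fun f => α.Q i e f
  pre := List.ofFn α.pre
  post := List.ofFn fun e => List.ofFn fun q => α.post e q
  des := α.des

def Task.encode {a p : ℕ} (T : Task a p) : DTask a p where
  init :=
    { lab := List.ofFn fun w => List.ofFn fun q => T.L w q
      rel := List.ofFn fun i => List.ofFn fun w => List.ofFn fun v => T.R i w v
      des := T.des }
  actions := T.actions.map Action.encode
  goal := T.goal

/-! #### Modal depth, model checking and product update -/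

def mdT {a p : ℕ} : Form a p → Timed ℕ
  | .top => do tick; pure 0
  | .atom _ => do tick; pure 0
  | .neg φ => do tick; mdT φ
  | .and φ ψ => do
      tick
      let m ← mdT φ
      let n ← mdT ψ
      maxT m n
  | .box _ φ => do
      tick
      let m ← mdT φ
      pure (m + 1)

def maxListT (l : List ℕ) : Timed ℕ := do
  tick
  foldT maxT 0 l

def actionMdT {a p : ℕ} (α : DAction a p) : Timed ℕ := do
  tick
  let m ← mapT mdT α.pre
  let m₁ ← maxListT m
  let n ← mapT (fun l => do
    let r ← mapT mdT l
    maxListT r) α.post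
  let n₁ ← maxListT n
  maxT m₁ n₁

/-- Model checking: the list of the truth values of a formula in the worlds of `s`. -/
def checkT {a p : ℕ} (s : DState) : Form a p → Timed (List Bool)
  | .top => do tick; mapT (fun _ => pure true) s.lab
  | .atom q => do tick; mapT (fun l => nthT false l q) s.lab
  | .neg φ => do
      tick
      let v ← checkT s φ
      mapT (fun c => pure (!c)) v
  | .and φ ψ => do
      tick
      let v ← checkT s φ
      let u ← checkT s ψ
      zipWithT (fun c d => pure (c && d)) v u
  | .box i φ => do
      tick
      let v ← checkT s φ
      let r ← nthT [] s.rel i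
      mapT (fun row => do
        let succ ← selectT row v
        allT (fun c => pure c) succ) r

/-- Truth of a formula in the designated world. -/
def holdsT {a p : ℕ} (s : DState) (φ : Form a p) : Timed Bool := do
  tick
  let v ← checkT s φ
  nthT false v s.des

def applicableT {a p : ℕ} (s : DState) (α : DAction a p) : Timed Bool := do
  tick
  let φ ← nthT .top α.pre α.des
  holdsT s φ

/-- The product update. The worlds are the pairs `(w, e)` such that the precondition of `e` holds
in `w`; in the result a pair is replaced by its position in the list of these pairs. -/
def updateT {a p : ℕ} (s : DState) (α : DAction a p) : Timed DState := do
  tick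
  let pres ← mapT (checkT s) α.pre
  let posts ← mapT (mapT (checkT s)) α.post
  let ws ← idxT s.lab 0
  let es ← idxT α.pre 0
  let pairs ← flatMapT (fun w => mapT (fun e => pure (w, e)) es) ws
  let worlds ← filterT (fun x => nth₂T false pres x.2 x.1) pairs
  let lab ← mapT (fun x => do
    let vs ← nthT [] posts x.2
    mapT (fun v => nthT false v x.1) vs) worlds
  let rel ← zipWithT (fun r q =>
    mapT (fun x =>
      mapT (fun y => do
        let c ← nth₂T false r x.1 y.1
        let d ← nth₂T false q x.2 y.2
        pure (c && d)) worlds) worlds) s.rel α.rel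
  let des ← findT (fun x => do
    let c ← eqNatT x.1 s.des
    let d ← eqNatT x.2 α.des
    pure (c && d)) worlds 0
  pure ⟨lab, rel, des⟩

/-! #### Bisimilarity of two states -/

/-- One refinement of a relation `Z` (a Boolean matrix) between the worlds of two states: the
pairs in `Z` with the forth and the back property with respect to `Z`. -/
def refineT (s t : DState) (Z : List (List Bool)) : Timed (List (List Bool)) := do
  tick
  let ws ← idxT s.lab 0
  let vs ← idxT t.lab 0
  mapT (fun w => mapT (fun v => do
    let c ← nth₂T false Z w v
    let ok ← zipWithT (fun r q => do
      let succW ← filterT (fun w₁ => nth₂T false r w w₁) ws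
      let succV ← filterT (fun v₁ => nth₂T false q v v₁) vs
      let forth ← allT (fun w₁ => anyT (fun v₁ => nth₂T false Z w₁ v₁) succV) succW
      let back ← allT (fun v₁ => anyT (fun w₁ => nth₂T false Z w₁ v₁) succW) succV
      pure (forth && back)) s.rel t.rel
    let fb ← allT (fun x => pure x) ok
    pure (c && fb)) vs) ws

/-- Bisimilarity: starting with the pairs of worlds with equal labels, the relation is refined as
many times as there are pairs of worlds, which gives the largest bisimulation. -/
def bisimT (s t : DState) : Timed Bool := do
  tick
  let Z ← mapT (fun l => mapT (fun k => eqListT eqBoolT l k) t.lab) s.lab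
  let Y ← foldT (fun Y _ => foldT (fun X _ => refineT s t X) Y t.lab) Z s.lab
  nth₂T false Y s.des t.des

/-! #### Signatures and canonical contractions -/

/-- Nested lists, by which signatures are represented. -/
inductive SExp where
  | nil : SExp
  | cons (x y : SExp) : SExp

/-- The total order that is used on signatures. -/
def cmpT : SExp → SExp → Timed Ordering
  | .nil, .nil => do tick; pure .eq
  | .nil, .cons _ _ => do tick; pure .lt
  | .cons _ _, .nil => do tick; pure .gt
  | .cons x y, .cons z w => do
      tick
      let o ← cmpT x z
      match o with
      | .eq => cmpT y w
      | .lt => pure .lt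
      | .gt => pure .gt

def eqSExpT (x y : SExp) : Timed Bool := do
  tick
  let o ← cmpT x y
  match o with
  | .eq => pure true
  | .lt => pure false
  | .gt => pure false

def ofListT : List SExp → Timed SExp
  | [] => do tick; pure .nil
  | x :: xs => do
      tick
      let r ← ofListT xs
      pure (.cons x r)

def bitsT : List Bool → Timed SExp
  | [] => do tick; pure .nil
  | c :: cs => do
      tick
      let r ← bitsT cs
      pure (.cons (if c then .cons .nil .nil else .nil) r)

/-- Insertion into an increasing list without repetitions. -/
def insertT (x : SExp) : List SExp → Timed (List SExp)
  | [] => do tick; pure [x]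
  | y :: ys => do
      tick
      let o ← cmpT x y
      match o with
      | .lt => pure (x :: y :: ys)
      | .eq => pure (y :: ys)
      | .gt => do
          let r ← insertT x ys
          pure (y :: r)

/-- The increasing list, without repetitions, of the members of a list. Sets of signatures are
represented by such lists. -/
def sortT (l : List SExp) : Timed (List SExp) := do
  tick
  foldT (fun acc x => insertT x acc) [] l

/-- `sigT s h` lists the `h`-signatures of the worlds of `s`: `σ_0(w) = (L(w), ∅)`, and
`σ_{h+1}(w)` is `L(w)` with, for each agent `i`, the set of the `σ_h(v)` with `w R_i v`. -/
def sigT (s : DState) : ℕ → Timed (List SExp)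
  | 0 => do
      tick
      mapT (fun l => do
        let x ← bitsT l
        pure (.cons x .nil)) s.lab
  | h + 1 => do
      tick
      let prev ← sigT s h
      let ws ← idxT s.lab 0
      zipWithT (fun l w => do
        let x ← bitsT l
        let sets ← mapT (fun r => do
          let row ← nthT [] r w
          let vs ← selectT row prev
          let set ← sortT vs
          ofListT set) s.rel
        let y ← ofListT sets
        pure (.cons x y)) s.lab ws

/-- Given the list `cur` of the bounds of the worlds reached so far (`none` for the others) the
worlds that are reached in `r` further steps get the bounds `r - 1, …, 0` in turn. -/
def boundsGoT (s : DState) : ℕ → List (Option ℕ) → Timed (List (Option ℕ))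
  | 0, cur => do tick; pure cur
  | r + 1, cur => do
      tick
      let ws ← idxT s.lab 0
      let next ← zipWithT (fun (o : Option ℕ) w =>
        match o with
        | some h => pure (some h)
        | none => do
            let c ← anyT (fun rel => do
              let us ← zipWithT (fun (o₁ : Option ℕ) row =>
                match o₁ with
                | some _ => nthT false row w
                | none => pure false) cur rel
              anyT (fun x => pure x) us) s.rel
            pure (if c then some r else none)) cur ws
      boundsGoT s r next

/-- The bounds `b(w) = b - d(w)` of the worlds `w`, where `d(w)` is the length of a shortest path
from the designated world to `w`; `none` if `d(w) > b` or if there is no such path. -/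
def boundsT (s : DState) (b : ℕ) : Timed (List (Option ℕ)) := do
  tick
  let ws ← idxT s.lab 0
  let start ← mapT (fun w => do
    let c ← eqNatT w s.des
    pure (if c then some b else none)) ws
  boundsGoT s b start

/-- A world with its bound and its signature for that bound. -/
structure Rep where
  world : ℕ
  bound : ℕ
  sig : SExp

/-- The worlds `w` with `b(w) ≥ 0`, with `b(w)` and `σ_{b(w)}(w)`. The list `sigs` has the
`h`-signatures of the worlds in its row `h`. -/
def repsT (sigs : List (List SExp)) (bounds : List (Option ℕ)) : Timed (List Rep) := do
  tick
  let ws ← idxT bounds 0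
  let rs ← zipWithT (fun w (o : Option ℕ) =>
    match o with
    | some h => do
        let x ← nth₂T .nil sigs h w
        pure [(⟨w, h, x⟩ : Rep)]
    | none => pure []) ws bounds
  flatMapT (fun l => pure l) rs

/-- Are the worlds `u` and `v` `h`-bisimilar, that is, are their `h`-signatures equal? -/
def sameSigT (sigs : List (List SExp)) (h u v : ℕ) : Timed Bool := do
  tick
  let x ← nth₂T .nil sigs h u
  let y ← nth₂T .nil sigs h v
  eqSExpT x y

/-- The canonical `b`-contraction. A world `u` strictly represents `w` if `b(u) > b(w)` and `u`,
`w` are `b(w)`-bisimilar. The worlds of the contraction are the signatures `σ_{b(w)}(w)` of the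
worlds `w` with `b(w) ≥ 0` that are not strictly represented by any world (each signature is replaced
by its position in the increasing list of all of them). The label of `σ_{b(w)}(w)` is that of `w`. If
`b(w) > 0`, an `i`-edge goes from it, for each `v` with `w R_i v`, to the least world
`σ_{b(u)}(u)` of the contraction such that `b(u) ≥ b(w) - 1` and `u`, `v` are
`(b(w) - 1)`-bisimilar. The designated world is `σ_b(w_d)`. -/
def contractT (s : DState) (b : ℕ) : Timed DState := do
  tick
  let down ← downT b
  let hs ← revT down []
  let sigs ← mapT (sigT s) hs
  let bounds ← boundsT s b
  let reps ← repsT sigs bounds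
  let maxReps ← filterT (fun x => do
    let strict ← anyT (fun y => do
      let larger ← leT (x.bound + 1) y.bound
      let same ← sameSigT sigs x.bound x.world y.world
      pure (larger && same)) reps
    pure (!strict)) reps
  let names ← mapT (fun x => pure x.sig) maxReps
  let sorted ← sortT names
  let worlds ← mapT (fun z => do
    let j ← findT (fun x => eqSExpT z x.sig) maxReps 0
    nthT ⟨0, 0, .nil⟩ maxReps j) sorted
  let ids ← idxT worlds 0
  let vs ← idxT s.lab 0
  let lab ← mapT (fun x => nthT [] s.lab x.world) worlds
  let rel ← mapT (fun r => mapT (fun x =>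
    match x.bound with
    | 0 => mapT (fun _ => pure false) ids
    | h + 1 => do
        let succ ← filterT (fun v => nth₂T false r x.world v) vs
        let targets ← mapT (fun v => findT (fun y => do
          let ge ← leT h y.bound
          let same ← sameSigT sigs h y.world v
          pure (ge && same)) worlds 0) succ
        mapT (fun j => anyT (fun t => eqNatT t j) targets) ids) worlds) s.rel
  let root ← nth₂T .nil sigs b s.des
  let des ← findT (fun z => eqSExpT root z) sorted 0
  pure ⟨lab, rel, des⟩

/-! #### The search -/

/-- Nodes of the search tree; `path` is the reversed list of the (positions of the) actions on the
path from the root. -/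
structure Node where
  state : DState
  bound : ℕ
  isBisim : Bool
  path : List ℕ

def eqMatT (M N : List (List Bool)) : Timed Bool := do
  tick
  eqListT (eqListT eqBoolT) M N

def eqStateT (s t : DState) : Timed Bool := do
  tick
  let c ← eqMatT s.lab t.lab
  let d ← eqListT eqMatT s.rel t.rel
  let e ← eqNatT s.des t.des
  pure (c && d && e)

/-- `InitNode(s, b, wasBisim)`. -/
def initNodeT (s : DState) (b : ℕ) (wasBisim : Bool) (path : List ℕ) : Timed Node := do
  tick
  let t ← contractT s b
  let c ← bisimT t s
  pure ⟨t, b, wasBisim && c, path⟩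

/-- `ChildNode(n, α, d_g)`, where `j` is the position and `m` the modal depth of `α`. -/
def childNodeT {a p : ℕ} (n : Node) (α : DAction a p) (j m dg : ℕ) : Timed (Option Node) := do
  tick
  if n.isBisim then do
    let s ← updateT n.state α
    let r ← initNodeT s n.bound true (j :: n.path)
    pure (some r)
  else do
    let b ← subT n.bound m
    let c ← leT dg b
    if c then do
      let s ← updateT n.state α
      let r ← initNodeT s b false (j :: n.path)
      pure (some r)
    else pure none

/-- The frontier is a queue; `visited` has all the contracted states generated so far, with their
bounds. -/
structure Config where
  frontier : List Node
  visited : List (DState × ℕ)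

/-- Adding a node to the frontier unless its contracted state, for the same bound, has been
generated before. -/
def pushT (c : Config) (n : Node) : Timed Config := do
  tick
  let old ← anyT (fun x => do
    let d ← eqStateT x.1 n.state
    let e ← eqNatT x.2 n.bound
    pure (d && e)) c.visited
  if old then pure c
  else do
    let f ← appendT c.frontier [n]
    pure ⟨f, (n.state, n.bound) :: c.visited⟩

/-- Expansion of a node by the action `α` at position `j`. -/
def tryT {a p : ℕ} (dg : ℕ) (n : Node) (c : Config) (j : ℕ) (α : DAction a p) :
    Timed Config := do
  tick
  let app ← applicableT n.state α
  let m ← actionMdT α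
  let ok ← leT m n.bound
  if app && ok then do
    let child ← childNodeT n α j m dg
    match child with
    | none => pure c
    | some n₁ => pushT c n₁
  else pure c

def expandT {a p : ℕ} (dg : ℕ) (n : Node) : Config → ℕ → List (DAction a p) → Timed Config
  | c, _, [] => do tick; pure c
  | c, j, α :: αs => do
      tick
      let c₁ ← tryT dg n c j α
      expandT dg n c₁ (j + 1) αs

/-- One pass through the main loop: either the search ends, with a plan or with failure (`none`), or
it goes on with a new configuration. -/
def loopT {a p : ℕ} (D : DTask a p) (c : Config) : Timed (Option (List ℕ) ⊕ Config) := do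
  tick
  match c.frontier with
  | [] => pure (.inl none)
  | n :: rest => do
      let goal ← holdsT n.state D.goal
      if goal then do
        let π ← revT n.path []
        pure (.inl (some π))
      else do
        let dg ← mdT D.goal
        let c₁ ← expandT dg n ⟨rest, c.visited⟩ 0 D.actions
        pure (.inr c₁)

def startT {a p : ℕ} (D : DTask a p) (b : ℕ) : Timed Config := do
  tick
  let n ← initNodeT D.init b true []
  pure ⟨[n], [(n.state, n.bound)]⟩

/-- `LoopRun D c t out`: from `c`, the main loop ends after `t` steps, with the output `out`. -/
inductive LoopRun {a p : ℕ} (D : DTask a p) : Config → ℕ → Option (List ℕ) → Prop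
  | halt (c : Config) (out : Option (List ℕ)) (h : (loopT D c).val = .inl out) :
      LoopRun D c (loopT D c).time out
  | next (c c₁ : Config) (t : ℕ) (out : Option (List ℕ)) (h : (loopT D c).val = .inr c₁)
      (h₁ : LoopRun D c₁ t out) : LoopRun D c ((loopT D c).time + t) out

/-- The run of `BoundedGraphSearch(T, b)` ends after `t` steps, with the output `out`. -/
def BoundedGraphSearch {a p : ℕ} (T : Task a p) (b t : ℕ) (out : Option (List ℕ)) : Prop :=
  ∃ t₁, LoopRun T.encode (startT T.encode b).val t₁ out ∧ t = (startT T.encode b).time + t₁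

/-! #### Planning with a bound on the length of the solution -/

/-- The depth bound `c u + o`. -/
def depthBoundT {a p : ℕ} (D : DTask a p) (u : ℕ) : Timed ℕ := do
  tick
  let ms ← mapT actionMdT D.actions
  let c ← maxListT ms
  let o ← mdT D.goal
  let cu ← mulT c u
  addT cu o

def shortT {α : Type} : List α → ℕ → Timed Bool
  | [], _ => do tick; pure true
  | _ :: _, 0 => do tick; pure false
  | _ :: xs, u + 1 => do tick; shortT xs u

/-- Rejecting plans of length greater than `u`. -/
def trimT (u : ℕ) (out : Option (List ℕ)) : Timed (Option (List ℕ)) := do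
  tick
  match out with
  | none => pure none
  | some π => do
      let c ← shortT π u
      pure (if c then some π else none)

/-- Searching for a solution of length at most `u`: the run of `BoundedGraphSearch(T, c u + o)`,
followed by a check of the length of the plan, ends after `t` steps, with the output `out`. -/
def PlanWithin {a p : ℕ} (T : Task a p) (u t : ℕ) (out : Option (List ℕ)) : Prop :=
  ∃ t₁ out₁, BoundedGraphSearch T (depthBoundT T.encode u).val t₁ out₁ ∧
    out = (trimT u out₁).val ∧
    t = (depthBoundT T.encode u).time + t₁ + (trimT u out₁).time

end DEL

namespace DEL

/-! ### Values of the list programs -/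

/-! Two facts carry the theorem: bounded bisimilarity is all that a depth-bounded search must
preserve, and there are no more canonical contractions than signatures.

Correctness. Worlds that are `h`-bisimilar agree on formulas of depth at most `h` (`NBis.sat_iff`),
and an update with `α` costs `md(α)` levels of bisimilarity (`IsUpdate.nbis`); so `c·r + o` levels
decide whether a given plan of length `r` succeeds (`State.NBis.achieves`). A state and its
`b`-contraction are `b`-bisimilar (`contract_nbis`), because each world of the contraction is
bisimilar, up to its own bound, to the world that it stands for. As long as the Boolean of a node
holds, its state is fully bisimilar to the one really reached and no depth is lost; afterwards the
bound drops by `md(α)` per action. Hence every node represents the state to which its path leads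
(`Sound`), and a plan that is returned is a solution. Conversely, admitting a plan of length `r`
with a sufficient bound (`Good`) depends only on the contracted state and its bound, so dropping
duplicates is harmless. Following good children from the root leads to a good node on the frontier,
and the breadth-first order makes the returned plan no longer than any plan covered by the bound
(`LoopRun.correct`).

Time. The contraction is determined, literally as data, by the `b`-signature of the designated world
(`contract_eq_of_sig_eq`). Thus the search generates at most `(b+1)·sigBound (a+p) b` pairs of a
state and a bound (`length_le_of_contractPair`); counting all models of the size of a contraction
would cost one more exponential. From `n` signatures of one height there arise at most `2^(p + a·n)`
of the next, which gives `exp2 (b+1) (12(a+p))` (`sigBound_le_exp2`). The same function bounds the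
size of signatures and, up to the factor `b+1`, the number of worlds of a contraction.

All else is polynomial. With `M` the product of `4|T|`, `a+p+1` and `(b+1)·sigBound`, every program
runs within a fixed power of `M`, and the number of passes of the main loop is linear in the number
of possible pairs, so `M^100` steps suffice. A fixed power of an iterated exponential is absorbed
into its argument (`exp2_pow_le`), the factor `(b+1)^100` into the exponential, and numerical
constants into a power of `|T| ≥ 2`. The second claim takes `b = c·u + o` and separates the powers
of `|T|` from the rest, which is a primitive recursive function of the parameters. -/

@[simp] theorem Timed.pure_val {α : Type} (x : α) : (pure x : Timed α).val = x := rfl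
@[simp] theorem Timed.pure_time {α : Type} (x : α) : (pure x : Timed α).time = 0 := rfl
@[simp] theorem Timed.bind_val {α β : Type} (x : Timed α) (f : α → Timed β) :
    (x >>= f).val = (f x.val).val := rfl
@[simp] theorem Timed.bind_time {α β : Type} (x : Timed α) (f : α → Timed β) :
    (x >>= f).time = x.time + (f x.val).time := rfl
@[simp] theorem tick_time : tick.time = 1 := rfl

@[simp] theorem addT_val (m n : ℕ) : (addT m n).val = m + n := by
  induction n with
  | zero => simp [addT]
  | succ n ih => simp [addT, ih]; omega

@[simp] theorem mulT_val (m n : ℕ) : (mulT m n).val = m * n := by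
  induction n with
  | zero => simp [mulT]
  | succ n ih => simp [mulT, ih, Nat.mul_succ]

@[simp] theorem subT_val (m n : ℕ) : (subT m n).val = m - n := by
  induction m generalizing n with
  | zero => cases n <;> simp [subT]
  | succ m ih => cases n <;> simp [subT, ih]

@[simp] theorem leT_val (m n : ℕ) : (leT m n).val = decide (m ≤ n) := by
  induction m generalizing n with
  | zero => simp [leT]
  | succ m ih => cases n <;> simp [leT, ih]

@[simp] theorem eqNatT_val (m n : ℕ) : (eqNatT m n).val = decide (m = n) := by
  induction m generalizing n with
  | zero => cases n <;> simp [eqNatT]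
  | succ m ih => cases n <;> simp [eqNatT, ih]

@[simp] theorem maxT_val (m n : ℕ) : (maxT m n).val = max m n := by
  simp [maxT, Nat.max_def]

@[simp] theorem downT_val (n : ℕ) : (downT n).val = (List.range (n + 1)).reverse := by
  induction n with
  | zero => simp [downT]
  | succ n ih => simp [downT, ih, List.range_succ]

@[simp] theorem mapT_val {α β : Type} (f : α → Timed β) (l : List α) :
    (mapT f l).val = l.map fun x => (f x).val := by
  induction l with
  | nil => simp [mapT]
  | cons x xs ih => simp [mapT, ih]

@[simp] theorem zipWithT_val {α β γ : Type} (f : α → β → Timed γ) (l : List α) (m : List β) :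
    (zipWithT f l m).val = List.zipWith (fun x y => (f x y).val) l m := by
  induction l generalizing m with
  | nil => simp [zipWithT]
  | cons x xs ih => cases m <;> simp [zipWithT, ih]

@[simp] theorem filterT_val {α : Type} (f : α → Timed Bool) (l : List α) :
    (filterT f l).val = l.filter fun x => (f x).val := by
  induction l with
  | nil => simp [filterT]
  | cons x xs ih => simp [filterT, ih, List.filter_cons]

@[simp] theorem anyT_val {α : Type} (f : α → Timed Bool) (l : List α) :
    (anyT f l).val = l.any fun x => (f x).val := by
  induction l with
  | nil => simp [anyT]
  | cons x xs ih => by_cases h : (f x).val <;> simp [anyT, ih, h]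

@[simp] theorem allT_val {α : Type} (f : α → Timed Bool) (l : List α) :
    (allT f l).val = l.all fun x => (f x).val := by
  induction l with
  | nil => simp [allT]
  | cons x xs ih => by_cases h : (f x).val <;> simp [allT, ih, h]

@[simp] theorem foldT_val {α σ : Type} (f : σ → α → Timed σ) (z : σ) (l : List α) :
    (foldT f z l).val = l.foldl (fun z x => (f z x).val) z := by
  induction l generalizing z with
  | nil => simp [foldT]
  | cons x xs ih => simp [foldT, ih]

@[simp] theorem appendT_val {α : Type} (l m : List α) : (appendT l m).val = l ++ m := by
  induction l with
  | nil => simp [appendT]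
  | cons x xs ih => simp [appendT, ih]

@[simp] theorem flatMapT_val {α β : Type} (f : α → Timed (List β)) (l : List α) :
    (flatMapT f l).val = l.flatMap fun x => (f x).val := by
  induction l with
  | nil => simp [flatMapT]
  | cons x xs ih => simp [flatMapT, ih]

@[simp] theorem revT_val {α : Type} (l m : List α) : (revT l m).val = l.reverse ++ m := by
  induction l generalizing m with
  | nil => simp [revT]
  | cons x xs ih => simp [revT, ih]

@[simp] theorem nthT_val {α : Type} (d : α) (l : List α) (j : ℕ) :
    (nthT d l j).val = l.getD j d := by
  induction l generalizing j with
  | nil => simp [nthT]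
  | cons x xs ih => cases j <;> simp [nthT, ih]

@[simp] theorem nth₂T_val {α : Type} (d : α) (M : List (List α)) (j k : ℕ) :
    (nth₂T d M j k).val = (M.getD j []).getD k d := by
  simp only [nth₂T, Timed.bind_val, nthT_val]

@[simp] theorem idxT_val {α : Type} (l : List α) (j : ℕ) :
    (idxT l j).val = List.range' j l.length := by
  induction l generalizing j with
  | nil => simp [idxT]
  | cons x xs ih => simp [idxT, ih, List.range'_succ]

@[simp] theorem findT_val {α : Type} (f : α → Timed Bool) (l : List α) (j : ℕ) :
    (findT f l j).val = j + l.findIdx fun x => (f x).val := by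
  induction l generalizing j with
  | nil => simp [findT]
  | cons x xs ih =>
    by_cases h : (f x).val <;> simp [findT, ih, h, List.findIdx_cons]; omega

/-- The entries of the second list at whose positions the first list has `true`. -/
def select {α : Type} (cs : List Bool) (xs : List α) : List α :=
  ((cs.zip xs).filter (·.1)).map (·.2)

@[simp] theorem selectT_val {α : Type} (cs : List Bool) (xs : List α) :
    (selectT cs xs).val = select cs xs := by
  induction cs generalizing xs with
  | nil => simp [selectT, select]
  | cons c cs ih =>
    cases xs with
    | nil => simp [selectT, select]
    | cons x xs => cases c <;> simp [selectT, ih] <;> simp [select]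

theorem mem_select {α : Type} {cs : List Bool} {xs : List α} {x : α} :
    x ∈ select cs xs ↔ ∃ j, cs.getD j false = true ∧ xs[j]? = some x := by
  induction cs generalizing xs with
  | nil => simp [select]
  | cons c cs ih =>
    cases xs with
    | nil => simp [select]
    | cons y ys =>
      have h : x ∈ select (c :: cs) (y :: ys) ↔ (c = true ∧ y = x) ∨ x ∈ select cs ys := by
        cases c <;> simp [select, eq_comm (a := x)]
      rw [h, ih]
      constructor
      · rintro (⟨h₁, h₂⟩ | ⟨j, h₁, h₂⟩)
        · exact ⟨0, by simpa using h₁, by simpa using h₂⟩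
        · exact ⟨j + 1, by simpa using h₁, by simpa using h₂⟩
      · rintro ⟨j, h₁, h₂⟩
        cases j with
        | zero => exact .inl ⟨by simpa using h₁, by simpa using h₂⟩
        | succ j => exact .inr ⟨j, by simpa using h₁, by simpa using h₂⟩

theorem select_length_le {α : Type} (cs : List Bool) (xs : List α) :
    (select cs xs).length ≤ xs.length := by
  simp only [select, List.length_map]
  refine (List.length_filter_le _ _).trans ?_
  simp

theorem eqListT_val {α : Type} [DecidableEq α] (f : α → α → Timed Bool)
    (hf : ∀ x y, (f x y).val = decide (x = y)) (l m : List α) :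
    (eqListT f l m).val = decide (l = m) := by
  induction l generalizing m with
  | nil => cases m <;> simp [eqListT]
  | cons x xs ih =>
    cases m with
    | nil => simp [eqListT]
    | cons y ys => by_cases h : x = y <;> simp [eqListT, ih, hf, h]

@[simp] theorem eqBoolT_val (x y : Bool) : (eqBoolT x y).val = decide (x = y) := by
  cases x <;> cases y <;> simp [eqBoolT]

@[simp] theorem eqListT_eqBoolT_val (x y : List Bool) :
    (eqListT eqBoolT x y).val = decide (x = y) := eqListT_val _ eqBoolT_val x y

@[simp] theorem eqMatT_val (x y : List (List Bool)) : (eqMatT x y).val = decide (x = y) := by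
  simp only [eqMatT, Timed.bind_val, eqListT_val _ eqListT_eqBoolT_val]

theorem eqStateT_val (s t : DState) : (eqStateT s t).val = true ↔ s = t := by
  cases s; cases t
  simp only [eqStateT, Timed.bind_val, Timed.pure_val, eqMatT_val, eqListT_val _ eqMatT_val,
    eqNatT_val, Bool.and_eq_true, decide_eq_true_eq, DState.mk.injEq, and_assoc]

/-! ### Times of the list programs -/

section Time

variable {M : ℕ}

theorem le_pow_mono (hM : 4 ≤ M) {x i j : ℕ} (h : x ≤ M ^ i) (hij : i ≤ j) : x ≤ M ^ j :=
  h.trans (Nat.pow_le_pow_right (by omega) hij)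

/-- All costs are measured in powers of one number `M ≥ 4`. A small constant factor then costs one
exponent, and estimates reduce to comparing numerals, which `decide` does. -/
theorem pow_four_le (hM : 4 ≤ M) {x i : ℕ} (h : x ≤ 4 * M ^ i) : x ≤ M ^ (i + 1) := by
  rw [pow_succ, mul_comm]
  exact h.trans (Nat.mul_le_mul_right _ hM)

theorem add_le_pow (hM : 4 ≤ M) {x y i j : ℕ} (hx : x ≤ M ^ i) (hy : y ≤ M ^ j) :
    x + y ≤ M ^ (max i j + 1) := by
  apply pow_four_le hM
  have h₁ := le_pow_mono hM hx (le_max_left i j)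
  have h₂ := le_pow_mono hM hy (le_max_right i j)
  omega

/-- Sequential composition costs one exponent. The second cost is needed only at the value that the
first program really returns, so size invariants of intermediate results can be used. -/
theorem bind_time_le {α β : Type} (hM : 4 ≤ M) {x : Timed α} {f : α → Timed β} {i j : ℕ}
    (hx : x.time ≤ M ^ i) (hf : (f x.val).time ≤ M ^ j) :
    (x >>= f).time ≤ M ^ (max i j + 1) := add_le_pow hM hx hf

theorem tick_bind_time_le {β : Type} (hM : 4 ≤ M) {f : Unit → Timed β} {j : ℕ}
    (hf : (f ()).time ≤ M ^ j) : (tick >>= f).time ≤ M ^ (j + 1) := by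
  have := bind_time_le (x := tick) (i := 0) hM (by simp) hf
  simpa using this

theorem pure_time_le {α : Type} (x : α) : (pure x : Timed α).time ≤ M ^ 0 := by simp

theorem linear_le_pow (hM : 4 ≤ M) {n j : ℕ} (hn : n ≤ M ^ j) : n + 1 ≤ M ^ (j + 1) := by
  apply pow_four_le hM
  have : 1 ≤ M ^ j := Nat.one_le_pow _ _ (by omega)
  omega

/-- At most `M` passes raise the exponent by one; the ticks and the final call are paid for by one
more. -/
theorem loop_le_pow (hM : 4 ≤ M) {t n k : ℕ} (ht : t ≤ n * (M ^ k + 1) + 1) (hn : n ≤ M) :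
    t ≤ M ^ (k + 2) := by
  apply pow_four_le hM
  have h₁ : 1 ≤ M ^ k := Nat.one_le_pow _ _ (by omega)
  have h₂ : n * (M ^ k + 1) ≤ M * (M ^ k + 1) := Nat.mul_le_mul_right _ hn
  have h₃ : M * 1 ≤ M * M ^ k := Nat.mul_le_mul_left _ h₁
  rw [pow_succ, mul_comm _ M]
  rw [mul_add M] at h₂
  omega

theorem addT_time (m n : ℕ) : (addT m n).time = n + 1 := by
  induction n with
  | zero => simp [addT]
  | succ n ih => simp [addT, ih]; omega

theorem mulT_time_le (m n : ℕ) : (mulT m n).time ≤ n * (m + 2) + 1 := by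
  induction n with
  | zero => simp [mulT]
  | succ n ih => simp [mulT, addT_time]; linarith

theorem subT_time_le (m n : ℕ) : (subT m n).time ≤ m + 1 := by
  induction m generalizing n with
  | zero => cases n <;> simp [subT]
  | succ m ih =>
    cases n with
    | zero => simp [subT]
    | succ n => have := ih n; simp [subT]; omega

/-- Unary comparison stops when either number is used up, so a bound for the right argument suffices
whatever the left one is. -/
theorem leT_time_le_right (m n : ℕ) : (leT m n).time ≤ n + 1 := by
  induction m generalizing n with
  | zero => simp [leT]
  | succ m ih =>
    cases n with
    | zero => simp [leT]
    | succ n => have := ih n; simp [leT]; omega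

theorem eqNatT_time_le_right (m n : ℕ) : (eqNatT m n).time ≤ n + 1 := by
  induction m generalizing n with
  | zero => cases n <;> simp [eqNatT]
  | succ m ih =>
    cases n with
    | zero => simp [eqNatT]
    | succ n => have := ih n; simp [eqNatT]; omega

theorem maxT_time_le_right (m n : ℕ) : (maxT m n).time ≤ n + 2 := by
  have := leT_time_le_right m n
  simp [maxT]; omega

theorem downT_time (n : ℕ) : (downT n).time = n + 1 := by
  induction n with
  | zero => simp [downT]
  | succ n ih => simp [downT, ih]; omega

theorem appendT_time {α : Type} (l m : List α) : (appendT l m).time = l.length + 1 := by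
  induction l with
  | nil => simp [appendT]
  | cons x xs ih => simp [appendT, ih]; omega

theorem revT_time {α : Type} (l m : List α) : (revT l m).time = l.length + 1 := by
  induction l generalizing m with
  | nil => simp [revT]
  | cons x xs ih => simp [revT, ih]; omega

theorem nthT_time_le' {α : Type} (d : α) (l : List α) (j : ℕ) :
    (nthT d l j).time ≤ l.length + 1 := by
  induction l generalizing j with
  | nil => simp [nthT]
  | cons x xs ih =>
    cases j with
    | zero => simp [nthT]
    | succ j => have := ih j; simp [nthT]; omega

theorem nthT_time_le {α : Type} (hM : 4 ≤ M) {l : List α} (hl : l.length ≤ M) (d : α) (j : ℕ) :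
    (nthT d l j).time ≤ M ^ 2 :=
  (nthT_time_le' d l j).trans (linear_le_pow hM (by simpa using hl))

theorem getD_mem_or {α : Type} (l : List α) (j : ℕ) (d : α) : l.getD j d ∈ l ∨ l.getD j d = d := by
  by_cases h : j < l.length
  · left; rw [List.getD_eq_getElem _ _ h]; exact List.getElem_mem h
  · right; rw [List.getD_eq_default _ _ (by omega)]

/-- The matrix has at most `M` rows, each of length at most `M`. -/
def MatLe {α : Type} (M : ℕ) (Z : List (List α)) : Prop :=
  Z.length ≤ M ∧ ∀ r ∈ Z, r.length ≤ M

theorem MatLe.getD_length {α : Type} {Z : List (List α)} (h : MatLe M Z) (j : ℕ) :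
    (Z.getD j []).length ≤ M := by
  rcases getD_mem_or Z j [] with h₁ | h₁
  · exact h.2 _ h₁
  · rw [h₁]; simp

theorem nth₂T_time_le {α : Type} (hM : 4 ≤ M) {Z : List (List α)} (h : MatLe M Z) (d : α)
    (j k : ℕ) : (nth₂T d Z j k).time ≤ M ^ 4 := by
  unfold nth₂T
  refine tick_bind_time_le hM (bind_time_le hM (nthT_time_le hM h.1 _ _) ?_ (j := 2))
  rw [nthT_val]
  exact nthT_time_le hM (h.getD_length j) _ _

theorem idxT_time {α : Type} (l : List α) (j : ℕ) : (idxT l j).time = l.length + 1 := by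
  induction l generalizing j with
  | nil => simp [idxT]
  | cons x xs ih => simp [idxT, ih]; omega

theorem idxT_time_le {α : Type} (hM : 4 ≤ M) {l : List α} (hl : l.length ≤ M) (j : ℕ) :
    (idxT l j).time ≤ M ^ 2 :=
  (idxT_time l j).le.trans (linear_le_pow hM (by simpa using hl))

theorem selectT_time_le' {α : Type} (cs : List Bool) (l : List α) :
    (selectT cs l).time ≤ l.length + 1 := by
  induction cs generalizing l with
  | nil => simp [selectT]
  | cons x xs ih =>
    cases l with
    | nil => simp [selectT]
    | cons y ys => have := ih ys; simp [selectT]; omega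

theorem selectT_time_le {α : Type} (hM : 4 ≤ M) (cs : List Bool) {l : List α}
    (hl : l.length ≤ M) : (selectT cs l).time ≤ M ^ 2 :=
  (selectT_time_le' cs l).trans (linear_le_pow hM (by simpa using hl))

theorem mapT_time_le {α β : Type} (hM : 4 ≤ M) {f : α → Timed β} {l : List α} {k : ℕ}
    (hl : l.length ≤ M) (hf : ∀ x ∈ l, (f x).time ≤ M ^ k) : (mapT f l).time ≤ M ^ (k + 2) := by
  refine loop_le_pow hM ?_ hl
  clear hl
  induction l with
  | nil => simp [mapT]
  | cons x xs ih =>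
    have h₁ := hf x (by simp)
    have h₂ := ih fun y hy => hf y (by simp [hy])
    simp only [mapT, Timed.bind_time, tick_time, Timed.pure_time, List.length_cons]
    linarith

theorem zipWithT_time_le {α β γ : Type} (hM : 4 ≤ M) {f : α → β → Timed γ} {l : List α}
    {m : List β} {k : ℕ} (hl : l.length ≤ M) (hf : ∀ x ∈ l, ∀ y ∈ m, (f x y).time ≤ M ^ k) :
    (zipWithT f l m).time ≤ M ^ (k + 2) := by
  refine loop_le_pow hM ?_ hl
  clear hl
  induction l generalizing m with
  | nil => simp [zipWithT]
  | cons x xs ih =>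
    cases m with
    | nil => simp [zipWithT]
    | cons y ys =>
      have h₁ := hf x (by simp) y (by simp)
      have h₂ := ih (m := ys) fun z hz w hw => hf z (by simp [hz]) w (by simp [hw])
      simp only [zipWithT, Timed.bind_time, tick_time, Timed.pure_time, List.length_cons]
      linarith

theorem filterT_time_le {α : Type} (hM : 4 ≤ M) {f : α → Timed Bool} {l : List α} {k : ℕ}
    (hl : l.length ≤ M) (hf : ∀ x ∈ l, (f x).time ≤ M ^ k) :
    (filterT f l).time ≤ M ^ (k + 2) := by
  refine loop_le_pow hM ?_ hl
  clear hl
  induction l with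
  | nil => simp [filterT]
  | cons x xs ih =>
    have h₁ := hf x (by simp)
    have h₂ := ih fun y hy => hf y (by simp [hy])
    simp only [filterT, Timed.bind_time, tick_time, Timed.pure_time, List.length_cons]
    linarith

theorem anyT_time_le {α : Type} (hM : 4 ≤ M) {f : α → Timed Bool} {l : List α} {k : ℕ}
    (hl : l.length ≤ M) (hf : ∀ x ∈ l, (f x).time ≤ M ^ k) : (anyT f l).time ≤ M ^ (k + 2) := by
  refine loop_le_pow hM ?_ hl
  clear hl
  induction l with
  | nil => simp [anyT]
  | cons x xs ih =>
    have h₁ := hf x (by simp)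
    have h₂ := ih fun y hy => hf y (by simp [hy])
    simp only [anyT, Timed.bind_time, tick_time, List.length_cons]
    split
    · simp only [Timed.pure_time]
      have : 0 ≤ xs.length * (M ^ k + 1) := Nat.zero_le _
      linarith
    · linarith

theorem allT_time_le {α : Type} (hM : 4 ≤ M) {f : α → Timed Bool} {l : List α} {k : ℕ}
    (hl : l.length ≤ M) (hf : ∀ x ∈ l, (f x).time ≤ M ^ k) : (allT f l).time ≤ M ^ (k + 2) := by
  refine loop_le_pow hM ?_ hl
  clear hl
  induction l with
  | nil => simp [allT]
  | cons x xs ih =>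
    have h₁ := hf x (by simp)
    have h₂ := ih fun y hy => hf y (by simp [hy])
    simp only [allT, Timed.bind_time, tick_time, List.length_cons]
    split
    · linarith
    · simp only [Timed.pure_time]
      have : 0 ≤ xs.length * (M ^ k + 1) := Nat.zero_le _
      linarith

theorem findT_time_le {α : Type} (hM : 4 ≤ M) {f : α → Timed Bool} {l : List α} {k : ℕ}
    (hl : l.length ≤ M) (hf : ∀ x ∈ l, (f x).time ≤ M ^ k) (j : ℕ) :
    (findT f l j).time ≤ M ^ (k + 2) := by
  refine loop_le_pow hM ?_ hl
  clear hl
  induction l generalizing j with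
  | nil => simp [findT]
  | cons x xs ih =>
    have h₁ := hf x (by simp)
    have h₂ := ih (fun y hy => hf y (by simp [hy])) (j + 1)
    simp only [findT, Timed.bind_time, tick_time, List.length_cons]
    split
    · simp only [Timed.pure_time]
      have : 0 ≤ xs.length * (M ^ k + 1) := Nat.zero_le _
      linarith
    · linarith

/-- The cost of a pass may depend on the size of the accumulator, hence the invariant `P`. -/
theorem foldT_time_le {α σ : Type} (hM : 4 ≤ M) (P : σ → Prop) {f : σ → α → Timed σ} {z : σ}
    {l : List α} {k : ℕ} (hl : l.length ≤ M) (hz : P z)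
    (hP : ∀ z, P z → ∀ x ∈ l, P (f z x).val) (hf : ∀ z, P z → ∀ x ∈ l, (f z x).time ≤ M ^ k) :
    (foldT f z l).time ≤ M ^ (k + 2) := by
  refine loop_le_pow hM ?_ hl
  clear hl
  induction l generalizing z with
  | nil => simp [foldT]
  | cons x xs ih =>
    have h₁ := hf z hz x (by simp)
    have h₂ := ih (hP z hz x (by simp)) (fun z h y hy => hP z h y (by simp [hy]))
      (fun z h y hy => hf z h y (by simp [hy]))
    simp only [foldT, Timed.bind_time, tick_time, List.length_cons]
    linarith

theorem flatMapT_time_le {α β : Type} (hM : 4 ≤ M) {f : α → Timed (List β)} {l : List α} {k : ℕ}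
    (hl : l.length ≤ M) (hf : ∀ x ∈ l, (f x).time ≤ M ^ k)
    (hlen : ∀ x ∈ l, (f x).val.length ≤ M) : (flatMapT f l).time ≤ M ^ (k + 4) := by
  have : (flatMapT f l).time ≤ l.length * (M ^ (k + 2) + 1) + 1 := by
    clear hl
    induction l with
    | nil => simp [flatMapT]
    | cons x xs ih =>
      have h₁ := hf x (by simp)
      have h₂ := ih (fun y hy => hf y (by simp [hy])) (fun y hy => hlen y (by simp [hy]))
      have h₃ := hlen x (by simp)
      -- Besides `f`, a pass appends a list of length at most `M`; this is why the exponent grows by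
      -- 4 instead of 2.
      have h₄ : M ^ k + M + 1 ≤ M ^ (k + 2) :=
        loop_le_pow hM (n := M) (by nlinarith [Nat.one_le_pow k M (by omega)]) le_rfl
      simp only [flatMapT, Timed.bind_time, tick_time, appendT_time, List.length_cons]
      linarith
  exact loop_le_pow hM this hl

theorem eqListT_time_le {α : Type} (hM : 4 ≤ M) {f : α → α → Timed Bool} {l m : List α} {k : ℕ}
    (hl : l.length ≤ M) (hf : ∀ x ∈ l, ∀ y ∈ m, (f x y).time ≤ M ^ k) :
    (eqListT f l m).time ≤ M ^ (k + 2) := by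
  refine loop_le_pow hM ?_ hl
  clear hl
  induction l generalizing m with
  | nil => cases m <;> simp [eqListT]
  | cons x xs ih =>
    cases m with
    | nil => simp [eqListT]
    | cons y ys =>
      have h₁ := hf x (by simp) y (by simp)
      have h₂ := ih (m := ys) fun z hz w hw => hf z (by simp [hz]) w (by simp [hw])
      simp only [eqListT, Timed.bind_time, tick_time, List.length_cons]
      split
      · linarith
      · simp only [Timed.pure_time]
        have : 0 ≤ xs.length * (M ^ k + 1) := Nat.zero_le _
        linarith

theorem ite_time_le {α : Type} (hM : 4 ≤ M) {c : Prop} [Decidable c] {x y : Timed α} {i j : ℕ}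
    (hx : x.time ≤ M ^ i) (hy : y.time ≤ M ^ j) :
    (if c then x else y).time ≤ M ^ (max i j) := by
  split
  · exact le_pow_mono hM hx (le_max_left _ _)
  · exact le_pow_mono hM hy (le_max_right _ _)

end Time

end DEL

namespace DEL

/-! ### Bounded bisimilarity -/

/-- Kripke models without a designated world. -/
structure Model (a p : ℕ) where
  W : Type
  R : Fin a → W → W → Prop
  L : W → Set (Fin p)

variable {a p : ℕ}

def Model.Sat (K : Model a p) : K.W → Form a p → Prop
  | _, .top => True
  | w, .atom q => q ∈ K.L w
  | w, .neg φ => ¬ K.Sat w φ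
  | w, .and φ ψ => K.Sat w φ ∧ K.Sat w ψ
  | w, .box i φ => ∀ v, K.R i w v → K.Sat v φ

def State.model (s : State a p) : Model a p := ⟨s.W, s.R, s.L⟩

theorem State.sat_model (s : State a p) (φ : Form a p) (w : s.W) :
    s.model.Sat w φ ↔ s.Sat w φ := by
  induction φ generalizing w with
  | top => rfl
  | atom q => rfl
  | neg φ ih => exact not_congr (ih w)
  | and φ ψ ih₁ ih₂ => exact and_congr (ih₁ w) (ih₂ w)
  | box i φ ih => exact forall₂_congr fun v _ => ih v

/-- `h`-bisimilarity. -/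
def NBis (K N : Model a p) : ℕ → K.W → N.W → Prop
  | 0, w, v => K.L w = N.L v
  | h + 1, w, v => K.L w = N.L v ∧ ∀ i,
      (∀ w', K.R i w w' → ∃ v', N.R i v v' ∧ NBis K N h w' v') ∧
      (∀ v', N.R i v v' → ∃ w', K.R i w w' ∧ NBis K N h w' v')

variable {K N O : Model a p}

theorem NBis.label {h : ℕ} {w : K.W} {v : N.W} (H : NBis K N h w v) : K.L w = N.L v := by
  cases h with
  | zero => exact H
  | succ h => exact H.1

theorem NBis.pred {h : ℕ} {w : K.W} {v : N.W} (H : NBis K N (h + 1) w v) : NBis K N h w v := by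
  induction h generalizing w v with
  | zero => exact H.1
  | succ h ih =>
    refine ⟨H.1, fun i => ⟨fun w' hw => ?_, fun v' hv => ?_⟩⟩
    · obtain ⟨v', h₁, h₂⟩ := (H.2 i).1 w' hw
      exact ⟨v', h₁, ih h₂⟩
    · obtain ⟨w', h₁, h₂⟩ := (H.2 i).2 v' hv
      exact ⟨w', h₁, ih h₂⟩

theorem NBis.mono {h k : ℕ} {w : K.W} {v : N.W} (H : NBis K N k w v) (hk : h ≤ k) :
    NBis K N h w v := by
  induction k with
  | zero => obtain rfl : h = 0 := by omega
            exact H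
  | succ k ih =>
    rcases Nat.lt_or_ge k h with h₁ | h₁
    · obtain rfl : h = k + 1 := by omega
      exact H
    · exact ih H.pred h₁

theorem NBis.refl (h : ℕ) (w : K.W) : NBis K K h w w := by
  induction h generalizing w with
  | zero => rfl
  | succ h ih =>
    exact ⟨rfl, fun i => ⟨fun w' hw => ⟨w', hw, ih w'⟩, fun w' hw => ⟨w', hw, ih w'⟩⟩⟩

theorem NBis.symm {h : ℕ} {w : K.W} {v : N.W} (H : NBis K N h w v) : NBis N K h v w := by
  induction h generalizing w v with
  | zero => exact Eq.symm H
  | succ h ih =>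
    refine ⟨H.1.symm, fun i => ⟨fun v' hv => ?_, fun w' hw => ?_⟩⟩
    · obtain ⟨w', h₁, h₂⟩ := (H.2 i).2 v' hv
      exact ⟨w', h₁, ih h₂⟩
    · obtain ⟨v', h₁, h₂⟩ := (H.2 i).1 w' hw
      exact ⟨v', h₁, ih h₂⟩

theorem NBis.trans {h : ℕ} {w : K.W} {v : N.W} {u : O.W} (H : NBis K N h w v)
    (H' : NBis N O h v u) : NBis K O h w u := by
  induction h generalizing w v u with
  | zero => exact Eq.trans H H'
  | succ h ih =>
    refine ⟨H.1.trans H'.1, fun i => ⟨fun w' hw => ?_, fun u' hu => ?_⟩⟩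
    · obtain ⟨v', h₁, h₂⟩ := (H.2 i).1 w' hw
      obtain ⟨u', h₃, h₄⟩ := (H'.2 i).1 v' h₁
      exact ⟨u', h₃, ih h₂ h₄⟩
    · obtain ⟨v', h₁, h₂⟩ := (H'.2 i).2 u' hu
      obtain ⟨w', h₃, h₄⟩ := (H.2 i).2 v' h₁
      exact ⟨w', h₃, ih h₄ h₂⟩

/-- Each box consumes one level of bisimilarity; Boolean connectives consume none. -/
theorem NBis.sat_iff {h : ℕ} {w : K.W} {v : N.W} (H : NBis K N h w v) {φ : Form a p}
    (hφ : φ.md ≤ h) : K.Sat w φ ↔ N.Sat v φ := by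
  induction φ generalizing h w v with
  | top => rfl
  | atom q => simp only [Model.Sat, H.label]
  | neg φ ih => exact not_congr (ih H hφ)
  | and φ ψ ih₁ ih₂ =>
    exact and_congr (ih₁ H ((le_max_left _ _).trans hφ)) (ih₂ H ((le_max_right _ _).trans hφ))
  | box i φ ih =>
    obtain ⟨h, rfl⟩ : ∃ k, h = k + 1 := ⟨h - 1, by simp only [Form.md] at hφ; omega⟩
    have hφ' : φ.md ≤ h := by simpa [Form.md] using hφ
    constructor
    · intro hw v' hv
      obtain ⟨w', h₁, h₂⟩ := (H.2 i).2 v' hv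
      exact (ih h₂ hφ').1 (hw w' h₁)
    · intro hv w' hw
      obtain ⟨v', h₁, h₂⟩ := (H.2 i).1 w' hw
      exact (ih h₂ hφ').2 (hv v' h₁)

/-! ### Product updates -/

/-- `K'` is the product of `K` with `α`, up to the names of the worlds. -/
structure IsUpdate (α : Action a p) (K K' : Model a p) (π : K'.W → K.W × Fin α.m) : Prop where
  sat : ∀ y, K.Sat (π y).1 (α.pre (π y).2)
  surj : ∀ w e, K.Sat w (α.pre e) → ∃ y, π y = (w, e)
  rel : ∀ i x y, K'.R i x y ↔ K.R i (π x).1 (π y).1 ∧ α.Q i (π x).2 (π y).2 = true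
  lab : ∀ x q, q ∈ K'.L x ↔ K.Sat (π x).1 (α.post (π x).2 q)

theorem Action.pre_md_le (α : Action a p) (e : Fin α.m) : (α.pre e).md ≤ α.md :=
  (Finset.le_sup (f := fun e => (α.pre e).md) (Finset.mem_univ e)).trans (le_max_left _ _)

theorem Action.post_md_le (α : Action a p) (e : Fin α.m) (q : Fin p) :
    (α.post e q).md ≤ α.md :=
  (Finset.le_sup (f := fun q => (α.post e q).md) (Finset.mem_univ q)).trans
    ((Finset.le_sup (f := fun e => Finset.univ.sup fun q => (α.post e q).md)
      (Finset.mem_univ e)).trans (le_max_right _ _))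

/-- Pairing bisimilar worlds with the same event gives a bisimulation of the products. It loses only
the `md(α)` levels that guarantee that preconditions (existence of the partner) and postconditions
(its label) agree. Working up to the names of worlds makes it apply to updates of states, of data,
and to a mixture of the two. -/
theorem IsUpdate.nbis {α : Action a p} {K' N' : Model a p} {π : K'.W → K.W × Fin α.m}
    {ρ : N'.W → N.W × Fin α.m} (hπ : IsUpdate α K K' π) (hρ : IsUpdate α N N' ρ) {h : ℕ}
    {x : K'.W} {y : N'.W} (H : NBis K N (h + α.md) (π x).1 (ρ y).1) (he : (π x).2 = (ρ y).2) :
    NBis K' N' h x y := by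
  have label : ∀ {k} {x : K'.W} {y : N'.W}, NBis K N (k + α.md) (π x).1 (ρ y).1 →
      (π x).2 = (ρ y).2 → K'.L x = N'.L y := by
    intro k x y H he
    ext q
    rw [hπ.lab, hρ.lab, he]
    exact H.sat_iff ((α.post_md_le _ q).trans (Nat.le_add_left _ _))
  induction h generalizing x y with
  | zero => exact label H he
  | succ h ih =>
    -- One level pays for moving to a successor; `md(α)` levels are left there for its preconditions
    -- and postconditions.
    rw [show h + 1 + α.md = (h + α.md) + 1 by omega] at H
    refine ⟨label (H.mono (Nat.le_succ _)) he, fun i => ⟨fun x' hx => ?_, fun y' hy => ?_⟩⟩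
    · obtain ⟨h₁, h₂⟩ := (hπ.rel i x x').1 hx
      obtain ⟨v, h₃, h₄⟩ := (H.2 i).1 _ h₁
      have h₅ := (h₄.sat_iff ((α.pre_md_le _).trans (Nat.le_add_left _ _))).1 (hπ.sat x')
      obtain ⟨y', hy'⟩ := hρ.surj _ _ h₅
      refine ⟨y', (hρ.rel i y y').2 ?_, ih ?_ ?_⟩
      · rw [hy', ← he]; exact ⟨h₃, h₂⟩
      · rw [hy']; exact h₄
      · rw [hy']
    · obtain ⟨h₁, h₂⟩ := (hρ.rel i y y').1 hy
      obtain ⟨v, h₃, h₄⟩ := (H.2 i).2 _ h₁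
      have h₅ := (h₄.sat_iff ((α.pre_md_le _).trans (Nat.le_add_left _ _))).2 (hρ.sat y')
      obtain ⟨x', hx'⟩ := hπ.surj _ _ h₅
      refine ⟨x', (hπ.rel i x x').2 ?_, ih ?_ ?_⟩
      · rw [hx', he]; exact ⟨h₃, h₂⟩
      · rw [hx']; exact h₄
      · rw [hx']

theorem State.isUpdate (s : State a p) (α : Action a p) (h : s.Applicable α) :
    IsUpdate α s.model (s.update α h).model (fun x => x.1) where
  sat y := (s.sat_model _ _).2 y.2
  surj w e hw := ⟨⟨(w, e), (s.sat_model _ _).1 hw⟩, rfl⟩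
  rel _ _ _ := Iff.rfl
  lab _ _ := (s.sat_model _ _).symm

/-- `h`-bisimilarity of pointed states. -/
def State.NBis (s t : State a p) (h : ℕ) : Prop := DEL.NBis s.model t.model h s.des t.des

theorem State.NBis.sat_iff {s t : State a p} {h : ℕ} (H : s.NBis t h) {φ : Form a p}
    (hφ : φ.md ≤ h) : s.Sat s.des φ ↔ t.Sat t.des φ := by
  rw [← s.sat_model, ← t.sat_model]
  exact DEL.NBis.sat_iff H hφ

theorem State.NBis.applicable_iff {s t : State a p} {h : ℕ} (H : s.NBis t h) {α : Action a p}
    (hα : α.md ≤ h) : s.Applicable α ↔ t.Applicable α :=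
  H.sat_iff ((α.pre_md_le _).trans hα)

theorem State.NBis.update {s t : State a p} {h k : ℕ} (H : s.NBis t h) {α : Action a p}
    (hk : k + α.md ≤ h) (hs : s.Applicable α) (ht : t.Applicable α) :
    (s.update α hs).NBis (t.update α ht) k :=
  (s.isUpdate α hs).nbis (t.isUpdate α ht) (DEL.NBis.mono H hk) rfl

/-- Bisimilar states admit the same plans. -/
theorem State.NBis.achieves {φ : Form a p} {c : ℕ} {αs : List (Action a p)}
    (hαs : ∀ α ∈ αs, α.md ≤ c) {s t : State a p} {h : ℕ} (H : s.NBis t h)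
    (hh : c * αs.length + φ.md ≤ h) (hs : s.Achieves φ αs) : t.Achieves φ αs := by
  induction αs generalizing s t h with
  | nil => exact (H.sat_iff (by simpa using hh)).1 hs
  | cons α αs ih =>
    obtain ⟨h₁, h₂⟩ := hs
    have h₃ : α.md ≤ c := hαs α (by simp)
    -- The first action uses at most `c` levels and leaves enough for the remaining ones and the
    -- goal.
    rw [List.length_cons, mul_add, mul_one] at hh
    refine ⟨(H.applicable_iff (by omega)).1 h₁, ih (fun β hβ => hαs β (by simp [hβ]))
      (H.update (k := c * αs.length + φ.md) (by omega) h₁ _) le_rfl h₂⟩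

end DEL

namespace DEL

variable {a p : ℕ}

/-! ### States as data -/

theorem getD_map_of_lt {α β : Type} (f : α → β) {l : List α} {j : ℕ} (h : j < l.length) (d : β) :
    (l.map f).getD j d = f l[j] := by
  rw [List.getD_eq_getElem _ _ (by simpa using h), List.getElem_map]

theorem getD_ofFn {α : Type} {n : ℕ} (f : Fin n → α) (j : Fin n) (d : α) :
    (List.ofFn f).getD j d = f j := by
  rw [List.getD_eq_getElem _ _ (by simp), List.getElem_ofFn]

/-- The shape of a state with `a` agents and `p` atoms. -/
structure DState.WF (a p : ℕ) (s : DState) : Prop where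
  lab : ∀ l ∈ s.lab, l.length = p
  rel : s.rel.length = a
  rows : ∀ r ∈ s.rel, r.length = s.lab.length
  cols : ∀ r ∈ s.rel, ∀ row ∈ r, row.length = s.lab.length
  des : s.des < s.lab.length

/-- Is there an `i`-edge from `w` to `v`? -/
def DState.adj (s : DState) (i w v : ℕ) : Bool := ((s.rel.getD i []).getD w []).getD v false

def DState.model (s : DState) (a p : ℕ) : Model a p where
  W := Fin s.lab.length
  R i w v := s.adj i w v = true
  L w := {q | (s.lab.getD w []).getD q false = true}

def DState.state (s : DState) (a p : ℕ) (h : s.des < s.lab.length) : State a p where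
  W := Fin s.lab.length
  finite := inferInstance
  R i w v := s.adj i w v = true
  L w := {q | (s.lab.getD w []).getD q false = true}
  des := ⟨s.des, h⟩

theorem DState.WF.getD_rel {s : DState} (h : s.WF a p) (i : Fin a) :
    s.rel.getD i [] ∈ s.rel := by
  rw [List.getD_eq_getElem _ _ (by rw [h.rel]; exact i.2)]
  exact List.getElem_mem _

theorem DState.WF.getD_row_mem {s : DState} {r : List (List Bool)}
    (hr : r.length = s.lab.length) {w : ℕ} (hw : w < s.lab.length) :
    r.getD w [] ∈ r := by
  rw [List.getD_eq_getElem _ _ (by omega)]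
  exact List.getElem_mem _

/-- Entries out of range are read as `false` or as empty rows, so an edge certifies that its indices
are in range. -/
theorem DState.WF.lt_of_adj {s : DState} (h : s.WF a p) {i w v : ℕ} (H : s.adj i w v = true) :
    i < a ∧ w < s.lab.length ∧ v < s.lab.length := by
  have hi : i < a := by
    by_contra hi
    rw [DState.adj, List.getD_eq_default s.rel _ (by rw [h.rel]; omega)] at H
    simp at H
  have h₁ := h.getD_rel ⟨i, hi⟩
  have hw : w < s.lab.length := by
    by_contra hw
    rw [DState.adj, List.getD_eq_default (s.rel.getD i []) _ (by rw [h.rows _ h₁]; omega)] at H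
    simp at H
  refine ⟨hi, hw, ?_⟩
  by_contra hv
  have h₂ := DState.WF.getD_row_mem (h.rows _ h₁) hw
  rw [DState.adj, List.getD_eq_default _ _ (by rw [h.cols _ h₁ _ h₂]; omega)] at H
  simp at H

/-! ### Model checking -/

theorem checkT_length (s : DState) (hs : s.WF a p) (φ : Form a p) :
    (checkT s φ).val.length = s.lab.length := by
  induction φ with
  | top => simp [checkT]
  | atom q => simp [checkT]
  | neg φ ih => simp [checkT, ih]
  | and φ ψ ih₁ ih₂ => simp [checkT, ih₁, ih₂]
  | box i φ ih =>
    simp only [checkT, Timed.bind_val, mapT_val, List.length_map, nthT_val]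
    exact hs.rows _ (hs.getD_rel i)

theorem getD_zipWith_of_lt {α β γ : Type} (f : α → β → γ) {l : List α} {m : List β} {j : ℕ}
    (h₁ : j < l.length) (h₂ : j < m.length) (d : γ) :
    (List.zipWith f l m).getD j d = f l[j] m[j] := by
  rw [List.getD_eq_getElem _ _ (by simp; omega), List.getElem_zipWith]

theorem exists_of_mem_zipWith {α β γ : Type} {f : α → β → γ} {l : List α} {m : List β} {z : γ}
    (h : z ∈ List.zipWith f l m) : ∃ x ∈ l, ∃ y ∈ m, z = f x y := by
  obtain ⟨j, hj, rfl⟩ := List.mem_iff_getElem.1 h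
  exact ⟨_, List.getElem_mem _, _, List.getElem_mem _, List.getElem_zipWith⟩

theorem checkT_iff (s : DState) (hs : s.WF a p) (φ : Form a p) (w : Fin s.lab.length) :
    (checkT s φ).val.getD w false = true ↔ (s.model a p).Sat w φ := by
  induction φ generalizing w with
  | top => simp [checkT, Model.Sat]
  | atom q =>
    simp only [checkT, Timed.bind_val, mapT_val, nthT_val, Model.Sat, DState.model]
    rw [getD_map_of_lt _ w.2, Set.mem_ofPred_eq, List.getD_eq_getElem s.lab _ w.2]
  | neg φ ih =>
    simp only [checkT, Timed.bind_val, mapT_val, Timed.pure_val, Model.Sat]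
    have hw : (w : ℕ) < (checkT s φ).val.length := by rw [checkT_length s hs]; exact w.2
    rw [getD_map_of_lt _ hw, ← ih w, List.getD_eq_getElem _ _ hw]
    simp
  | and φ ψ ih₁ ih₂ =>
    simp only [checkT, Timed.bind_val, zipWithT_val, Timed.pure_val, Model.Sat]
    have hw : (w : ℕ) < (checkT s φ).val.length := by rw [checkT_length s hs]; exact w.2
    have hw' : (w : ℕ) < (checkT s ψ).val.length := by rw [checkT_length s hs]; exact w.2
    rw [getD_zipWith_of_lt _ hw hw', ← ih₁ w, ← ih₂ w, List.getD_eq_getElem _ _ hw,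
      List.getD_eq_getElem _ _ hw', Bool.and_eq_true]
  | box i φ ih =>
    simp only [checkT, Timed.bind_val, mapT_val, allT_val, selectT_val, nthT_val, Timed.pure_val,
      Model.Sat]
    have hw : (w : ℕ) < (s.rel.getD i []).length := by
      rw [hs.rows _ (hs.getD_rel i)]; exact w.2
    rw [getD_map_of_lt _ hw, List.all_eq_true]
    simp only [mem_select]
    constructor
    · intro H v hv
      refine (ih v).1 ?_
      have hv' : Fin.val (n := s.lab.length) v < (checkT s φ).val.length := by
        rw [checkT_length s hs]; exact Fin.is_lt (n := s.lab.length) v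
      rw [List.getD_eq_getElem _ _ hv']
      refine H _ ⟨Fin.val (n := s.lab.length) v, ?_, List.getElem?_eq_getElem hv'⟩
      change s.adj i w (Fin.val (n := s.lab.length) v) = true at hv
      rwa [DState.adj, List.getD_eq_getElem _ _ hw] at hv
    · rintro H x ⟨j, h₁, h₂⟩
      obtain ⟨hj, rfl⟩ := List.getElem?_eq_some_iff.1 h₂
      have hj' : j < s.lab.length := by rwa [checkT_length s hs] at hj
      have := (ih ⟨j, hj'⟩).2 (H ⟨j, hj'⟩ ?_)
      · rwa [List.getD_eq_getElem _ _ hj] at this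
      · change s.adj i w j = true
        rw [DState.adj, List.getD_eq_getElem _ _ hw]
        exact h₁

theorem holdsT_iff (s : DState) (hs : s.WF a p) (φ : Form a p) :
    (holdsT s φ).val = true ↔ (s.state a p hs.des).Sat ⟨s.des, hs.des⟩ φ := by
  simp only [holdsT, Timed.bind_val, nthT_val]
  exact (checkT_iff s hs φ ⟨s.des, hs.des⟩).trans
    (State.sat_model (s.state a p hs.des) φ ⟨s.des, hs.des⟩)

theorem applicableT_iff (s : DState) (hs : s.WF a p) (α : Action a p) :
    (applicableT s α.encode).val = true ↔ (s.state a p hs.des).Applicable α := by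
  simp only [applicableT, Timed.bind_val, nthT_val, Action.encode, getD_ofFn]
  exact holdsT_iff s hs _

/-! ### Product updates of states as data -/

/-- The worlds of the product update, as pairs. -/
def updateWorlds (s : DState) (α : Action a p) : List (ℕ × ℕ) :=
  ((List.range s.lab.length).flatMap fun w => (List.range α.m).map fun e => (w, e)).filter
    fun x => (((List.ofFn α.pre).map fun φ => (checkT s φ).val).getD x.2 []).getD x.1 false

theorem mem_updateWorlds (s : DState) (hs : s.WF a p) (α : Action a p) (w e : ℕ) :
    (w, e) ∈ updateWorlds s α ↔ ∃ (hw : w < s.lab.length) (he : e < α.m),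
      (s.model a p).Sat ⟨w, hw⟩ (α.pre ⟨e, he⟩) := by
  simp only [updateWorlds, List.mem_filter, List.mem_flatMap, List.mem_range, List.mem_map,
    Prod.mk.injEq]
  constructor
  · rintro ⟨⟨w', hw, e', he, rfl, rfl⟩, H⟩
    refine ⟨hw, he, ?_⟩
    rw [getD_map_of_lt _ (by simpa using he), List.getElem_ofFn] at H
    exact (checkT_iff s hs _ ⟨w', hw⟩).1 H
  · rintro ⟨hw, he, H⟩
    refine ⟨⟨w, hw, e, he, rfl, rfl⟩, ?_⟩
    rw [getD_map_of_lt _ (by simpa using he), List.getElem_ofFn]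
    exact (checkT_iff s hs _ ⟨w, hw⟩).2 H

theorem updateWorlds_length_le (s : DState) (α : Action a p) :
    (updateWorlds s α).length ≤ s.lab.length * α.m := by
  refine (List.length_filter_le _ _).trans ?_
  simp [List.length_flatMap]

theorem updateT_val (s : DState) (α : Action a p) :
    (updateT s α.encode).val =
      { lab := (updateWorlds s α).map fun x =>
          (((List.ofFn fun e => List.ofFn fun q => α.post e q).map fun l =>
            l.map fun φ => (checkT s φ).val).getD x.2 []).map fun v => v.getD x.1 false
        rel := List.zipWith (fun r q => (updateWorlds s α).map fun x =>
          (updateWorlds s α).map fun y =>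
            (r.getD x.1 []).getD y.1 false && (q.getD x.2 []).getD y.2 false) s.rel
          (List.ofFn fun i => List.ofFn fun e => List.ofFn fun f => α.Q i e f)
        des := (updateWorlds s α).findIdx fun x => decide (x.1 = s.des) && decide (x.2 = (α.des : ℕ)) } := by
  simp only [updateT, Timed.bind_val, Timed.pure_val, mapT_val, flatMapT_val, filterT_val, idxT_val,
    nth₂T_val, nthT_val, zipWithT_val, findT_val, eqNatT_val, Action.encode, List.length_ofFn,
    ← List.range_eq_range', Nat.zero_add, updateWorlds]

section Update

variable {s : DState} (hs : s.WF a p) (α : Action a p)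

theorem updateT_lab_length : (updateT s α.encode).val.lab.length = (updateWorlds s α).length := by
  simp [updateT_val]

include hs in
theorem updateT_wf (happ : (s.state a p hs.des).Applicable α) :
    (updateT s α.encode).val.WF a p := by
  have hdes : ((s.des, (α.des : ℕ)) : ℕ × ℕ) ∈ updateWorlds s α :=
    (mem_updateWorlds s hs α _ _).2 ⟨hs.des, α.des.2,
      (State.sat_model (s.state a p hs.des) _ _).2 happ⟩
  rw [updateT_val]
  constructor
  · intro l hl
    obtain ⟨⟨w, e⟩, hx, rfl⟩ := List.mem_map.1 hl
    obtain ⟨hw, he, -⟩ := (mem_updateWorlds s hs α _ _).1 hx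
    rw [List.length_map, getD_map_of_lt _ (by simpa using he)]
    simp
  · simp [hs.rel]
  · intro r hr
    obtain ⟨x, -, y, -, rfl⟩ := exists_of_mem_zipWith hr
    simp
  · intro r hr
    obtain ⟨x, -, y, -, rfl⟩ := exists_of_mem_zipWith hr
    intro row hrow
    obtain ⟨x, -, rfl⟩ := List.mem_map.1 hrow
    simp
  · rw [List.length_map]
    exact List.findIdx_lt_length_of_exists ⟨_, hdes, by simp⟩

/-- The world and the event of a world of the product update. -/
def updateProj (y : Fin (updateT s α.encode).val.lab.length) : Fin s.lab.length × Fin α.m :=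
  have hy : (y : ℕ) < (updateWorlds s α).length := by rw [← updateT_lab_length]; exact y.2
  have h := (mem_updateWorlds s hs α (updateWorlds s α)[(y : ℕ)].1 (updateWorlds s α)[(y : ℕ)].2).1
    (List.getElem_mem hy)
  (⟨_, h.1⟩, ⟨_, h.2.1⟩)

-- The names of the new worlds are positions in `updateWorlds`; looking up the pair at a position is
-- the projection that `IsUpdate` asks for.
include hs in
theorem updateT_isUpdate :
    IsUpdate α (s.model a p) ((updateT s α.encode).val.model a p) (updateProj hs α) where
  sat (y : Fin (updateT s α.encode).val.lab.length) := ((mem_updateWorlds s hs α _ _).1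
    (List.getElem_mem (l := updateWorlds s α) (n := y)
      (by rw [← updateT_lab_length]; exact y.2))).2.2
  surj (w : Fin s.lab.length) e H := by
    have := (mem_updateWorlds s hs α w e).2 ⟨w.2, e.2, H⟩
    obtain ⟨j, hj, hj'⟩ := List.mem_iff_getElem.1 this
    refine ⟨⟨j, by rwa [updateT_lab_length]⟩, ?_⟩
    simp only [updateProj, hj']
    exact Prod.ext rfl rfl
  rel i (x y : Fin (updateT s α.encode).val.lab.length) := by
    have hx : (x : ℕ) < (updateWorlds s α).length := by rw [← updateT_lab_length]; exact x.2
    have hy : (y : ℕ) < (updateWorlds s α).length := by rw [← updateT_lab_length]; exact y.2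
    obtain ⟨_, hex, -⟩ := (mem_updateWorlds s hs α (updateWorlds s α)[(x : ℕ)].1
      (updateWorlds s α)[(x : ℕ)].2).1 (List.getElem_mem hx)
    obtain ⟨_, hey, -⟩ := (mem_updateWorlds s hs α (updateWorlds s α)[(y : ℕ)].1
      (updateWorlds s α)[(y : ℕ)].2).1 (List.getElem_mem hy)
    change DState.adj _ i x y = true ↔ s.adj i _ _ = true ∧ _
    simp only [DState.adj, updateT_val, updateProj]
    have hi : (i : ℕ) < s.rel.length := by rw [hs.rel]; exact i.2
    rw [getD_zipWith_of_lt _ hi (by simp), getD_map_of_lt _ hx, getD_map_of_lt _ hy,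
      Bool.and_eq_true, List.getD_eq_getElem s.rel _ hi]
    rw [List.getElem_ofFn]
    have h₁ := getD_ofFn (fun e => List.ofFn fun f => α.Q ⟨i, i.2⟩ e f) ⟨_, hex⟩ []
    rw [h₁]
    have h₂ := getD_ofFn (fun f => α.Q ⟨i, i.2⟩ ⟨_, hex⟩ f) ⟨_, hey⟩ false
    rw [h₂]
  lab (x : Fin (updateT s α.encode).val.lab.length) q := by
    have hx : (x : ℕ) < (updateWorlds s α).length := by rw [← updateT_lab_length]; exact x.2
    obtain ⟨hwx, hex, -⟩ := (mem_updateWorlds s hs α (updateWorlds s α)[(x : ℕ)].1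
      (updateWorlds s α)[(x : ℕ)].2).1 (List.getElem_mem hx)
    change ((updateT s α.encode).val.lab.getD x []).getD q false = true ↔ _
    simp only [updateT_val, updateProj]
    rw [getD_map_of_lt _ hx, getD_map_of_lt _ (l := List.ofFn fun e => List.ofFn fun q => α.post e q)
      (j := (updateWorlds s α)[(x : ℕ)].2) (by simpa using hex), List.getElem_ofFn, List.map_map,
      getD_map_of_lt _ (by simp), List.getElem_ofFn]
    exact checkT_iff s hs _ ⟨_, hwx⟩

/-- Applicability puts the designated pair into the list of worlds, so the search for its position
succeeds. -/
theorem updateProj_des (happ : (s.state a p hs.des).Applicable α) :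
    updateProj hs α ⟨_, (updateT_wf hs α happ).des⟩ = (⟨s.des, hs.des⟩, α.des) := by
  have h := (updateT_wf hs α happ).des
  rw [updateT_lab_length] at h
  have h' : (updateWorlds s α).findIdx (fun x => decide (x.1 = s.des) && decide (x.2 = (α.des : ℕ))) <
    (updateWorlds s α).length := by simpa [updateT_val] using h
  have := List.findIdx_getElem (w := h')
  simp only [Bool.and_eq_true, decide_eq_true_eq] at this
  have hd : (updateT s α.encode).val.des = (updateWorlds s α).findIdx
      (fun x => decide (x.1 = s.des) && decide (x.2 = (α.des : ℕ))) := by rw [updateT_val]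
  ext <;> simp only [updateProj, hd]
  · exact this.1
  · exact this.2

/-- The product update of data represents the product update of a bisimilar state. -/
theorem updateT_nbis (happ : (s.state a p hs.des).Applicable α) {t : State a p}
    (ht : t.Applicable α) {h k : ℕ} (H : (s.state a p hs.des).NBis t h) (hk : k + α.md ≤ h) :
    ((updateT s α.encode).val.state a p (updateT_wf hs α happ).des).NBis (t.update α ht) k := by
  refine (updateT_isUpdate hs α).nbis (x := ⟨_, (updateT_wf hs α happ).des⟩)
    (t.isUpdate α ht) ?_ ?_
  · rw [updateProj_des hs α happ]
    exact DEL.NBis.mono H hk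
  · rw [updateProj_des hs α happ]
    rfl

end Update

theorem Task.encode_wf (T : Task a p) : T.encode.init.WF a p where
  lab l hl := by
    obtain ⟨w, rfl⟩ := (List.mem_ofFn' _ _).1 hl
    simp
  rel := by simp [Task.encode]
  rows r hr := by
    obtain ⟨i, rfl⟩ := (List.mem_ofFn' _ _).1 hr
    simp [Task.encode]
  cols r hr row hrow := by
    obtain ⟨i, rfl⟩ := (List.mem_ofFn' _ _).1 hr
    obtain ⟨w, rfl⟩ := (List.mem_ofFn' _ _).1 hrow
    simp [Task.encode]
  des := by simp [Task.encode]

/-- The encoding is an isomorphic copy; the only difference is that the number of worlds is the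
length of a list, hence the casts. -/
theorem Task.encode_nbis (T : Task a p) (h : ℕ) :
    (T.encode.init.state a p T.encode_wf.des).NBis T.init h := by
  have hn : T.encode.init.lab.length = T.n := by simp [Task.encode]
  have key : ∀ (h : ℕ) (w : Fin T.encode.init.lab.length),
      NBis (T.encode.init.state a p T.encode_wf.des).model T.init.model h w (w.cast hn) := by
    have hR : ∀ (i : Fin a) (w v : Fin T.encode.init.lab.length),
        T.encode.init.adj i w v = T.R i (w.cast hn) (v.cast hn) := by
      intro i w v
      simp only [DState.adj, Task.encode, getD_ofFn]
      have h₁ := getD_ofFn (fun w => List.ofFn fun v => T.R i w v) (w.cast hn) []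
      rw [Fin.val_cast] at h₁
      rw [h₁]
      exact getD_ofFn (fun v => T.R i (w.cast hn) v) (v.cast hn) false
    have hL : ∀ w : Fin T.encode.init.lab.length,
        (T.encode.init.state a p T.encode_wf.des).L w = T.init.L (w.cast hn) := by
      intro w
      ext q
      change (T.encode.init.lab.getD w []).getD q false = true ↔ T.L (w.cast hn) q = true
      have h₁ := getD_ofFn (fun w => List.ofFn fun q => T.L w q) (w.cast hn) []
      rw [Fin.val_cast] at h₁
      simp only [Task.encode]
      rw [h₁, getD_ofFn]
      exact Iff.rfl
    intro h
    induction h with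
    | zero => exact hL
    | succ h ih =>
      refine fun w => ⟨hL w, fun i => ⟨fun (v : Fin _) hv => ⟨v.cast hn, ?_, ih v⟩,
        fun (v : Fin _) hv => ?_⟩⟩
      · change T.encode.init.adj i w v = true at hv
        rwa [hR] at hv
      · refine ⟨Fin.cast hn.symm v, ?_, ih (Fin.cast hn.symm v)⟩
        change T.encode.init.adj i w (Fin.cast hn.symm v) = true
        rw [hR]
        exact hv
  exact key h _

end DEL

namespace DEL

variable {a p : ℕ}

/-! ### Bisimilarity of states as data -/

/-- A shrinking set loses an element at each step until it is stable, so as many steps as it has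
elements are enough. -/
theorem iterate_fixed {α : Type} (F : Finset α → Finset α) (hF : ∀ S, F S ⊆ S) (S : Finset α)
    {n : ℕ} (hn : S.card ≤ n) : F (F^[n] S) = F^[n] S := by
  have key : ∀ k, F (F^[k] S) = F^[k] S ∨ (F^[k] S).card + k ≤ S.card := by
    intro k
    induction k with
    | zero => right; simp
    | succ k ih =>
      rw [Function.iterate_succ_apply']
      by_cases h : F (F^[k] S) = F^[k] S
      · left; rw [h, h]
      · right
        have := Finset.card_lt_card ((hF (F^[k] S)).ssubset_of_ne h)
        rcases ih with ih | ih
        · exact absurd ih h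
        · omega
  rcases key n with h | h
  · exact h
  -- If elements were lost in all `n` steps, nothing is left, and the empty set is stable.
  · have : F^[n] S = ∅ := by rw [← Finset.card_eq_zero]; omega
    rw [this]
    exact Finset.subset_empty.1 (hF ∅)

theorem getD_range_map {α : Type} (f : ℕ → α) {n j : ℕ} (h : j < n) (d : α) :
    ((List.range n).map f).getD j d = f j := by
  rw [getD_map_of_lt _ (by simpa using h), List.getElem_range]

section Bisim

variable (s t : DState) (i : ℕ)

/-- The forth and back properties with respect to the relation given by a matrix. -/
def forthBack (r q : List (List Bool)) (n m : ℕ) (Z : List (List Bool)) (w v : ℕ) : Bool :=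
  (((List.range n).filter fun w₁ => (r.getD w []).getD w₁ false).all fun w₁ =>
    ((List.range m).filter fun v₁ => (q.getD v []).getD v₁ false).any fun v₁ =>
      (Z.getD w₁ []).getD v₁ false) &&
  (((List.range m).filter fun v₁ => (q.getD v []).getD v₁ false).all fun v₁ =>
    ((List.range n).filter fun w₁ => (r.getD w []).getD w₁ false).any fun w₁ =>
      (Z.getD w₁ []).getD v₁ false)

theorem refineT_val (Z : List (List Bool)) :
    (refineT s t Z).val = (List.range s.lab.length).map fun w =>
      (List.range t.lab.length).map fun v =>
        (Z.getD w []).getD v false &&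
        (List.zipWith (fun r q => forthBack r q s.lab.length t.lab.length Z w v)
          s.rel t.rel).all id := by
  simp only [refineT, Timed.bind_val, Timed.pure_val, mapT_val, filterT_val, idxT_val, nth₂T_val,
    zipWithT_val, allT_val, anyT_val, ← List.range_eq_range', forthBack]
  rfl

theorem all_zipWith {α β : Type} (f : α → β → Bool) (l : List α) (m : List β) (d : α) (e : β)
    (h : l.length = m.length) :
    (List.zipWith f l m).all id = true ↔
      ∀ i < l.length, f (l.getD i d) (m.getD i e) = true := by
  rw [List.all_eq_true]
  constructor
  · intro H i hi
    rw [List.getD_eq_getElem _ _ hi, List.getD_eq_getElem _ _ (h ▸ hi)]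
    exact H _ (List.mem_iff_getElem.2 ⟨i, by simp; omega, List.getElem_zipWith⟩)
  · intro H x hx
    obtain ⟨i, hi, rfl⟩ := List.mem_iff_getElem.1 hx
    have hi' : i < l.length ∧ i < m.length := by simpa using hi
    have := H i hi'.1
    rw [List.getD_eq_getElem _ _ hi'.1, List.getD_eq_getElem _ _ hi'.2] at this
    simpa using this

theorem forthBack_iff (Z : List (List Bool)) (w v : ℕ) :
    forthBack (s.rel.getD i []) (t.rel.getD i []) s.lab.length t.lab.length Z w v = true ↔
      (∀ w₁ : Fin s.lab.length, s.adj i w w₁ = true →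
        ∃ v₁ : Fin t.lab.length, t.adj i v v₁ = true ∧ (Z.getD w₁ []).getD v₁ false = true) ∧
      (∀ v₁ : Fin t.lab.length, t.adj i v v₁ = true →
        ∃ w₁ : Fin s.lab.length, s.adj i w w₁ = true ∧ (Z.getD w₁ []).getD v₁ false = true) := by
  simp only [forthBack, DState.adj, Bool.and_eq_true, List.all_eq_true, List.any_eq_true,
    List.mem_filter, List.mem_range]
  refine and_congr ⟨fun H w₁ h => ?_, fun H w₁ h => ?_⟩ ⟨fun H w₁ h => ?_, fun H w₁ h => ?_⟩
  · obtain ⟨v₁, h₁, h₂⟩ := H w₁ ⟨w₁.2, h⟩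
    exact ⟨⟨v₁, h₁.1⟩, h₁.2, h₂⟩
  · obtain ⟨v₁, h₁, h₂⟩ := H ⟨w₁, h.1⟩ h.2
    exact ⟨v₁, ⟨v₁.2, h₁⟩, h₂⟩
  · obtain ⟨v₁, h₁, h₂⟩ := H w₁ ⟨w₁.2, h⟩
    exact ⟨⟨v₁, h₁.1⟩, h₁.2, h₂⟩
  · obtain ⟨v₁, h₁, h₂⟩ := H ⟨w₁, h.1⟩ h.2
    exact ⟨v₁, ⟨v₁.2, h₁⟩, h₂⟩

open Classical in
/-- One refinement of a set of pairs of worlds. -/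
noncomputable def refineSet (a : ℕ) (S : Finset (Fin s.lab.length × Fin t.lab.length)) :
    Finset (Fin s.lab.length × Fin t.lab.length) :=
  S.filter fun x => ∀ i < a,
    (∀ w₁ : Fin s.lab.length, s.adj i x.1 w₁ = true →
      ∃ v₁ : Fin t.lab.length, t.adj i x.2 v₁ = true ∧ (w₁, v₁) ∈ S) ∧
    (∀ v₁ : Fin t.lab.length, t.adj i x.2 v₁ = true →
      ∃ w₁ : Fin s.lab.length, s.adj i x.1 w₁ = true ∧ (w₁, v₁) ∈ S)

/-- The set of pairs given by a matrix. -/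
def pairsOf (Z : List (List Bool)) : Finset (Fin s.lab.length × Fin t.lab.length) :=
  Finset.univ.filter fun x => (Z.getD x.1 []).getD x.2 false = true

theorem mem_pairsOf {Z : List (List Bool)} {x : Fin s.lab.length × Fin t.lab.length} :
    x ∈ pairsOf s t Z ↔ (Z.getD x.1 []).getD x.2 false = true := by
  simp [pairsOf]

variable {s t} (hs : s.WF a p) (ht : t.WF a p)

include hs ht in
theorem pairsOf_refineT (Z : List (List Bool)) :
    pairsOf s t (refineT s t Z).val = refineSet s t a (pairsOf s t Z) := by
  ext ⟨w, v⟩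
  simp only [refineSet, Finset.mem_filter, mem_pairsOf]
  rw [refineT_val, getD_range_map _ w.2, getD_range_map _ v.2, Bool.and_eq_true,
    all_zipWith _ _ _ [] [] (hs.rel.trans ht.rel.symm), hs.rel]
  simp only [forthBack_iff]

-- The relation obtained after as many refinements as there are pairs is stable, hence a
-- bisimulation. Only soundness of the test is needed: a negative answer merely makes the search
-- spend depth.
open Classical in
include hs ht in
theorem bisimT_sound (H : (bisimT s t).val = true) (h : ℕ) :
    (s.state a p hs.des).NBis (t.state a p ht.des) h := by
  simp only [bisimT, Timed.bind_val, foldT_val, mapT_val, nth₂T_val, List.foldl_const,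
    eqListT_eqBoolT_val] at H
  -- The folds ignore the entries of the lists, so the nested loops are one iteration of length
  -- `t.lab.length * s.lab.length`.
  rw [← Function.iterate_mul] at H
  set Z := s.lab.map fun l => t.lab.map fun k => decide (l = k) with hZ
  have hsemi : Function.Semiconj (pairsOf s t) (fun X => (refineT s t X).val)
      (refineSet s t a) := pairsOf_refineT hs ht
  set n := t.lab.length * s.lab.length with hn
  have hsub : ∀ S, refineSet s t a S ⊆ S := fun S => Finset.filter_subset _ _
  have hfix := iterate_fixed (refineSet s t a) hsub (pairsOf s t Z) (n := n)
    ((Finset.card_le_univ _).trans (by simp [hn, mul_comm]))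
  have hsub' : ∀ k, (refineSet s t a)^[k] (pairsOf s t Z) ⊆ pairsOf s t Z := by
    intro k
    induction k with
    | zero => exact subset_rfl
    | succ k ih => rw [Function.iterate_succ_apply']; exact (hsub _).trans ih
  have hdes : (⟨s.des, hs.des⟩, ⟨t.des, ht.des⟩) ∈ (refineSet s t a)^[n] (pairsOf s t Z) := by
    rw [← (hsemi.iterate_right n) Z, mem_pairsOf]
    exact H
  set S := (refineSet s t a)^[n] (pairsOf s t Z)
  have hlab : ∀ x ∈ S, (s.model a p).L x.1 = (t.model a p).L x.2 := by
    intro x hx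
    have := (mem_pairsOf s t).1 (hsub' n hx)
    rw [hZ, getD_map_of_lt _ x.1.2, getD_map_of_lt _ x.2.2, decide_eq_true_eq] at this
    simp only [DState.model]
    rw [List.getD_eq_getElem s.lab _ x.1.2, List.getD_eq_getElem t.lab _ x.2.2, this]
  have key : ∀ h, ∀ x ∈ S, NBis (s.model a p) (t.model a p) h x.1 x.2 := by
    intro h
    induction h with
    | zero => exact hlab
    | succ h ih =>
      intro x hx
      have hx' := hx
      rw [← hfix] at hx'
      have hx'' := (Finset.mem_filter.1 hx').2
      refine ⟨hlab x hx, fun i => ⟨fun w₁ hw => ?_, fun v₁ hv => ?_⟩⟩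
      · obtain ⟨v₁, h₁, h₂⟩ := (hx'' i i.2).1 w₁ hw
        exact ⟨v₁, h₁, ih _ h₂⟩
      · obtain ⟨w₁, h₁, h₂⟩ := (hx'' i i.2).2 v₁ hv
        exact ⟨w₁, h₁, ih _ h₂⟩
  exact key h _ hdes

end Bisim

end DEL

namespace DEL

variable {a p : ℕ}

/-! ### The order of signatures -/

theorem cmpT_eq_iff (x y : SExp) : (cmpT x y).val = .eq ↔ x = y := by
  induction x generalizing y with
  | nil => cases y <;> simp [cmpT]
  | cons x₁ x₂ ih₁ ih₂ =>
    cases y with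
    | nil => simp [cmpT]
    | cons y₁ y₂ =>
      have := ih₁ y₁
      simp only [cmpT, Timed.bind_val, SExp.cons.injEq]
      rcases h : (cmpT x₁ y₁).val with _ | _ | _ <;> simp_all

@[simp] theorem eqSExpT_val (x y : SExp) : (eqSExpT x y).val = true ↔ x = y := by
  have := cmpT_eq_iff x y
  simp only [eqSExpT, Timed.bind_val]
  rcases h : (cmpT x y).val with _ | _ | _ <;> simp_all

/-- The strict order of signatures. -/
def SExp.Lt (x y : SExp) : Prop := (cmpT x y).val = .lt

theorem SExp.lt_cons {x₁ x₂ y₁ y₂ : SExp} :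
    SExp.Lt (.cons x₁ x₂) (.cons y₁ y₂) ↔ x₁.Lt y₁ ∨ x₁ = y₁ ∧ x₂.Lt y₂ := by
  rw [← cmpT_eq_iff x₁ y₁]
  simp only [SExp.Lt, cmpT, Timed.bind_val]
  rcases h : (cmpT x₁ y₁).val with _ | _ | _ <;> simp

theorem cmpT_gt_iff (x y : SExp) : (cmpT x y).val = .gt ↔ y.Lt x := by
  induction x generalizing y with
  | nil => cases y <;> simp [cmpT, SExp.Lt]
  | cons x₁ x₂ ih₁ ih₂ =>
    cases y with
    | nil => simp [cmpT, SExp.Lt]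
    | cons y₁ y₂ =>
      rw [SExp.lt_cons, ← ih₁, ← ih₂, eq_comm (a := y₁), ← cmpT_eq_iff x₁ y₁]
      simp only [cmpT, Timed.bind_val]
      rcases h : (cmpT x₁ y₁).val with _ | _ | _ <;> simp [eq_comm]

theorem SExp.lt_trans {x y z : SExp} (h₁ : x.Lt y) (h₂ : y.Lt z) : x.Lt z := by
  induction x generalizing y z with
  | nil =>
    cases z with
    | nil => cases y <;> simp [Lt, cmpT] at h₁ h₂
    | cons z₁ z₂ => simp [Lt, cmpT]
  | cons x₁ x₂ ih₁ ih₂ =>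
    cases y with
    | nil => simp [Lt, cmpT] at h₁
    | cons y₁ y₂ =>
      cases z with
      | nil => simp [Lt, cmpT] at h₂
      | cons z₁ z₂ =>
        rw [lt_cons] at h₁ h₂ ⊢
        rcases h₁ with h₁ | ⟨rfl, h₁⟩ <;> rcases h₂ with h₂ | ⟨rfl, h₂⟩
        · exact .inl (ih₁ h₁ h₂)
        · exact .inl h₁
        · exact .inl h₂
        · exact .inr ⟨rfl, ih₂ h₁ h₂⟩

theorem SExp.lt_irrefl (x : SExp) : ¬ x.Lt x := by
  rw [SExp.Lt, (cmpT_eq_iff x x).2 rfl]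
  simp

theorem mem_insertT {x y : SExp} {l : List SExp} : y ∈ (insertT x l).val ↔ y = x ∨ y ∈ l := by
  induction l with
  | nil => simp [insertT]
  | cons z l ih =>
    have := cmpT_eq_iff x z
    simp only [insertT, Timed.bind_val]
    rcases h : (cmpT x z).val with _ | _ | _
    · simp
    · obtain rfl := this.1 h
      simp
    · simp only [Timed.bind_val, Timed.pure_val, List.mem_cons, ih]
      tauto

theorem pairwise_insertT {x : SExp} {l : List SExp} (hl : l.Pairwise SExp.Lt) :
    (insertT x l).val.Pairwise SExp.Lt := by
  induction l with
  | nil => simp [insertT]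
  | cons z l ih =>
    have hl' := List.pairwise_cons.1 hl
    simp only [insertT, Timed.bind_val]
    rcases h : (cmpT x z).val with _ | _ | _
    · refine List.pairwise_cons.2 ⟨fun y hy => ?_, hl⟩
      rcases List.mem_cons.1 hy with rfl | hy
      · exact h
      · exact SExp.lt_trans h (hl'.1 y hy)
    · exact hl
    · simp only [Timed.bind_val, Timed.pure_val]
      refine List.pairwise_cons.2 ⟨fun y hy => ?_, ih hl'.2⟩
      rcases mem_insertT.1 hy with rfl | hy
      · exact (cmpT_gt_iff _ _).1 h
      · exact hl'.1 y hy

/-- The increasing list of the members of a list. -/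
def sortS (l : List SExp) : List SExp := (sortT l).val

theorem sortS_spec (l : List SExp) :
    (sortS l).Pairwise SExp.Lt ∧ ∀ y, y ∈ sortS l ↔ y ∈ l := by
  have key : ∀ (l acc : List SExp), acc.Pairwise SExp.Lt →
      (foldT (fun acc x => insertT x acc) acc l).val.Pairwise SExp.Lt ∧
      ∀ y, y ∈ (foldT (fun acc x => insertT x acc) acc l).val ↔ y ∈ l ∨ y ∈ acc := by
    intro l
    induction l with
    | nil => intro acc h; simp [foldT, h]
    | cons x l ih =>
      intro acc h
      obtain ⟨h₁, h₂⟩ := ih _ (pairwise_insertT (x := x) h)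
      simp only [foldT, Timed.bind_val]
      refine ⟨h₁, fun y => ?_⟩
      rw [h₂, mem_insertT, List.mem_cons]
      tauto
  have := key l [] List.Pairwise.nil
  simpa [sortS, sortT] using this

@[simp] theorem mem_sortS {l : List SExp} {y : SExp} : y ∈ sortS l ↔ y ∈ l := (sortS_spec l).2 y

theorem sortS_pairwise (l : List SExp) : (sortS l).Pairwise SExp.Lt := (sortS_spec l).1

theorem sortS_nodup (l : List SExp) : (sortS l).Nodup :=
  by
  refine (sortS_pairwise l).imp fun {x y} h => ?_
  rintro rfl
  exact SExp.lt_irrefl _ h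

/-- A strictly increasing list is determined by its members, so equality of the representing lists
is equality of sets. -/
theorem sortS_eq_iff {l m : List SExp} : sortS l = sortS m ↔ ∀ x, x ∈ l ↔ x ∈ m := by
  constructor
  · intro h x
    rw [← mem_sortS, h, mem_sortS]
  · intro h
    refine List.Perm.eq_of_pairwise (le := SExp.Lt) ?_ (sortS_pairwise l) (sortS_pairwise m) ?_
    · intro x y _ _ h₁ h₂
      exact absurd (SExp.lt_trans h₁ h₂) (SExp.lt_irrefl _)
    · rw [List.perm_ext_iff_of_nodup (sortS_nodup l) (sortS_nodup m)]
      simpa using h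

/-! ### Signatures -/

def SExp.bits (l : List Bool) : SExp := (bitsT l).val

def SExp.ofList (l : List SExp) : SExp := (ofListT l).val

theorem SExp.bits_injective : Function.Injective SExp.bits := by
  intro l
  induction l with
  | nil => intro m h; cases m <;> simp_all [bits, bitsT]
  | cons c l ih =>
    intro m h
    cases m with
    | nil => simp [bits, bitsT] at h
    | cons d m =>
      simp only [bits, bitsT, Timed.bind_val, Timed.pure_val, SExp.cons.injEq] at h
      rw [ih h.2]
      cases c <;> cases d <;> simp_all

theorem SExp.ofList_injective : Function.Injective SExp.ofList := by
  intro l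
  induction l with
  | nil => intro m h; cases m <;> simp_all [ofList, ofListT]
  | cons c l ih =>
    intro m h
    cases m with
    | nil => simp [ofList, ofListT] at h
    | cons d m =>
      simp only [ofList, ofListT, Timed.bind_val, Timed.pure_val, SExp.cons.injEq] at h
      rw [ih h.2, h.1]

/-- The `h`-signature of a world. -/
def DState.sig (s : DState) (h w : ℕ) : SExp := (sigT s h).val.getD w .nil

theorem sigT_length (s : DState) (h : ℕ) : (sigT s h).val.length = s.lab.length := by
  cases h <;> simp [sigT]

theorem DState.sig_zero (s : DState) {w : ℕ} (hw : w < s.lab.length) :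
    s.sig 0 w = .cons (.bits s.lab[w]) .nil := by
  simp only [sig, sigT, Timed.bind_val, mapT_val]
  rw [getD_map_of_lt _ hw]
  rfl

theorem DState.sig_succ (s : DState) (h : ℕ) {w : ℕ} (hw : w < s.lab.length) :
    s.sig (h + 1) w = .cons (.bits s.lab[w]) (.ofList (s.rel.map fun r =>
      .ofList (sortS (select (r.getD w []) (sigT s h).val)))) := by
  simp only [sig, sigT, Timed.bind_val, zipWithT_val, mapT_val, idxT_val, nthT_val, selectT_val,
    Timed.pure_val]
  rw [getD_zipWith_of_lt _ hw (by simpa using hw)]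
  simp only [List.getElem_range', Nat.zero_add, Nat.one_mul]
  rfl

theorem DState.mem_succSigs {s : DState} {i : Fin a} {h w : ℕ} {x : SExp} :
    x ∈ select ((s.rel.getD i []).getD w []) (sigT s h).val ↔
      ∃ v : Fin s.lab.length, s.adj i w v = true ∧ x = s.sig h v := by
  rw [mem_select]
  constructor
  · rintro ⟨j, h₁, h₂⟩
    obtain ⟨hj, rfl⟩ := List.getElem?_eq_some_iff.1 h₂
    refine ⟨⟨j, by rwa [sigT_length] at hj⟩, h₁, ?_⟩
    rw [sig, List.getD_eq_getElem _ _ hj]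
  · rintro ⟨v, h₁, rfl⟩
    have hv : (v : ℕ) < (sigT s h).val.length := by rw [sigT_length]; exact v.2
    refine ⟨v, h₁, ?_⟩
    rw [sig, List.getD_eq_getElem _ _ hv, List.getElem?_eq_getElem hv]

theorem DState.label_eq_iff {s t : DState} (hs : s.WF a p) (ht : t.WF a p)
    (w : Fin s.lab.length) (v : Fin t.lab.length) :
    (s.model a p).L w = (t.model a p).L v ↔ s.lab[w] = t.lab[v] := by
  have h₁ := hs.lab _ (List.getElem_mem w.2)
  have h₂ := ht.lab _ (List.getElem_mem v.2)
  simp only [DState.model]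
  rw [List.getD_eq_getElem s.lab _ w.2, List.getD_eq_getElem t.lab _ v.2]
  constructor
  · intro H
    refine List.ext_getElem (h₁.trans h₂.symm) fun q hq hq' => ?_
    have := Set.ext_iff.1 H ⟨q, h₁ ▸ hq⟩
    simp only [Set.mem_ofPred_eq] at this
    rw [List.getD_eq_getElem s.lab[(w : ℕ)] _ hq, List.getD_eq_getElem t.lab[(v : ℕ)] _ hq'] at this
    exact Bool.eq_iff_iff.2 this
  · intro H
    simp only [Fin.getElem_fin] at H
    rw [H]

theorem getElem_eq_of_map_eq {α β γ : Type} {f : α → γ} {g : β → γ} {l : List α} {m : List β}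
    (h : l.map f = m.map g) {i : ℕ} (hi : i < l.length) (hi' : i < m.length) :
    f l[i] = g m[i] := by
  have := List.getElem_map f (l := l) (i := i) (h := by simpa using hi)
  rw [← this, ← List.getElem_map g (l := m) (i := i) (h := by simpa using hi')]
  simp only [h]

/-- Worlds with the same signature are bisimilar, even if the signatures are for different
bounds. -/
theorem nbis_of_sig_eq {s t : DState} (hs : s.WF a p) (ht : t.WF a p) {h k : ℕ} (hk : h ≤ k)
    {w : Fin s.lab.length} {v : Fin t.lab.length} (H : s.sig h w = t.sig k v) :
    NBis (s.model a p) (t.model a p) h w v := by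
  have lab : ∀ {h k : ℕ} {w : Fin s.lab.length} {v : Fin t.lab.length},
      s.sig h w = t.sig k v → (s.model a p).L w = (t.model a p).L v := by
    intro h k w v H
    rw [DState.label_eq_iff hs ht]
    apply SExp.bits_injective
    cases h <;> cases k <;>
      simp only [DState.sig_zero _ w.2, DState.sig_zero _ v.2, DState.sig_succ _ _ w.2,
        DState.sig_succ _ _ v.2, SExp.cons.injEq] at H <;> exact H.1
  induction h generalizing k w v with
  | zero => exact lab H
  | succ h ih =>
    -- From `h + 1 ≤ k` the second signature also has positive height, so both list the signatures
    -- of successors, again at heights in the right order.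
    obtain ⟨k, rfl⟩ : ∃ j, k = j + 1 := ⟨k - 1, by omega⟩
    refine ⟨lab H, fun i => ?_⟩
    rw [DState.sig_succ _ _ w.2, DState.sig_succ _ _ v.2, SExp.cons.injEq] at H
    have hi : (i : ℕ) < s.rel.length := by rw [hs.rel]; exact i.2
    have hi' : (i : ℕ) < t.rel.length := by rw [ht.rel]; exact i.2
    have := sortS_eq_iff.1
      (SExp.ofList_injective (getElem_eq_of_map_eq (SExp.ofList_injective H.2) hi hi'))
    rw [← List.getD_eq_getElem s.rel [] hi, ← List.getD_eq_getElem t.rel [] hi'] at this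
    simp only [DState.mem_succSigs] at this
    constructor
    · intro w' hw
      obtain ⟨v', h₁, h₂⟩ := (this _).1 ⟨w', hw, rfl⟩
      exact ⟨v', h₁, ih (by omega) h₂⟩
    · intro v' hv
      obtain ⟨w', h₁, h₂⟩ := (this _).2 ⟨v', hv, rfl⟩
      exact ⟨w', h₁, ih (by omega) h₂.symm⟩

/-- Partners among the successors have equal signatures by induction, so the sets coincide. With
`nbis_of_sig_eq`, equality of `h`-signatures is `h`-bisimilarity, also between different states. -/
theorem sig_eq_of_nbis {s t : DState} (hs : s.WF a p) (ht : t.WF a p) {h : ℕ}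
    {w : Fin s.lab.length} {v : Fin t.lab.length}
    (H : NBis (s.model a p) (t.model a p) h w v) : s.sig h w = t.sig h v := by
  have lab : s.lab[w] = t.lab[v] := (DState.label_eq_iff hs ht w v).1 H.label
  induction h generalizing w v with
  | zero => rw [DState.sig_zero _ w.2, DState.sig_zero _ v.2]; simp only [Fin.getElem_fin] at lab; rw [lab]
  | succ h ih =>
    rw [DState.sig_succ _ _ w.2, DState.sig_succ _ _ v.2]
    simp only [Fin.getElem_fin] at lab
    rw [lab]
    congr 2
    refine List.ext_getElem (by simp [hs.rel, ht.rel]) fun i hi hi' => ?_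
    have hi : i < s.rel.length := by simpa using hi
    have hi' : i < t.rel.length := by simpa using hi'
    rw [List.getElem_map, List.getElem_map]
    congr 1
    rw [sortS_eq_iff, ← List.getD_eq_getElem s.rel [] hi, ← List.getD_eq_getElem t.rel [] hi']
    intro x
    have hia : i < a := hs.rel ▸ hi
    rw [DState.mem_succSigs (i := ⟨i, hia⟩), DState.mem_succSigs (i := ⟨i, hia⟩)]
    constructor
    · rintro ⟨w', h₁, rfl⟩
      obtain ⟨v', h₂, h₃⟩ := (H.2 ⟨i, hia⟩).1 w' h₁
      exact ⟨v', h₂, ih h₃ ((DState.label_eq_iff hs ht _ _).1 h₃.label)⟩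
    · rintro ⟨v', h₁, rfl⟩
      obtain ⟨w', h₂, h₃⟩ := (H.2 ⟨i, hia⟩).2 v' h₁
      exact ⟨w', h₂, (ih h₃ ((DState.label_eq_iff hs ht _ _).1 h₃.label)).symm⟩

end DEL

namespace DEL

variable {a p : ℕ}

/-! ### The number and the size of signatures -/

def SExp.size : SExp → ℕ
  | .nil => 0
  | .cons x y => x.size + y.size + 1

theorem SExp.size_bits (l : List Bool) : (SExp.bits l).size ≤ 2 * l.length := by
  induction l with
  | nil => simp [bits, bitsT, size]
  | cons c l ih =>
    simp only [bits] at ih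
    cases c <;> simp [bits, bitsT, size] <;> omega

theorem SExp.size_ofList {l : List SExp} {n : ℕ} (h : ∀ x ∈ l, x.size ≤ n) :
    (SExp.ofList l).size ≤ l.length * (n + 1) := by
  induction l with
  | nil => simp [ofList, ofListT, size]
  | cons x l ih =>
    have h₁ := h x (by simp)
    have h₂ := ih fun y hy => h y (by simp [hy])
    simp only [ofList, ofListT, Timed.bind_val, Timed.pure_val, size, List.length_cons] at h₂ ⊢
    linarith

noncomputable instance : DecidableEq SExp := Classical.decEq _

/-- The `h`-signatures for `a` agents and `p` atoms. -/
noncomputable def sigSet (a p : ℕ) : ℕ → Finset SExp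
  | 0 => (Finset.univ : Finset (Fin p → Bool)).image fun L => .cons (.bits (List.ofFn L)) .nil
  | h + 1 => ((Finset.univ : Finset (Fin p → Bool)) ×ˢ
      Fintype.piFinset fun _ : Fin a => (sigSet a p h).powerset).image fun x =>
        .cons (.bits (List.ofFn x.1))
          (.ofList (List.ofFn fun i => .ofList (sortS (x.2 i).toList)))

/-- A bound for the number and the size of `h`-signatures, where `x` is the number of agents
and atoms. -/
def sigBound (x : ℕ) : ℕ → ℕ
  | 0 => 2 ^ (4 * x)
  | h + 1 => 2 ^ (4 * x * sigBound x h)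

theorem one_le_sigBound (x h : ℕ) : 1 ≤ sigBound x h := by
  cases h <;> exact Nat.one_le_two_pow

/-- A label and one set of `h`-signatures per agent: from `n` signatures there arise at most `2^p ·
(2^n)^a = 2^(p + n·a)`. -/
theorem card_sigSet_le (a p h : ℕ) : (sigSet a p h).card ≤ sigBound (a + p) h := by
  induction h with
  | zero =>
    refine Finset.card_image_le.trans ?_
    simp only [Finset.card_univ, Fintype.card_fun, Fintype.card_bool, Fintype.card_fin, sigBound]
    exact Nat.pow_le_pow_right (by omega) (by omega)
  | succ h ih =>
    refine Finset.card_image_le.trans ?_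
    have h₁ := one_le_sigBound (a + p) h
    simp only [Finset.card_product, Finset.card_univ, Fintype.card_fun, Fintype.card_bool,
      Fintype.card_fin, Fintype.card_piFinset, Finset.card_powerset, Finset.prod_const, sigBound]
    rw [← pow_mul, ← pow_add]
    refine Nat.pow_le_pow_right (by omega) ?_
    have h₂ : (sigSet a p h).card * a ≤ sigBound (a + p) h * a := Nat.mul_le_mul_right _ ih
    have h₃ : p * 1 ≤ p * sigBound (a + p) h := Nat.mul_le_mul_left _ h₁
    have h₄ : 4 * (a + p) * sigBound (a + p) h =
      4 * (a * sigBound (a + p) h) + 4 * (p * sigBound (a + p) h) := by ring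
    rw [h₄]
    rw [mul_comm _ a, mul_comm _ a] at h₂
    rw [mul_comm _ a]
    omega

/-- The factor 4 in `sigBound` comes from here: the size of a signature is bounded by a polynomial
of degree 4, which has to fit under the same exponential as the count. -/
theorem succ_pow_four_le (y : ℕ) : (y + 1) ^ 4 ≤ 2 ^ (4 * y) := by
  rw [mul_comm, pow_mul]
  exact Nat.pow_le_pow_left (Nat.lt_two_pow_self) 4

/-- A signature lists at most `a` sets, each with at most `sigBound` members of size at most
`sigBound` of the previous height. -/
theorem size_le_of_mem_sigSet {h : ℕ} {x : SExp} (hx : x ∈ sigSet a p h) :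
    x.size ≤ sigBound (a + p) h := by
  induction h generalizing x with
  | zero =>
    obtain ⟨L, -, rfl⟩ := Finset.mem_image.1 hx
    have h₁ := SExp.size_bits (List.ofFn L)
    have h₂ := succ_pow_four_le (a + p)
    simp only [List.length_ofFn, SExp.size, sigBound] at h₁ ⊢
    nlinarith [Nat.zero_le a, Nat.zero_le p, Nat.zero_le ((a + p) ^ 2), Nat.zero_le ((a + p) ^ 3),
      Nat.zero_le ((a + p) ^ 4)]
  | succ h ih =>
    obtain ⟨⟨L, S⟩, hS, rfl⟩ := Finset.mem_image.1 hx
    have hS' := Fintype.mem_piFinset.1 (Finset.mem_product.1 hS).2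
    simp only [Finset.mem_powerset] at hS'
    have h₁ := SExp.size_bits (List.ofFn L)
    set G := sigBound (a + p) h with hG
    have h₂ : ∀ i : Fin a, (SExp.ofList (sortS (S i).toList)).size ≤ G * (G + 1) := by
      intro i
      refine (SExp.size_ofList (n := G) fun y hy => ih (hS' i (by simpa using hy))).trans ?_
      refine Nat.mul_le_mul_right _ ((?_ : _ ≤ (S i).card).trans
        ((Finset.card_le_card (hS' i)).trans (card_sigSet_le a p h)))
      rw [← Finset.length_toList]
      refine ((sortS_nodup _).subperm fun y hy => ?_).length_le
      simpa using hy
    have h₃ := SExp.size_ofList (n := G * (G + 1))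
      (l := List.ofFn fun i => SExp.ofList (sortS (S i).toList)) (by
        intro y hy
        obtain ⟨i, rfl⟩ := (List.mem_ofFn' _ _).1 hy
        exact h₂ i)
    have h₄ := succ_pow_four_le ((a + p) * G)
    have h₅ : 1 ≤ G := one_le_sigBound (a + p) h
    simp only [List.length_ofFn, SExp.size, sigBound] at h₁ h₃ ⊢
    rw [← hG, mul_assoc]
    refine le_trans ?_ h₄
    set y := (a + p) * G with hy
    have h₆ : a * G ≤ y := Nat.mul_le_mul_right _ (by omega)
    have h₇ : p * 1 ≤ y := Nat.mul_le_mul (by omega) h₅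
    have h₈ : a * (G * G) ≤ y * y := by
      have : a ≤ a * a := Nat.le_mul_self a
      calc a * (G * G) ≤ a * a * (G * G) := Nat.mul_le_mul_right _ this
        _ = (a * G) * (a * G) := by ring
        _ ≤ y * y := Nat.mul_le_mul h₆ h₆
    have h₉ : a * 1 ≤ y := Nat.mul_le_mul (by omega) h₅
    nlinarith [Nat.zero_le (y ^ 2), Nat.zero_le (y ^ 3), Nat.zero_le (y ^ 4)]

theorem exists_eq_ofFn {α : Type} {l : List α} {n : ℕ} (h : l.length = n) :
    ∃ f : Fin n → α, l = List.ofFn f := by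
  subst h
  exact ⟨l.get, (List.ofFn_get l).symm⟩

/-- The sets of signatures of successors lie in the previous level by induction, and sorting forgets
order and repetitions, so passing to a `Finset` and back changes nothing. -/
theorem DState.sig_mem_sigSet {s : DState} (hs : s.WF a p) (h : ℕ) {w : ℕ}
    (hw : w < s.lab.length) : s.sig h w ∈ sigSet a p h := by
  obtain ⟨L, hL⟩ := exists_eq_ofFn (hs.lab _ (List.getElem_mem hw))
  induction h generalizing w L with
  | zero =>
    rw [s.sig_zero hw, hL]
    exact Finset.mem_image.2 ⟨L, Finset.mem_univ _, rfl⟩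
  | succ h ih =>
    rw [s.sig_succ h hw, hL]
    have hsub : ∀ (i : Fin a) (x : SExp),
        x ∈ select ((s.rel.getD i []).getD w []) (sigT s h).val → x ∈ sigSet a p h := by
      intro i x hx
      obtain ⟨v, -, rfl⟩ := DState.mem_succSigs.1 hx
      obtain ⟨L', hL'⟩ := exists_eq_ofFn (hs.lab _ (List.getElem_mem v.2))
      exact ih v.2 L' hL'
    refine Finset.mem_image.2 ⟨(L, fun i =>
      (select ((s.rel.getD i []).getD w []) (sigT s h).val).toFinset), ?_, ?_⟩
    · refine Finset.mem_product.2 ⟨Finset.mem_univ _, Fintype.mem_piFinset.2 fun i => ?_⟩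
      rw [Finset.mem_powerset]
      intro x hx
      exact hsub i x (by simpa using hx)
    · simp only
      congr 2
      refine List.ext_getElem (by simp [hs.rel]) fun i hi hi' => ?_
      have hi' : i < s.rel.length := by simpa using hi'
      rw [List.getElem_ofFn, List.getElem_map]
      congr 1
      rw [sortS_eq_iff]
      intro x
      simp only [List.getD_eq_getElem s.rel [] hi', Finset.mem_toList, List.mem_toFinset]

/-! ### Estimates by iterated exponentials -/

theorem sigBound_mono (x : ℕ) {h k : ℕ} (hk : h ≤ k) : sigBound x h ≤ sigBound x k := by
  refine monotone_nat_of_le_succ (fun h => ?_) hk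
  rcases Nat.eq_zero_or_pos x with rfl | hx
  · cases h <;> simp [sigBound]
  · refine Nat.lt_two_pow_self.le.trans (Nat.pow_le_pow_right (by omega) ?_)
    exact Nat.le_mul_of_pos_left _ (by omega)

/-- A factor is pushed down the tower one exponential at a time: `c ≤ 2^(c-1)`, and `c - 1 + y ≤
c·y` for `y ≥ 1`. Positivity of `x` is needed at the bottom. -/
theorem mul_exp2_le (n : ℕ) {x : ℕ} (hx : 1 ≤ x) (c : ℕ) :
    c * exp2 n x ≤ exp2 n (c * x) := by
  induction n generalizing c with
  | zero => exact le_rfl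
  | succ n ih =>
    rcases Nat.eq_zero_or_pos c with rfl | hc
    · simp
    have h₁ : 1 ≤ exp2 n x := by
      cases n with
      | zero => exact hx
      | succ n => exact Nat.one_le_two_pow
    calc c * 2 ^ exp2 n x ≤ 2 ^ (c - 1) * 2 ^ exp2 n x := by
          have : c - 1 < 2 ^ (c - 1) := Nat.lt_two_pow_self
          exact Nat.mul_le_mul_right _ (by omega)
      _ = 2 ^ (c - 1 + exp2 n x) := (pow_add _ _ _).symm
      _ ≤ 2 ^ (c * exp2 n x) := by
          refine Nat.pow_le_pow_right (by omega) ?_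
          obtain ⟨d, rfl⟩ : ∃ d, c = d + 1 := ⟨c - 1, by omega⟩
          have := Nat.mul_le_mul_left d h₁
          rw [add_mul]
          omega
      _ ≤ 2 ^ exp2 n (c * x) := Nat.pow_le_pow_right (by omega) (ih c)

theorem exp2_pow_le (n : ℕ) {x : ℕ} (hx : 1 ≤ x) (c : ℕ) :
    exp2 (n + 1) x ^ c ≤ exp2 (n + 1) (c * x) := by
  change (2 ^ exp2 n x) ^ c ≤ 2 ^ exp2 n (c * x)
  rw [← pow_mul, mul_comm]
  exact Nat.pow_le_pow_right (by omega) (mul_exp2_le n hx c)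

theorem exp2_le_succ (n x : ℕ) : exp2 n x ≤ exp2 (n + 1) x := Nat.lt_two_pow_self.le

theorem le_exp2 (n x : ℕ) : n ≤ exp2 n x := by
  induction n with
  | zero => exact Nat.zero_le _
  | succ n ih => exact lt_of_le_of_lt ih Nat.lt_two_pow_self

/-- The factor `4x` recurs at every level of `sigBound`, so the bare inequality does not pass
through the induction. The strengthened claim carries `2·4x` along: writing `A = 4x·sigBound x h`,
one has `2·4x·2^A ≤ 2^(2A)`, and the case of height 0 gives `8x·2^(4x) ≤ 2^(12x)`. -/
theorem sigBound_le_exp2 (x h : ℕ) : sigBound x h ≤ exp2 (h + 1) (12 * x) := by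
  rcases Nat.eq_zero_or_pos x with rfl | hx
  · cases h <;> simp only [sigBound, Nat.mul_zero, Nat.zero_mul, pow_zero] <;>
      exact Nat.one_le_two_pow
  suffices 2 * (4 * x * sigBound x h) ≤ exp2 (h + 1) (12 * x) by
    refine le_trans ?_ this
    rw [← mul_assoc]
    exact Nat.le_mul_of_pos_left _ (by omega)
  induction h with
  | zero =>
    simp only [sigBound, exp2]
    rw [show 12 * x = 8 * x + 4 * x by ring, pow_add, ← mul_assoc, ← mul_assoc]
    exact Nat.mul_le_mul_right _ Nat.lt_two_pow_self.le
  | succ h ih =>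
    set A := 4 * x * sigBound x h with hA
    have h₁ : 4 * x ≤ A := Nat.le_mul_of_pos_right _ (one_le_sigBound x h)
    have h₂ : 2 * A ≤ 2 ^ A := by
      obtain ⟨B, hB⟩ : ∃ B, A = B + 1 := ⟨A - 1, by omega⟩
      rw [hB, pow_succ, mul_comm]
      exact Nat.mul_le_mul_right _ Nat.lt_two_pow_self
    calc 2 * (4 * x * 2 ^ A) = 2 * (4 * x) * 2 ^ A := by ring
      _ ≤ 2 ^ A * 2 ^ A := Nat.mul_le_mul_right _ (le_trans (by omega) h₂)
      _ = 2 ^ (2 * A) := by rw [← pow_add, two_mul]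
      _ ≤ 2 ^ exp2 (h + 1) (12 * x) := Nat.pow_le_pow_right (by omega) ih

end DEL

namespace DEL

variable {a p : ℕ}

/-! ### Bounds of worlds -/

/-- The state of the computation of bounds when all bounds that are at least `r` are known. -/
structure BoundsInv (s : DState) (b r : ℕ) (cur : List (Option ℕ)) : Prop where
  len : cur.length = s.lab.length
  root : cur.getD s.des none = some b
  ge : ∀ w h, cur.getD w none = some h → r ≤ h ∧ h ≤ b
  succ : ∀ w h, cur.getD w none = some h → r < h → ∀ i v, s.adj i w v = true →
    ∃ h', cur.getD v none = some h' ∧ h ≤ h' + 1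
  pred : ∀ w h, cur.getD w none = some h →
    h = b ∧ w = s.des ∨ ∃ i v, s.adj i v w = true ∧ cur.getD v none = some (h + 1)

theorem lt_of_getD_eq_some {α : Type} {l : List (Option α)} {j : ℕ} {x : α}
    (h : l.getD j none = some x) : j < l.length := by
  by_contra hj
  rw [List.getD_eq_default _ _ (by omega)] at h
  exact absurd h (by simp)

/-- One step of the computation of bounds. -/
def boundsStep (s : DState) (r : ℕ) (cur : List (Option ℕ)) : List (Option ℕ) :=
  List.zipWith (fun (o : Option ℕ) w =>
    match o with
    | some h => some h
    | none => if s.rel.any fun rel => (List.zipWith (fun (o₁ : Option ℕ) row =>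
        match o₁ with
        | some _ => row.getD w false
        | none => false) cur rel).any id then some r else none) cur (List.range s.lab.length)

theorem boundsGoT_succ_val (s : DState) (r : ℕ) (cur : List (Option ℕ)) :
    (boundsGoT s (r + 1) cur).val = (boundsGoT s r (boundsStep s r cur)).val := by
  simp only [boundsGoT, Timed.bind_val, zipWithT_val, idxT_val, ← List.range_eq_range', boundsStep]
  congr 3
  funext o w
  cases o with
  | some h => rfl
  | none =>
    simp only [Timed.bind_val, anyT_val, zipWithT_val, Timed.pure_val]
    congr 4
    funext rel
    congr 2
    funext o row
    cases o <;> simp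

theorem boundsStep_getD {s : DState} (hs : s.WF a p) (r : ℕ) {cur : List (Option ℕ)}
    (hcur : cur.length = s.lab.length) {w : ℕ} (hw : w < s.lab.length) :
    (∀ h, cur.getD w none = some h → (boundsStep s r cur).getD w none = some h) ∧
    (cur.getD w none = none →
      ((∃ i v h, s.adj i v w = true ∧ cur.getD v none = some h) →
        (boundsStep s r cur).getD w none = some r) ∧
      ((¬ ∃ i v h, s.adj i v w = true ∧ cur.getD v none = some h) →
        (boundsStep s r cur).getD w none = none)) := by
  have hw' : w < cur.length := by omega
  have hw'' : w < (List.range s.lab.length).length := by simpa using hw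
  have key : (s.rel.any fun rel => (List.zipWith (fun (o₁ : Option ℕ) row =>
        match o₁ with
        | some _ => row.getD w false
        | none => false) cur rel).any id) = true ↔
      ∃ i v h, s.adj i v w = true ∧ cur.getD v none = some h := by
    rw [List.any_eq_true]
    constructor
    · rintro ⟨rel, hrel, H⟩
      obtain ⟨i, hi, rfl⟩ := List.mem_iff_getElem.1 hrel
      rw [List.any_eq_true] at H
      obtain ⟨x, hx, hx'⟩ := H
      obtain ⟨v, hv, rfl⟩ := List.mem_iff_getElem.1 hx
      have hv' : v < cur.length ∧ v < s.rel[i].length := by simpa using hv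
      rw [id, List.getElem_zipWith] at hx'
      rcases ho : cur[v] with _ | h
      · simp [ho] at hx'
      · refine ⟨i, v, h, ?_, by rw [List.getD_eq_getElem _ _ hv'.1, ho]⟩
        rw [DState.adj, List.getD_eq_getElem s.rel _ hi, List.getD_eq_getElem _ _ hv'.2]
        simpa [ho] using hx'
    · rintro ⟨i, v, h, h₁, h₂⟩
      obtain ⟨hi, hv, -⟩ := hs.lt_of_adj h₁
      have hi' : i < s.rel.length := hs.rel ▸ hi
      have hv' : v < s.rel[i].length := by rw [hs.rows _ (List.getElem_mem hi')]; exact hv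
      have hv'' : v < cur.length := by omega
      refine ⟨s.rel[i], List.getElem_mem hi', List.any_eq_true.2 ⟨_, List.mem_iff_getElem.2
        ⟨v, by simp; omega, rfl⟩, ?_⟩⟩
      rw [DState.adj, List.getD_eq_getElem s.rel _ hi', List.getD_eq_getElem _ _ hv'] at h₁
      rw [List.getD_eq_getElem _ _ hv''] at h₂
      simpa [h₂] using h₁
  rw [boundsStep, getD_zipWith_of_lt _ hw' hw'', List.getElem_range, List.getD_eq_getElem _ _ hw']
  refine ⟨fun h H => by rw [H], fun H => ⟨fun H' => ?_, fun H' => ?_⟩⟩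
  · rw [H]
    exact if_pos (key.2 H')
  · rw [H]
    exact if_neg fun h => H' (key.1 h)

/-- Worlds whose bound exceeds `r + 1` have only known successors, so a world first reached in this
round is reached from a world with bound exactly `r + 1`. -/
theorem BoundsInv.step {s : DState} (hs : s.WF a p) {b r : ℕ} {cur : List (Option ℕ)}
    (H : BoundsInv s b (r + 1) cur) (hr : r ≤ b) : BoundsInv s b r (boundsStep s r cur) := by
  have hlen : (boundsStep s r cur).length = s.lab.length := by simp [boundsStep, H.len]
  have keep : ∀ w h, cur.getD w none = some h → (boundsStep s r cur).getD w none = some h := by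
    intro w h hw
    exact (boundsStep_getD hs r H.len (H.len ▸ lt_of_getD_eq_some hw)).1 h hw
  have new : ∀ w h, (boundsStep s r cur).getD w none = some h → cur.getD w none = some h ∨
      h = r ∧ cur.getD w none = none ∧ ∃ i v h', s.adj i v w = true ∧ cur.getD v none = some h' := by
    intro w h hw
    have hw' : w < s.lab.length := hlen ▸ lt_of_getD_eq_some hw
    have h₁ := boundsStep_getD hs r H.len hw'
    rcases ho : cur.getD w none with _ | h'
    · right
      by_cases hex : ∃ i v h', s.adj i v w = true ∧ cur.getD v none = some h'
      · rw [(h₁.2 ho).1 hex, Option.some_inj] at hw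
        exact ⟨hw.symm, rfl, hex⟩
      · rw [(h₁.2 ho).2 hex] at hw
        exact absurd hw (by simp)
    · left
      rw [h₁.1 h' ho] at hw
      exact hw
  refine ⟨hlen, keep _ _ H.root, fun w h hw => ?_, fun w h hw hrh i v hv => ?_, fun w h hw => ?_⟩
  · rcases new w h hw with h₁ | ⟨rfl, -⟩
    · have := H.ge w h h₁
      omega
    · omega
  · rcases new w h hw with h₁ | ⟨rfl, -⟩
    · have hv' := (hs.lt_of_adj hv).2.2
      rcases ho : cur.getD v none with _ | h'
      -- If `h` exceeded `r + 1`, the successor would already have had a bound; hence `h ≤ r + 1`.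
      · refine ⟨r, ((boundsStep_getD hs r H.len hv').2 ho).1 ⟨i, w, h, hv, h₁⟩, ?_⟩
        by_contra hlt
        obtain ⟨h', h₂, -⟩ := H.succ w h h₁ (by omega) i v hv
        rw [ho] at h₂
        exact absurd h₂ (by simp)
      · refine ⟨h', keep _ _ ho, ?_⟩
        by_cases hlt : r + 1 < h
        · obtain ⟨h'', h₂, h₃⟩ := H.succ w h h₁ hlt i v hv
          rw [ho] at h₂
          obtain rfl := Option.some.inj h₂
          exact h₃
        · have := H.ge v h' ho
          omega
    · omega
  · rcases new w h hw with h₁ | ⟨rfl, h₁, i, v, h', h₂, h₃⟩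
    · rcases H.pred w h h₁ with h₂ | ⟨i, v, h₂, h₃⟩
      · exact .inl h₂
      · exact .inr ⟨i, v, h₂, keep _ _ h₃⟩
    · refine .inr ⟨i, v, h₂, keep _ _ ?_⟩
      have h₄ := H.ge v h' h₃
      -- The predecessor has exactly one more: with a larger bound, the new world would have been
      -- known before.
      by_cases hlt : h + 1 < h'
      · obtain ⟨h'', h₅, -⟩ := H.succ v h' h₃ hlt i w h₂
        rw [h₁] at h₅
        exact absurd h₅ (by simp)
      · rw [h₃, show h' = h + 1 by omega]

/-- The list of the bounds of the worlds. -/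
def DState.bounds (s : DState) (b : ℕ) : List (Option ℕ) := (boundsT s b).val

/-- The computation starts with the root alone, at `r = b`. At `r = 0` the invariant contains all
that contractions need to know of distances: from a positive bound an edge leads to a bound smaller
by at most one, and each bound below `b` is one less than that of some predecessor. -/
theorem bounds_inv {s : DState} (hs : s.WF a p) (b : ℕ) : BoundsInv s b 0 (s.bounds b) := by
  have key : ∀ r cur, r ≤ b → BoundsInv s b r cur → BoundsInv s b 0 (boundsGoT s r cur).val := by
    intro r
    induction r with
    | zero => intro cur _ H; exact H
    | succ r ih =>
      intro cur hr H
      rw [boundsGoT_succ_val]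
      exact ih _ (by omega) (H.step hs (by omega))
  simp only [DState.bounds, boundsT, Timed.bind_val, mapT_val, idxT_val, eqNatT_val,
    ← List.range_eq_range', Timed.pure_val]
  have hroot : ∀ w h, (((List.range s.lab.length).map fun w =>
      if decide (w = s.des) = true then some b else none).getD w none = some h) →
      w = s.des ∧ h = b := by
    intro w h H
    have hw := lt_of_getD_eq_some H
    rw [getD_range_map _ (by simpa using hw)] at H
    by_cases hd : w = s.des
    · simp only [hd, decide_true, if_true, Option.some_inj] at H
      exact ⟨hd, H.symm⟩
    · simp [hd] at H
  refine key _ _ le_rfl ⟨by simp, ?_, ?_, ?_, ?_⟩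
  · rw [getD_range_map _ hs.des]
    simp
  · intro w h H
    obtain ⟨-, rfl⟩ := hroot w h H
    exact ⟨le_rfl, le_rfl⟩
  · intro w h H hlt
    obtain ⟨-, rfl⟩ := hroot w h H
    exact absurd hlt (lt_irrefl _)
  · intro w h H
    exact .inl (hroot w h H).symm

end DEL

namespace DEL

variable {a p : ℕ}

/-! ### Canonical contractions -/

theorem eqSExpT_val' (x y : SExp) : (eqSExpT x y).val = decide (x = y) :=
  Bool.eq_iff_iff.2 (by rw [eqSExpT_val, decide_eq_true_eq])

/-- The lists of the `0`-, …, `b`-signatures. -/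
def DState.sigs (s : DState) (b : ℕ) : List (List SExp) :=
  (List.range (b + 1)).map fun h => (sigT s h).val

theorem DState.getD_sigs (s : DState) {b h : ℕ} (hh : h ≤ b) (w : ℕ) :
    ((s.sigs b).getD h []).getD w .nil = s.sig h w := by
  rw [sigs, getD_range_map _ (by omega)]
  rfl

def DState.reps (s : DState) (b : ℕ) : List Rep := (repsT (s.sigs b) (s.bounds b)).val

/-- The worlds that are not strictly represented. -/
noncomputable def DState.maxReps (s : DState) (b : ℕ) : List Rep :=
  (s.reps b).filter fun x => !(s.reps b).any fun y =>
    decide (x.bound + 1 ≤ y.bound) && decide (((s.sigs b).getD x.bound []).getD x.world .nil =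
      ((s.sigs b).getD x.bound []).getD y.world .nil)

noncomputable def DState.repSigs (s : DState) (b : ℕ) : List SExp :=
  sortS ((s.maxReps b).map Rep.sig)

/-- The representatives of the worlds of the contraction. -/
noncomputable def DState.repWorlds (s : DState) (b : ℕ) : List Rep :=
  (s.repSigs b).map fun z => (s.maxReps b).getD
    ((s.maxReps b).findIdx fun x => decide (z = x.sig)) ⟨0, 0, .nil⟩

/-- The world of the contraction to which the edges to `v` from worlds with bound `h + 1` are
redirected. -/
noncomputable def DState.target (s : DState) (b h v : ℕ) : ℕ :=
  (s.repWorlds b).findIdx fun y => decide (h ≤ y.bound) &&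
    decide (((s.sigs b).getD h []).getD y.world .nil = ((s.sigs b).getD h []).getD v .nil)

/-- The rows of the relations of the contraction. -/
noncomputable def DState.contractRow (s : DState) (b : ℕ) (r : List (List Bool)) (x : Rep) :
    List Bool :=
  match x.bound with
  | 0 => (List.range (s.repWorlds b).length).map fun _ => false
  | h + 1 => (List.range (s.repWorlds b).length).map fun j =>
      (((List.range s.lab.length).filter fun v => (r.getD x.world []).getD v false).map fun v =>
        s.target b h v).any fun t => decide (t = j)

def DState.contract (s : DState) (b : ℕ) : DState := (contractT s b).val

theorem sigs_val (s : DState) (b : ℕ) :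
    (mapT (sigT s) (revT (downT b).val []).val).val = s.sigs b := by
  simp [DState.sigs]

theorem maxReps_val (s : DState) (b : ℕ) : (filterT (fun x => do
    let strict ← anyT (fun y => do
      let larger ← leT (x.bound + 1) y.bound
      let same ← sameSigT (s.sigs b) x.bound x.world y.world
      pure (larger && same)) (s.reps b)
    pure (!strict)) (s.reps b)).val = s.maxReps b := by
  simp only [filterT_val, Timed.bind_val, anyT_val, leT_val, sameSigT, nth₂T_val, eqSExpT_val',
    Timed.pure_val, DState.maxReps]

theorem repSigs_val (s : DState) (b : ℕ) :
    (sortT ((s.maxReps b).map Rep.sig)).val = s.repSigs b := rfl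

theorem repWorlds_val (s : DState) (b : ℕ) : (mapT (fun z => do
    let j ← findT (fun x : Rep => eqSExpT z x.sig) (s.maxReps b) 0
    nthT ⟨0, 0, .nil⟩ (s.maxReps b) j) (s.repSigs b)).val = s.repWorlds b := by
  simp only [mapT_val, Timed.bind_val, findT_val, nthT_val, eqSExpT_val', Nat.zero_add,
    DState.repWorlds]

theorem contract_eq (s : DState) (b : ℕ) : s.contract b =
    { lab := (s.repWorlds b).map fun x => s.lab.getD x.world []
      rel := s.rel.map fun r => (s.repWorlds b).map (s.contractRow b r)
      des := (s.repSigs b).findIdx fun z =>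
        decide (((s.sigs b).getD b []).getD s.des .nil = z) } := by
  simp only [DState.contract, contractT, Timed.bind_val, sigs_val]
  change DState.mk _ _ _ = _
  rw [show (repsT (s.sigs b) (boundsT s b).val).val = s.reps b from rfl, maxReps_val,
    mapT_val (fun x : Rep => (pure x.sig : Timed SExp))]
  simp only [Timed.pure_val]
  rw [show (s.maxReps b).map (fun x => x.sig) = (s.maxReps b).map Rep.sig from rfl, repSigs_val,
    repWorlds_val]
  simp only [mapT_val, idxT_val, nthT_val, ← List.range_eq_range', findT_val, Nat.zero_add,
    nth₂T_val, eqSExpT_val']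
  congr 1
  refine List.map_congr_left fun r _ => List.map_congr_left fun x _ => ?_
  unfold DState.contractRow
  cases x.bound with
  | zero => simp only [mapT_val, Timed.pure_val]
  | succ h =>
    simp only [Timed.bind_val, mapT_val, filterT_val, nth₂T_val, findT_val, leT_val, sameSigT,
      eqSExpT_val', Timed.pure_val, anyT_val, eqNatT_val, Nat.zero_add, DState.target]

/-! ### Maximal representatives, and bisimilarity of a state with its contraction -/

variable {s t : DState} {b : ℕ}

theorem mem_reps {x : Rep} :
    x ∈ s.reps b ↔ (s.bounds b).getD x.world none = some x.bound ∧
      x.sig = ((s.sigs b).getD x.bound []).getD x.world .nil := by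
  simp only [DState.reps, repsT, Timed.bind_val, flatMapT_val, zipWithT_val, idxT_val,
    Timed.pure_val, List.mem_flatMap, ← List.range_eq_range']
  constructor
  · rintro ⟨l, hl, hx⟩
    obtain ⟨w, hw, rfl⟩ := List.mem_iff_getElem.1 hl
    have hw' : w < (s.bounds b).length := by
      simpa [DState.bounds] using hw
    rw [List.getElem_zipWith, List.getElem_range] at hx
    change x ∈ Timed.val (match (s.bounds b)[w] with
      | some h => do
          let y ← nth₂T .nil (s.sigs b) h w
          pure [(⟨w, h, y⟩ : Rep)]
      | none => pure []) at hx
    rcases ho : (s.bounds b)[w] with _ | h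
    · simp [ho] at hx
    · simp only [ho, Timed.bind_val, nth₂T_val, Timed.pure_val, List.mem_singleton] at hx
      subst hx
      exact ⟨by rw [List.getD_eq_getElem _ _ hw', ho], rfl⟩
  · rintro ⟨h₁, h₂⟩
    have hw := lt_of_getD_eq_some h₁
    refine ⟨[x], List.mem_iff_getElem.2 ⟨x.world, by simpa [DState.bounds] using hw, ?_⟩, by simp⟩
    rw [List.getElem_zipWith, List.getElem_range]
    change Timed.val (match (s.bounds b)[x.world] with
      | some h => do
          let y ← nth₂T .nil (s.sigs b) h x.world
          pure [(⟨x.world, h, y⟩ : Rep)]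
      | none => pure []) = _
    rw [List.getD_eq_getElem _ _ hw] at h₁
    rw [h₁]
    simp only [Timed.bind_val, nth₂T_val, Timed.pure_val, ← h₂]

section

variable (hs : s.WF a p)

include hs

theorem rep_lt {x : Rep} (hx : x ∈ s.reps b) : x.world < s.lab.length := by
  have := lt_of_getD_eq_some (mem_reps.1 hx).1
  rwa [(bounds_inv hs b).len] at this

theorem rep_bound_le {x : Rep} (hx : x ∈ s.reps b) : x.bound ≤ b :=
  ((bounds_inv hs b).ge _ _ (mem_reps.1 hx).1).2

theorem rep_sig {x : Rep} (hx : x ∈ s.reps b) : x.sig = s.sig x.bound x.world := by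
  rw [(mem_reps.1 hx).2, s.getD_sigs (rep_bound_le hs hx)]

theorem mk_mem_reps {w h : ℕ} (hw : (s.bounds b).getD w none = some h) :
    (⟨w, h, s.sig h w⟩ : Rep) ∈ s.reps b := by
  refine mem_reps.2 ⟨hw, ?_⟩
  rw [s.getD_sigs ((bounds_inv hs b).ge _ _ hw).2]

theorem mem_maxReps {x : Rep} : x ∈ s.maxReps b ↔ x ∈ s.reps b ∧
    ∀ y ∈ s.reps b, x.bound < y.bound → s.sig x.bound x.world ≠ s.sig x.bound y.world := by
  rw [DState.maxReps, List.mem_filter]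
  refine and_congr_right fun hx => ?_
  rw [s.getD_sigs (rep_bound_le hs hx)]
  simp only [s.getD_sigs (rep_bound_le hs hx), Bool.not_eq_true', List.any_eq_false,
    Bool.and_eq_true, decide_eq_true_eq, not_and, Nat.succ_le_iff, ne_eq]

/-- Every representative has a maximal one. -/
theorem exists_maxRep {x : Rep} (hx : x ∈ s.reps b) :
    ∃ y ∈ s.maxReps b, x.bound ≤ y.bound ∧ s.sig x.bound x.world = s.sig x.bound y.world := by
  -- Passing to a strict representative raises the bound, which never exceeds `b`.
  obtain ⟨n, hn⟩ : ∃ n, n = b - x.bound := ⟨_, rfl⟩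
  induction n using Nat.strong_induction_on generalizing x with
  | _ n ih =>
    by_cases hmax : x ∈ s.maxReps b
    · exact ⟨x, hmax, le_rfl, rfl⟩
    · rw [mem_maxReps hs] at hmax
      push Not at hmax
      obtain ⟨y, hy, hlt, heq⟩ := hmax hx
      have hyb := rep_bound_le hs hy
      obtain ⟨z, hz, h₁, h₂⟩ := ih (b - y.bound) (by omega) hy rfl
      refine ⟨z, hz, by omega, heq.trans ?_⟩
      have hz' := ((mem_maxReps hs).1 hz).1
      have := nbis_of_sig_eq hs hs le_rfl (w := ⟨_, rep_lt hs hy⟩) (v := ⟨_, rep_lt hs hz'⟩) h₂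
      exact sig_eq_of_nbis hs hs (w := ⟨_, rep_lt hs hy⟩) (v := ⟨_, rep_lt hs hz'⟩)
        (this.mono hlt.le)

/-- Signatures of different heights can coincide as data, for instance at worlds without successors.
For maximal representatives this is impossible, since the one with the larger bound would strictly
represent the other. So the signature alone determines the bound of a world of the contraction. -/
theorem bound_eq_of_sig_eq {x y : Rep} (hx : x ∈ s.maxReps b) (hy : y ∈ s.maxReps b)
    (h : x.sig = y.sig) : x.bound = y.bound := by
  have key : ∀ {x y : Rep}, x ∈ s.maxReps b → y ∈ s.maxReps b → x.sig = y.sig →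
      ¬ x.bound < y.bound := by
    intro x y hx hy h hlt
    have hx' := (mem_maxReps hs).1 hx
    have hy' := (mem_maxReps hs).1 hy
    rw [rep_sig hs hx'.1, rep_sig hs hy'.1] at h
    refine hx'.2 y hy'.1 hlt (sig_eq_of_nbis hs hs (w := ⟨_, rep_lt hs hx'.1⟩)
      (v := ⟨_, rep_lt hs hy'.1⟩) (nbis_of_sig_eq hs hs hlt.le h))
  exact le_antisymm (not_lt.1 (key hy hx h.symm)) (not_lt.1 (key hx hy h))

omit hs in
theorem repWorlds_length : (s.repWorlds b).length = (s.repSigs b).length := by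
  simp [DState.repWorlds]

-- The first maximal representative with the given signature is chosen; it exists because the
-- signatures were collected from maximal representatives, so the default entry is never used.
omit hs in
theorem repWorlds_getElem {j : ℕ} (hj : j < (s.repWorlds b).length) :
    (s.repWorlds b)[j] ∈ s.maxReps b ∧
      (s.repWorlds b)[j].sig = (s.repSigs b)[j]'(by rwa [← repWorlds_length]) := by
  have hj' : j < (s.repSigs b).length := by rwa [← repWorlds_length]
  have hmem : (s.repSigs b)[j] ∈ (s.maxReps b).map Rep.sig := by
    rw [← mem_sortS]; exact List.getElem_mem hj'
  obtain ⟨x, hx, hxs⟩ := List.mem_map.1 hmem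
  have hlt : (s.maxReps b).findIdx (fun x => decide ((s.repSigs b)[j] = x.sig)) <
      (s.maxReps b).length :=
    List.findIdx_lt_length_of_exists ⟨x, hx, by simp [hxs]⟩
  have hget := List.findIdx_getElem (w := hlt)
  simp only [DState.repWorlds, List.getElem_map]
  rw [List.getD_eq_getElem _ _ hlt]
  exact ⟨List.getElem_mem _, (by simpa using hget : _ = _).symm⟩

theorem repWorlds_mem {j : ℕ} (hj : j < (s.repWorlds b).length) :
    (s.repWorlds b)[j] ∈ s.reps b := ((mem_maxReps hs).1 (repWorlds_getElem hj).1).1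

/-- Every maximal representative has the bound and the signature of a world of the contraction. -/
theorem exists_repWorld {x : Rep} (hx : x ∈ s.maxReps b) :
    ∃ (j : ℕ) (hj : j < (s.repWorlds b).length), (s.repWorlds b)[j].sig = x.sig ∧
      (s.repWorlds b)[j].bound = x.bound := by
  have : x.sig ∈ s.repSigs b := mem_sortS.2 (List.mem_map.2 ⟨x, hx, rfl⟩)
  obtain ⟨j, hj, hjx⟩ := List.mem_iff_getElem.1 this
  rw [← repWorlds_length] at hj
  have h₁ := repWorlds_getElem hj
  exact ⟨j, hj, h₁.2.trans hjx, bound_eq_of_sig_eq hs h₁.1 hx (h₁.2.trans hjx)⟩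

omit hs in
theorem contract_lab_length : (s.contract b).lab.length = (s.repWorlds b).length := by
  simp [contract_eq]

/-- No bound exceeds `b`, so nothing strictly represents the root. -/
theorem root_mem_maxReps : (⟨s.des, b, s.sig b s.des⟩ : Rep) ∈ s.maxReps b := by
  refine (mem_maxReps hs).2 ⟨mk_mem_reps hs (bounds_inv hs b).root, fun y hy hlt => ?_⟩
  have := rep_bound_le hs hy
  simp only at hlt
  omega

theorem contract_des_lt : (s.contract b).des < (s.repWorlds b).length ∧
    ∃ h : (s.contract b).des < (s.repWorlds b).length,
      (s.repWorlds b)[(s.contract b).des].sig = s.sig b s.des ∧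
      (s.repWorlds b)[(s.contract b).des].bound = b := by
  have hdes : (s.contract b).des = (s.repSigs b).findIdx
      fun z => decide (s.sig b s.des = z) := by
    rw [contract_eq, s.getD_sigs le_rfl]
  have hroot := root_mem_maxReps hs (b := b)
  have hlt : (s.repSigs b).findIdx (fun z => decide (s.sig b s.des = z)) <
      (s.repSigs b).length :=
    List.findIdx_lt_length_of_exists
      ⟨s.sig b s.des, mem_sortS.2 (List.mem_map.2 ⟨_, hroot, rfl⟩), by simp⟩
  have hget := List.findIdx_getElem (w := hlt)
  simp only [decide_eq_true_eq] at hget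
  have hlt' : (s.contract b).des < (s.repWorlds b).length := by
    rw [hdes, repWorlds_length]; exact hlt
  have h₁ := repWorlds_getElem hlt'
  have h₂ : (s.repWorlds b)[(s.contract b).des].sig = s.sig b s.des := by
    rw [h₁.2, hget]
    simp only [hdes]
  exact ⟨hlt', hlt', h₂, bound_eq_of_sig_eq hs h₁.1 hroot h₂⟩

theorem contract_wf (b : ℕ) : (s.contract b).WF a p where
  lab l hl := by
    rw [contract_eq] at hl
    obtain ⟨x, hx, rfl⟩ := List.mem_map.1 hl
    obtain ⟨j, hj, rfl⟩ := List.mem_iff_getElem.1 hx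
    rw [List.getD_eq_getElem _ _ (rep_lt hs (repWorlds_mem hs hj))]
    exact hs.lab _ (List.getElem_mem _)
  rel := by simp [contract_eq, hs.rel]
  rows r hr := by
    rw [contract_eq] at hr ⊢
    obtain ⟨x, -, rfl⟩ := List.mem_map.1 hr
    simp
  cols r hr row hrow := by
    rw [contract_lab_length]
    rw [contract_eq] at hr
    obtain ⟨x, -, rfl⟩ := List.mem_map.1 hr
    obtain ⟨y, -, rfl⟩ := List.mem_map.1 hrow
    unfold DState.contractRow
    cases y.bound <;> simp
  des := by rw [contract_lab_length]; exact (contract_des_lt hs).1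

theorem adj_contract {i j k : ℕ} (hi : i < a) (hj : j < (s.repWorlds b).length)
    (hk : k < (s.repWorlds b).length) :
    (s.contract b).adj i j k = true ↔ ∃ h v, (s.repWorlds b)[j].bound = h + 1 ∧
      s.adj i (s.repWorlds b)[j].world v = true ∧ s.target b h v = k := by
  have hi' : i < s.rel.length := hs.rel ▸ hi
  rw [DState.adj, contract_eq, getD_map_of_lt _ hi', getD_map_of_lt _ hj, DState.contractRow]
  cases hb : (s.repWorlds b)[j].bound with
  | zero => simp
  | succ h =>
    simp only [getD_range_map _ hk, List.any_eq_true, List.mem_map, List.mem_filter,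
      List.mem_range, decide_eq_true_eq, Nat.add_right_cancel_iff]
    constructor
    · rintro ⟨_, ⟨v, hv, rfl⟩, h₁⟩
      refine ⟨h, v, rfl, ?_, h₁⟩
      rw [DState.adj, List.getD_eq_getElem s.rel _ hi']
      exact hv.2
    · rintro ⟨_, v, rfl, h₁, h₂⟩
      have hv := (hs.lt_of_adj h₁).2.2
      rw [DState.adj, List.getD_eq_getElem s.rel _ hi'] at h₁
      exact ⟨_, ⟨v, ⟨hv, h₁⟩, rfl⟩, h₂⟩

/-- The search for a target succeeds: a successor of a world with bound `h + 1` has bound at least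
`h`, hence a maximal representative, and the world of the contraction with the signature of the
latter is `h`-bisimilar to the successor. -/
theorem target_spec {i j h v : ℕ} (hj : j < (s.repWorlds b).length)
    (hb : (s.repWorlds b)[j].bound = h + 1)
    (hv : s.adj i (s.repWorlds b)[j].world v = true) :
    ∃ hk : s.target b h v < (s.repWorlds b).length,
      h ≤ (s.repWorlds b)[s.target b h v].bound ∧
      s.sig h (s.repWorlds b)[s.target b h v].world = s.sig h v := by
  have hmem := repWorlds_mem hs hj
  have hbound := (mem_reps.1 hmem).1
  have hh : h ≤ b := by have := rep_bound_le hs hmem; omega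
  obtain ⟨h', h₁, h₂⟩ := (bounds_inv hs b).succ _ _ hbound (by omega) i v hv
  have hrep := mk_mem_reps hs h₁
  have hv' := (hs.lt_of_adj hv).2.2
  obtain ⟨y, hy, h₃, h₄⟩ := exists_maxRep hs hrep
  simp only at h₃ h₄
  obtain ⟨k, hk, h₅, h₆⟩ := exists_repWorld hs hy
  have hy' := ((mem_maxReps hs).1 hy).1
  have hk' := repWorlds_mem hs hk
  rw [rep_sig hs hk', rep_sig hs hy', h₆] at h₅
  have h₇ : s.sig h v = s.sig h y.world :=
    sig_eq_of_nbis hs hs (w := ⟨_, hv'⟩) (v := ⟨_, rep_lt hs hy'⟩)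
      ((nbis_of_sig_eq hs hs le_rfl h₄).mono (by omega))
  have h₈ : s.sig h (s.repWorlds b)[k].world = s.sig h y.world :=
    sig_eq_of_nbis hs hs (w := ⟨_, rep_lt hs hk'⟩) (v := ⟨_, rep_lt hs hy'⟩)
      ((nbis_of_sig_eq hs hs le_rfl h₅).mono (by omega))
  have hlt : s.target b h v < (s.repWorlds b).length := by
    refine List.findIdx_lt_length_of_exists ⟨_, List.getElem_mem hk, ?_⟩
    rw [s.getD_sigs hh, s.getD_sigs hh, h₈, h₇]
    simp only [Bool.and_eq_true, decide_eq_true_eq, and_true]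
    omega
  refine ⟨hlt, ?_⟩
  have hget := List.findIdx_getElem (w := hlt)
  change (decide (h ≤ (s.repWorlds b)[s.target b h v].bound) &&
    decide (((s.sigs b).getD h []).getD (s.repWorlds b)[s.target b h v].world .nil =
      ((s.sigs b).getD h []).getD v .nil)) = true at hget
  rw [s.getD_sigs hh, s.getD_sigs hh] at hget
  simpa only [Bool.and_eq_true, decide_eq_true_eq] using hget

/-- An edge out of a world with bound `h + 1` is redirected to a world with bound at least `h` that
represents an `h`-bisimilar successor. So the induction on `k` never asks for more than the bound of
the world reached. -/
theorem contract_nbis_world {k j : ℕ} (hj : j < (s.repWorlds b).length)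
    (hk : k ≤ (s.repWorlds b)[j].bound) :
    NBis ((s.contract b).model a p) (s.model a p) k ⟨j, by rwa [contract_lab_length]⟩
      ⟨(s.repWorlds b)[j].world, rep_lt hs (repWorlds_mem hs hj)⟩ := by
  have lab : ∀ {j} (hj : j < (s.repWorlds b).length),
      ((s.contract b).model a p).L ⟨j, by rwa [contract_lab_length]⟩ =
      (s.model a p).L ⟨(s.repWorlds b)[j].world, rep_lt hs (repWorlds_mem hs hj)⟩ := by
    intro j hj
    rw [DState.label_eq_iff (contract_wf hs b) hs]
    simp only [contract_eq, Fin.getElem_fin, List.getElem_map]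
    exact List.getD_eq_getElem _ _ (rep_lt hs (repWorlds_mem hs hj))
  induction k generalizing j with
  | zero => exact lab hj
  | succ k ih =>
    obtain ⟨h, hb⟩ : ∃ h, (s.repWorlds b)[j].bound = h + 1 := 
      ⟨(s.repWorlds b)[j].bound - 1, by omega⟩
    refine ⟨lab hj, fun i => ⟨fun (j' : Fin _) hj' => ?_, fun (v : Fin _) hv => ?_⟩⟩
    · obtain ⟨h', v, h₁, h₂, h₃⟩ :=
        (adj_contract hs i.2 hj (by rw [← contract_lab_length]; exact j'.2)).1 hj'
      obtain rfl : h = h' := by omega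
      obtain ⟨h₄, h₅, h₆⟩ := target_spec hs hj h₁ h₂
      have hv := (hs.lt_of_adj h₂).2.2
      refine ⟨⟨v, hv⟩, h₂, ?_⟩
      have h₇ := (ih h₄ (by omega)).trans ((nbis_of_sig_eq hs hs le_rfl
        (w := ⟨_, rep_lt hs (repWorlds_mem hs h₄)⟩) (v := ⟨v, hv⟩) h₆).mono (by omega : k ≤ h))
      obtain rfl : j' = ⟨s.target b h v, by rwa [contract_lab_length]⟩ := Fin.ext h₃.symm
      exact h₇
    · obtain ⟨h₄, h₅, h₆⟩ := target_spec hs hj hb hv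
      exact ⟨⟨s.target b h v, by rwa [contract_lab_length]⟩,
        (adj_contract hs i.2 hj h₄).2 ⟨h, v, hb, hv, rfl⟩,
        (ih h₄ (by omega)).trans ((nbis_of_sig_eq hs hs le_rfl
        (w := ⟨_, rep_lt hs (repWorlds_mem hs h₄)⟩) (v := v) h₆).mono (by omega : k ≤ h))⟩

/-- A state and its contraction are `b`-bisimilar. -/
theorem contract_nbis :
    ((s.contract b).state a p (contract_wf hs b).des).NBis (s.state a p hs.des) b := by
  obtain ⟨-, hlt, hsig, hb⟩ := contract_des_lt hs (b := b)
  have hmem := repWorlds_mem hs hlt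
  rw [rep_sig hs hmem, hb] at hsig
  exact (contract_nbis_world hs hlt hb.ge).trans
    (nbis_of_sig_eq hs hs le_rfl (w := ⟨_, rep_lt hs hmem⟩) (v := ⟨_, hs.des⟩) hsig)

end

end DEL

namespace DEL

variable {a p : ℕ}

/-! ### Canonicity of contractions -/

/-- The search compares states as data, so canonicity must be an equality of matrices and not an
isomorphism. -/
theorem rel_ext {s t : DState} (hs : s.WF a p) (ht : t.WF a p)
    (hlen : s.lab.length = t.lab.length)
    (h : ∀ i < a, ∀ j < s.lab.length, ∀ k < s.lab.length, s.adj i j k = true ↔ t.adj i j k = true) :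
    s.rel = t.rel := by
  refine List.ext_getElem (hs.rel.trans ht.rel.symm) fun i hi hi' => ?_
  have h₁ := hs.rows _ (List.getElem_mem hi)
  have h₂ := ht.rows _ (List.getElem_mem hi')
  refine List.ext_getElem (by omega) fun j hj hj' => ?_
  have h₃ := hs.cols _ (List.getElem_mem hi) _ (List.getElem_mem hj)
  have h₄ := ht.cols _ (List.getElem_mem hi') _ (List.getElem_mem hj')
  refine List.ext_getElem (by omega) fun k hk hk' => ?_
  have := h i (hs.rel ▸ hi) j (by omega) k (by omega)
  rw [DState.adj, DState.adj, List.getD_eq_getElem s.rel _ hi, List.getD_eq_getElem t.rel _ hi',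
    List.getD_eq_getElem _ _ hj, List.getD_eq_getElem _ _ hj', List.getD_eq_getElem _ _ hk,
    List.getD_eq_getElem _ _ hk'] at this
  exact Bool.eq_iff_iff.2 this

theorem findIdx_congr {α β : Type} {l : List α} {m : List β} {f : α → Bool} {g : β → Bool}
    (hlen : l.length = m.length)
    (h : ∀ (j : ℕ) (hj : j < l.length) (hj' : j < m.length), f l[j] = g m[j]) :
    l.findIdx f = m.findIdx g := by
  have : l.map f = m.map g := by
    refine List.ext_getElem (by simpa using hlen) fun j hj hj' => ?_
    rw [List.getElem_map, List.getElem_map]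
    exact h j _ _
  have h₁ := List.findIdx_map l f id
  have h₂ := List.findIdx_map m g id
  simp only [Function.id_comp] at h₁ h₂
  rw [← h₁, ← h₂, this]

section

variable {s t : DState} {b : ℕ}

/-- A shortest path from the root to `w` is copied step by step into the other state. Each step uses
up one level of bisimilarity, which matches the loss of bound; in the other state the world reached
may be closer to the root. -/
theorem exists_rep_of_sig_eq (hs : s.WF a p) (ht : t.WF a p)
    (H : s.sig b s.des = t.sig b t.des) {w h : ℕ} (hw : (s.bounds b).getD w none = some h) :
    ∃ v h', (t.bounds b).getD v none = some h' ∧ h ≤ h' ∧ s.sig h w = t.sig h v := by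
  have hb := ((bounds_inv hs b).ge _ _ hw).2
  obtain ⟨n, hn⟩ : ∃ n, n = b - h := ⟨_, rfl⟩
  induction n generalizing w h with
  | zero =>
    obtain rfl : h = b := by omega
    rcases (bounds_inv hs h).pred _ _ hw with ⟨-, rfl⟩ | ⟨i, v, -, h₂⟩
    · exact ⟨t.des, h, (bounds_inv ht h).root, le_rfl, H⟩
    · have := ((bounds_inv hs h).ge _ _ h₂).2
      omega
  | succ n ih =>
    rcases (bounds_inv hs b).pred _ _ hw with ⟨rfl, rfl⟩ | ⟨i, w₀, h₁, h₂⟩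
    · omega
    · have hb' := ((bounds_inv hs b).ge _ _ h₂).2
      obtain ⟨v₀, h', h₃, h₄, h₅⟩ := ih h₂ hb' (by omega)
      obtain ⟨hi, hw₀, hw'⟩ := hs.lt_of_adj h₁
      have hv₀ : v₀ < t.lab.length := by
        have := lt_of_getD_eq_some h₃
        rwa [(bounds_inv ht b).len] at this
      have := nbis_of_sig_eq hs ht le_rfl (w := ⟨w₀, hw₀⟩) (v := ⟨v₀, hv₀⟩) h₅
      obtain ⟨v, h₆, h₇⟩ := (this.2 ⟨i, hi⟩).1 ⟨w, hw'⟩ h₁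
      obtain ⟨h'', h₈, h₉⟩ := (bounds_inv ht b).succ _ _ h₃ (by omega) i (Fin.val v) h₆
      exact ⟨_, h'', h₈, by omega, sig_eq_of_nbis hs ht h₇⟩

/-- The counterpart of a maximal representative has the same bound and is itself maximal: anything
larger could be carried back and would strictly represent `x`. -/
theorem exists_maxRep_of_sig_eq (hs : s.WF a p) (ht : t.WF a p)
    (H : s.sig b s.des = t.sig b t.des) {x : Rep} (hx : x ∈ s.maxReps b) :
    ∃ y ∈ t.maxReps b, y.bound = x.bound ∧ y.sig = x.sig := by
  obtain ⟨hx₁, hx₂⟩ := (mem_maxReps hs).1 hx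
  have hxl := rep_lt hs hx₁
  -- A world of `t` with larger bound that is bisimilar to `x` has a counterpart in `s` with at
  -- least that bound, contrary to the maximality of `x`.
  have back : ∀ {v h'}, (t.bounds b).getD v none = some h' → x.bound ≤ h' →
      s.sig x.bound x.world = t.sig x.bound v → ¬ x.bound < h' := by
    intro v h' hv hle heq hlt
    have hvl := rep_lt ht (mk_mem_reps ht hv)
    obtain ⟨w, h'', h₁, h₂, h₃⟩ := exists_rep_of_sig_eq ht hs H.symm hv
    have hwl := rep_lt hs (mk_mem_reps hs h₁)
    refine hx₂ _ (mk_mem_reps hs h₁) (by simp only; omega) ?_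
    refine heq.trans ?_
    exact sig_eq_of_nbis ht hs (w := ⟨v, hvl⟩) (v := ⟨w, hwl⟩)
      ((nbis_of_sig_eq ht hs le_rfl h₃).mono hle)
  obtain ⟨v, h', h₁, h₂, h₃⟩ := exists_rep_of_sig_eq hs ht H (mem_reps.1 hx₁).1
  obtain rfl : x.bound = h' := le_antisymm h₂ (not_lt.1 (back h₁ h₂ h₃))
  have hvl := rep_lt ht (mk_mem_reps ht h₁)
  refine ⟨_, (mem_maxReps ht).2 ⟨mk_mem_reps ht h₁, fun y hy hlt heq => ?_⟩, rfl, ?_⟩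
  · exact back (mem_reps.1 hy).1 hlt.le (h₃.trans heq) hlt
  · rw [rep_sig hs hx₁, h₃]

theorem repSigs_eq (hs : s.WF a p) (ht : t.WF a p) (H : s.sig b s.des = t.sig b t.des) :
    s.repSigs b = t.repSigs b := by
  rw [DState.repSigs, DState.repSigs, sortS_eq_iff]
  have key : ∀ {s t : DState}, s.WF a p → t.WF a p → s.sig b s.des = t.sig b t.des → ∀ x,
      x ∈ (s.maxReps b).map Rep.sig → x ∈ (t.maxReps b).map Rep.sig := by
    intro s t hs ht H x hx
    obtain ⟨y, hy, rfl⟩ := List.mem_map.1 hx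
    obtain ⟨z, hz, -, h₂⟩ := exists_maxRep_of_sig_eq hs ht H hy
    exact List.mem_map.2 ⟨z, hz, h₂⟩
  exact fun x => ⟨key hs ht H x, key ht hs H.symm x⟩

/-- The representing worlds are unrelated as positions; what they share is the signature at the same
place of a common sorted list, hence the bound and bisimilarity up to this bound. -/
theorem repWorlds_eq (hs : s.WF a p) (ht : t.WF a p) (H : s.sig b s.des = t.sig b t.des)
    {j : ℕ} (hj : j < (s.repWorlds b).length) (hj' : j < (t.repWorlds b).length) :
    (s.repWorlds b)[j].bound = (t.repWorlds b)[j].bound ∧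
    NBis (s.model a p) (t.model a p) (s.repWorlds b)[j].bound
      ⟨(s.repWorlds b)[j].world, rep_lt hs (repWorlds_mem hs hj)⟩
      ⟨(t.repWorlds b)[j].world, rep_lt ht (repWorlds_mem ht hj')⟩ := by
  have h₁ := repWorlds_getElem hj
  have h₂ := repWorlds_getElem hj'
  have h₃ : (s.repWorlds b)[j].sig = (t.repWorlds b)[j].sig := by
    rw [h₁.2, h₂.2]
    simp only [repSigs_eq hs ht H]
  obtain ⟨y, hy, h₄, h₅⟩ := exists_maxRep_of_sig_eq hs ht H h₁.1
  have h₆ := bound_eq_of_sig_eq ht hy h₂.1 (h₅.trans h₃)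
  have h₇ : (s.repWorlds b)[j].bound = (t.repWorlds b)[j].bound := h₄.symm.trans h₆
  refine ⟨h₇, nbis_of_sig_eq hs ht le_rfl ?_⟩
  rw [rep_sig hs (repWorlds_mem hs hj), rep_sig ht (repWorlds_mem ht hj')] at h₃
  rw [h₃, h₇]

/-- The contraction is determined by the signature of the designated world. -/
theorem contract_eq_of_sig_eq (hs : s.WF a p) (ht : t.WF a p)
    (H : s.sig b s.des = t.sig b t.des) : s.contract b = t.contract b := by
  have hlen : (s.repWorlds b).length = (t.repWorlds b).length := by
    rw [repWorlds_length, repWorlds_length, repSigs_eq hs ht H]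
  have hlab : (s.contract b).lab = (t.contract b).lab := by
    refine List.ext_getElem (by rw [contract_lab_length, contract_lab_length, hlen])
      fun j hj hj' => ?_
    have hj₁ : j < (s.repWorlds b).length := by rwa [contract_lab_length] at hj
    have hj₂ : j < (t.repWorlds b).length := by omega
    have := (repWorlds_eq hs ht H hj₁ hj₂).2.label
    rw [DState.label_eq_iff hs ht] at this
    simp only [contract_eq, List.getElem_map]
    rw [List.getD_eq_getElem _ _ (rep_lt hs (repWorlds_mem hs hj₁)),
      List.getD_eq_getElem _ _ (rep_lt ht (repWorlds_mem ht hj₂))]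
    exact this
  have hdes : (s.contract b).des = (t.contract b).des := by
    simp only [contract_eq, s.getD_sigs le_rfl, t.getD_sigs le_rfl, H, repSigs_eq hs ht H]
  -- Whether a world qualifies as a target depends only on its bound and on `h`-signatures, and
  -- those agree place by place; so both searches stop at the same position.
  have htarget : ∀ {h v v'}, h ≤ b → s.sig h v = t.sig h v' →
      s.target b h v = t.target b h v' := by
    intro h v v' hh hv
    refine findIdx_congr hlen fun j hj hj' => ?_
    obtain ⟨h₁, h₂⟩ := repWorlds_eq hs ht H hj hj'
    simp only [s.getD_sigs hh, t.getD_sigs hh, ← h₁, hv]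
    by_cases hle : h ≤ (s.repWorlds b)[j].bound
    · have h₃ := sig_eq_of_nbis hs ht (h₂.mono hle)
      simp only at h₃
      rw [h₃]
    · simp [hle]
  have hrel : (s.contract b).rel = (t.contract b).rel := by
    refine rel_ext (contract_wf hs b) (contract_wf ht b) (by rw [hlab]) fun i hi j hj k hk => ?_
    have hj₁ : j < (s.repWorlds b).length := by rwa [contract_lab_length] at hj
    have hj₂ : j < (t.repWorlds b).length := by omega
    have hk₁ : k < (s.repWorlds b).length := by rwa [contract_lab_length] at hk
    have hk₂ : k < (t.repWorlds b).length := by omega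
    rw [adj_contract hs hi hj₁ hk₁, adj_contract ht hi hj₂ hk₂]
    obtain ⟨h₁, h₂⟩ := repWorlds_eq hs ht H hj₁ hj₂
    have hle := rep_bound_le hs (repWorlds_mem hs hj₁)
    constructor
    · rintro ⟨h, v, h₃, h₄, h₅⟩
      rw [h₃] at h₂
      obtain ⟨v', h₆, h₇⟩ := (h₂.2 ⟨i, hi⟩).1 ⟨v, (hs.lt_of_adj h₄).2.2⟩ h₄
      exact ⟨h, Fin.val v', h₁ ▸ h₃, h₆,
        (htarget (by omega) (sig_eq_of_nbis hs ht h₇)).symm.trans h₅⟩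
    · rintro ⟨h, v, h₃, h₄, h₅⟩
      rw [h₁, h₃] at h₂
      obtain ⟨v', h₆, h₇⟩ := (h₂.2 ⟨i, hi⟩).2 ⟨v, (ht.lt_of_adj h₄).2.2⟩ h₄
      exact ⟨h, Fin.val v', h₁.trans h₃, h₆,
        (htarget (by omega) (sig_eq_of_nbis hs ht h₇)).trans h₅⟩
  cases hc : s.contract b
  cases hc' : t.contract b
  simp only [hc, hc'] at hlab hdes hrel
  rw [hlab, hdes, hrel]

/-! ### The number of worlds of a contraction and the number of contractions -/

theorem contract_length_le (hs : s.WF a p) (b : ℕ) :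
    (s.contract b).lab.length ≤ (b + 1) * sigBound (a + p) b := by
  rw [contract_lab_length, repWorlds_length, ← List.toFinset_card_of_nodup (l := s.repSigs b)
    (sortS_nodup _)]
  -- Worlds are named by signatures of heights `0, …, b`, hence the factor `b + 1`.
  have hsub : (s.repSigs b).toFinset ⊆ (Finset.range (b + 1)).biUnion (sigSet a p) := by
    intro z hz
    rw [List.mem_toFinset, DState.repSigs, mem_sortS, List.mem_map] at hz
    obtain ⟨x, hx, rfl⟩ := hz
    have hx' := ((mem_maxReps hs).1 hx).1
    rw [Finset.mem_biUnion]
    refine ⟨x.bound, Finset.mem_range.2 (by have := rep_bound_le hs hx'; omega), ?_⟩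
    rw [rep_sig hs hx']
    exact DState.sig_mem_sigSet hs _ (rep_lt hs hx')
  refine (Finset.card_le_card hsub).trans (Finset.card_biUnion_le.trans ?_)
  refine (Finset.sum_le_card_nsmul _ _ (sigBound (a + p) b) fun h hh => ?_).trans (by simp)
  exact (card_sigSet_le a p h).trans (sigBound_mono _ (by simpa [Nat.lt_succ_iff] using hh))

end

/-- The pairs of a bound that is at most `b` and a contracted state for this bound. -/
def ContractPair (a p b : ℕ) (x : DState × ℕ) : Prop :=
  x.2 ≤ b ∧ ∃ s : DState, s.WF a p ∧ x.1 = s.contract x.2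

/-- Sending a pair to its bound and the signature, for this bound, of the designated world of a
preimage under contraction is injective, because contractions are canonical. -/
theorem length_le_of_contractPair {b : ℕ} {l : List (DState × ℕ)} (hl : l.Nodup)
    (h : ∀ x ∈ l, ContractPair a p b x) : l.length ≤ (b + 1) * sigBound (a + p) b := by
  classical
  have : Nonempty DState := ⟨⟨[], [], 0⟩⟩
  choose! f hf using fun x hx => (h x hx).2
  have hcard := Finset.card_le_card_of_injOn (s := l.toFinset)
    (t := (Finset.range (b + 1)).sigma fun h => sigSet a p h)
    (fun x => ⟨x.2, (f x).sig x.2 (f x).des⟩)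
    (fun x hx => by
      have hx : x ∈ l := by simpa using hx
      simp only [Finset.coe_sigma, Set.mem_sigma_iff, Finset.coe_range, Set.mem_Iio, Finset.mem_coe]
      exact ⟨Nat.lt_succ_of_le (h x hx).1, DState.sig_mem_sigSet (hf x hx).1 _ (hf x hx).1.des⟩)
    (fun x hx y hy hxy => by
      have hx : x ∈ l := by simpa using hx
      have hy : y ∈ l := by simpa using hy
      simp only [Sigma.mk.injEq] at hxy
      obtain ⟨h₁, h₂⟩ := hxy
      have h₂ := eq_of_heq h₂
      refine Prod.ext ?_ h₁
      rw [(hf x hx).2, (hf y hy).2, ← h₁]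
      rw [← h₁] at h₂
      exact contract_eq_of_sig_eq (hf x hx).1 (hf y hy).1 h₂)
  rw [List.toFinset_card_of_nodup hl] at hcard
  refine hcard.trans ?_
  rw [Finset.card_sigma]
  refine (Finset.sum_le_card_nsmul _ _ (sigBound (a + p) b) fun h hh => ?_).trans (by simp)
  exact (card_sigSet_le a p h).trans (sigBound_mono _ (by simpa [Nat.lt_succ_iff] using hh))

end DEL

namespace DEL

variable {a p : ℕ}

/-! ### Modal depths -/

@[simp] theorem mdT_val (φ : Form a p) : (mdT φ).val = φ.md := by
  induction φ with
  | top => rfl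
  | atom q => rfl
  | neg φ ih => simpa [mdT, Form.md] using ih
  | and φ ψ ih₁ ih₂ => simp [mdT, Form.md, ih₁, ih₂]
  | box i φ ih => simp [mdT, Form.md, ih]

/-- Maxima computed by folds are compared with the suprema in the definitions through their upper
bounds, which avoids any reordering. -/
theorem maxListT_le_iff (l : List ℕ) (n : ℕ) : (maxListT l).val ≤ n ↔ ∀ x ∈ l, x ≤ n := by
  have key : ∀ (l : List ℕ) c, l.foldl (fun z x => max z x) c ≤ n ↔ c ≤ n ∧ ∀ x ∈ l, x ≤ n := by
    intro l
    induction l with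
    | nil => simp
    | cons x l ih => intro c; simp [ih, and_assoc]
  simp only [maxListT, Timed.bind_val, foldT_val, maxT_val]
  rw [key]
  simp

theorem actionMdT_val (α : Action a p) : (actionMdT α.encode).val = α.md := by
  refine eq_of_forall_ge_iff fun n => ?_
  simp only [actionMdT, Timed.bind_val, mapT_val, mdT_val, maxT_val, max_le_iff, maxListT_le_iff,
    Action.encode, Action.md, Finset.sup_le_iff]
  simp only [List.forall_mem_map, List.forall_mem_ofFn_iff, maxListT_le_iff, Finset.mem_univ,
    forall_const]

theorem md_le_c {T : Task a p} {α : Action a p} (h : α ∈ T.actions) : α.md ≤ T.c := by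
  have key : ∀ l : List ℕ, ∀ x ∈ l, x ≤ l.foldr max 0 := by
    intro l
    induction l with
    | nil => simp
    | cons y l ih =>
      intro x hx
      rcases List.mem_cons.1 hx with rfl | hx
      · exact le_max_left _ _
      · exact (ih x hx).trans (le_max_right _ _)
  exact key _ _ (List.mem_map.2 ⟨α, h, rfl⟩)

theorem c_le_iff (T : Task a p) (n : ℕ) : T.c ≤ n ↔ ∀ α ∈ T.actions, α.md ≤ n := by
  unfold Task.c
  induction T.actions with
  | nil => simp
  | cons α l ih => simp [ih]

theorem depthBoundT_val (T : Task a p) (u : ℕ) :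
    (depthBoundT T.encode u).val = T.c * u + T.o := by
  have : (maxListT (mapT actionMdT T.encode.actions).val).val = T.c := by
    refine eq_of_forall_ge_iff fun n => ?_
    rw [maxListT_le_iff, c_le_iff]
    simp [Task.encode, actionMdT_val]
  simp only [depthBoundT, Timed.bind_val, this, mulT_val, addT_val, mdT_val]
  rfl

/-! ### Expansion of nodes -/

/-- The child of a node for an action, if there is one. -/
def child (dg : ℕ) (n : Node) (α : Action a p) (j : ℕ) : Option Node :=
  if ((applicableT n.state α.encode).val && decide (α.md ≤ n.bound)) = true then
    (childNodeT n α.encode j α.md dg).val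
  else none

/-- Is there a generated state that equals the state of the node, with the same bound? -/
def seen (v : List (DState × ℕ)) (n : Node) : Bool :=
  v.any fun x => (eqStateT x.1 n.state).val && decide (x.2 = n.bound)

theorem seen_iff {v : List (DState × ℕ)} {n : Node} :
    seen v n = true ↔ (n.state, n.bound) ∈ v := by
  simp only [seen, List.any_eq_true, Bool.and_eq_true, eqStateT_val, decide_eq_true_eq]
  constructor
  · rintro ⟨⟨s, b⟩, h, rfl, rfl⟩
    exact h
  · exact fun h => ⟨_, h, rfl, rfl⟩

open Classical in
theorem pushT_val (c : Config) (n : Node) :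
    (pushT c n).val = if (n.state, n.bound) ∈ c.visited then c
      else ⟨c.frontier ++ [n], (n.state, n.bound) :: c.visited⟩ := by
  have h : (anyT (fun x : DState × ℕ => do
      let d ← eqStateT x.1 n.state
      let e ← eqNatT x.2 n.bound
      pure (d && e)) c.visited).val = seen c.visited n := by
    simp only [anyT_val, Timed.bind_val, eqNatT_val, Timed.pure_val, seen]
  simp only [pushT, Timed.bind_val, h]
  by_cases h' : seen c.visited n = true
  · rw [if_pos h', if_pos (seen_iff.1 h')]
    rfl
  · rw [if_neg h', if_neg fun hm => h' (seen_iff.2 hm)]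
    simp

theorem tryT_val (dg : ℕ) (n : Node) (c : Config) (j : ℕ) (α : Action a p) :
    (tryT dg n c j α.encode).val = match child dg n α j with
      | none => c
      | some n₁ => (pushT c n₁).val := by
  simp only [tryT, Timed.bind_val, actionMdT_val, leT_val, child]
  split
  · simp only [Timed.bind_val]
    cases (childNodeT n α.encode j α.md dg).val <;> rfl
  · rfl

theorem initNodeT_val (s : DState) (b : ℕ) (β : Bool) (path : List ℕ) :
    (initNodeT s b β path).val =
      ⟨s.contract b, b, β && (bisimT (s.contract b) s).val, path⟩ := rfl

/-- What is known of a child: its state is the contraction of an updated state. -/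
theorem child_spec {dg : ℕ} {n n₁ : Node} (hn : n.state.WF a p) {α : Action a p} {j : ℕ}
    (h : child dg n α j = some n₁) : (n.state.state a p hn.des).Applicable α ∧
      α.md ≤ n.bound ∧ ∃ b' β, n₁ = ⟨(updateT n.state α.encode).val.contract b', b',
        β && (bisimT ((updateT n.state α.encode).val.contract b')
          (updateT n.state α.encode).val).val, j :: n.path⟩ ∧
      (b' = n.bound ∧ n.isBisim = true ∨ b' + α.md = n.bound ∧ dg ≤ b' ∧ β = false) := by
  unfold child at h
  split at h
  · rename_i hc
    rw [Bool.and_eq_true, applicableT_iff _ hn, decide_eq_true_eq] at hc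
    refine ⟨hc.1, hc.2, ?_⟩
    by_cases hb : n.isBisim = true
    · simp only [childNodeT, Timed.bind_val, hb, if_true, initNodeT_val, Timed.pure_val,
        Option.some_inj] at h
      exact ⟨_, true, h.symm, .inl ⟨rfl, hb⟩⟩
    · simp only [childNodeT, Timed.bind_val, hb, subT_val, leT_val, Bool.false_eq_true,
        if_false] at h
      split at h
      · rename_i hd
        simp only [Timed.bind_val, initNodeT_val, Timed.pure_val, Option.some_inj] at h
        refine ⟨_, false, h.symm, .inr ⟨Nat.sub_add_cancel hc.2, by simpa using hd, rfl⟩⟩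
      · simp at h
  · simp at h

theorem child_exists {dg : ℕ} {n : Node} (hn : n.state.WF a p) {α : Action a p} (j : ℕ)
    (happ : (n.state.state a p hn.des).Applicable α) (hmd : dg + α.md ≤ n.bound) :
    ∃ n₁, child dg n α j = some n₁ := by
  unfold child
  rw [if_pos (by rw [Bool.and_eq_true, applicableT_iff _ hn, decide_eq_true_eq]
                 exact ⟨happ, by omega⟩)]
  by_cases hb : n.isBisim = true
  · simp only [childNodeT, Timed.bind_val, hb, if_true, Timed.pure_val]
    exact ⟨_, rfl⟩
  · simp only [childNodeT, Timed.bind_val, hb, subT_val, leT_val, Bool.false_eq_true, if_false]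
    rw [if_pos (by rw [decide_eq_true_eq]; omega)]
    exact ⟨_, rfl⟩

/-! ### Correctness of the search -/

section Search

variable {T : Task a p}

/-- The path to the node leads to a state which the state of the node represents. -/
structure Sound (T : Task a p) (n : Node) : Prop where
  bound : T.o ≤ n.bound
  wf : n.state.WF a p
  reached : ∃ (αs : List (Action a p)) (t : State a p),
    List.Forall₂ (fun j α => T.actions[j]? = some α) n.path.reverse αs ∧
    (∀ βs, t.Achieves T.goal βs → T.init.Achieves T.goal (αs ++ βs)) ∧
    (n.state.state a p wf.des).NBis t n.bound ∧
    (n.isBisim = true → ∀ h, (n.state.state a p wf.des).NBis t h)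

theorem State.NBis.trans {s t u : State a p} {h : ℕ} (H : s.NBis t h) (H' : t.NBis u h) :
    s.NBis u h := DEL.NBis.trans H H'

/-- The child represents the real successor to depth `b'`: by updating a representation of
sufficient depth, and then contracting. The flag stays true only if the parent was fully bisimilar
and the test found that contracting lost nothing. -/
theorem Sound.child {n n₁ : Node} (hn : Sound T n) {α : Action a p} {j : ℕ}
    (hα : T.actions[j]? = some α) (h : child T.o n α j = some n₁) : Sound T n₁ := by
  obtain ⟨happ, hmd, b', β, rfl, hb⟩ := child_spec hn.wf h
  have hwf := updateT_wf hn.wf α happ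
  obtain ⟨αs, t, h₁, h₂, h₃, h₄⟩ := hn.reached
  have ht : t.Applicable α := (h₃.applicable_iff hmd).1 happ
  have hcon := contract_nbis hwf (b := b')
  have hup : ((updateT n.state α.encode).val.state a p hwf.des).NBis (t.update α ht) b' := by
    rcases hb with ⟨-, hb⟩ | ⟨hb, -⟩
    -- Full bisimilarity supplies the extra `md(α)` levels, so the bound need not drop.
    · exact updateT_nbis hn.wf α happ ht (h₄ hb (b' + α.md)) le_rfl
    · exact updateT_nbis hn.wf α happ ht h₃ hb.le
  refine ⟨?_, contract_wf hwf b', αs ++ [α], t.update α ht, ?_, ?_, hcon.trans hup, ?_⟩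
  · rcases hb with ⟨rfl, -⟩ | ⟨-, hb, -⟩
    · exact hn.bound
    · exact hb
  · rw [List.reverse_cons]
    exact List.rel_append h₁ (.cons hα .nil)
  · intro βs hβ
    rw [List.append_assoc]
    exact h₂ _ ⟨ht, hβ⟩
  · intro hβ k
    rw [Bool.and_eq_true] at hβ
    rcases hb with ⟨-, hb⟩ | ⟨-, -, hb⟩
    · exact (bisimT_sound (contract_wf hwf b') hwf hβ.2 k).trans
        (updateT_nbis hn.wf α happ ht (h₄ hb (k + α.md)) le_rfl)
    · rw [hb] at hβ
      exact absurd hβ.1 (by simp)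

/-- A plan of length `r` leads from the state of the node to the goal, and the bound of the node
suffices for all plans of this length. -/
def Good (T : Task a p) (x : DState × ℕ) (r : ℕ) : Prop :=
  T.c * r + T.o ≤ x.2 ∧ ∃ (h : x.1.des < x.1.lab.length) (αs : List (Action a p)),
    (∀ α ∈ αs, α ∈ T.actions) ∧ αs.length = r ∧ (x.1.state a p h).Achieves T.goal αs

/-- The first action of the plan passes the depth tests because `c·(r+1) + o` is within the bound;
whether or not the bound drops, `c·r + o` levels remain, which is what the rest of the plan needs to
survive the contraction. -/
theorem Good.child {n : Node} (hn : Sound T n) {r : ℕ} (h : Good T (n.state, n.bound) (r + 1)) :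
    ∃ α ∈ T.actions, ∀ j, ∃ n₁, child T.o n α j = some n₁ ∧ Good T (n₁.state, n₁.bound) r := by
  obtain ⟨hb, hd, αs, hαs, hlen, hach⟩ := h
  cases αs with
  | nil => simp at hlen
  | cons α αs =>
    obtain ⟨happ, hach⟩ := hach
    have hα : α ∈ T.actions := hαs α (by simp)
    have hc := md_le_c hα
    simp only [mul_add, mul_one] at hb
    refine ⟨α, hα, fun j => ?_⟩
    obtain ⟨n₁, hn₁⟩ := child_exists (dg := T.o) hn.wf j happ (by omega)
    refine ⟨n₁, hn₁, ?_⟩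
    obtain ⟨-, -, b', β, rfl, hb'⟩ := child_spec hn.wf hn₁
    have hwf := updateT_wf hn.wf α happ
    have hb'' : T.c * r + T.o ≤ b' := by
      rcases hb' with ⟨rfl, -⟩ | ⟨hb', -⟩ <;> omega
    have hlen' : αs.length = r := by simpa using hlen
    refine ⟨hb'', (contract_wf hwf b').des, αs, fun β hβ => hαs β (by simp [hβ]), hlen', ?_⟩
    -- The plan starts at the contracted state itself, so the update is exact; the only loss is the
    -- contraction of the child.
    have h₁ : (n.state.state a p hn.wf.des).NBis (n.state.state a p hn.wf.des) (b' + α.md) :=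
      NBis.refl _ _
    have h₂ := (contract_nbis hwf (b := b')).trans (updateT_nbis hn.wf α happ happ h₁ le_rfl)
    exact State.NBis.achieves (fun β hβ => md_le_c (hαs β (by simp [hβ])))
      (show State.NBis _ _ b' from DEL.NBis.symm h₂) (by rw [hlen']; exact hb'') hach

/-- All children of the node that can be on a plan have been generated. -/
structure Closed (T : Task a p) (V : List Node) (n : Node) : Prop where
  not_goal : ¬ Good T (n.state, n.bound) 0
  child : ∀ r, Good T (n.state, n.bound) (r + 1) → ∃ n₁ ∈ V,
    n₁.path.length ≤ n.path.length + 1 ∧ Good T (n₁.state, n₁.bound) r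

/-- The invariant of the main loop; `V` are the nodes generated so far. -/
structure SearchInv (T : Task a p) (c : Config) (V : List Node) : Prop where
  visited : c.visited = V.map fun n => (n.state, n.bound)
  sub : ∀ n ∈ c.frontier, n ∈ V
  sound : ∀ n ∈ V, Sound T n
  closed : ∀ n ∈ V, n ∈ c.frontier ∨ Closed T V n
  sorted : c.frontier.Pairwise fun m n => m.path.length ≤ n.path.length
  depth : ∀ n ∈ c.frontier, ∀ m ∈ V, m.path.length ≤ n.path.length + 1

/-- The invariant of the expansion of the node `n`. -/
structure ExpandInv (T : Task a p) (n : Node) (c : Config) (V : List Node) : Prop where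
  visited : c.visited = V.map fun n => (n.state, n.bound)
  sub : ∀ m ∈ c.frontier, m ∈ V
  mem : n ∈ V
  sound : ∀ m ∈ V, Sound T m
  closed : ∀ m ∈ V, m ∈ c.frontier ∨ m = n ∨ Closed T V m
  sorted : c.frontier.Pairwise fun m n => m.path.length ≤ n.path.length
  depth : ∀ m ∈ V, m.path.length ≤ n.path.length + 1
  front : ∀ m ∈ c.frontier, n.path.length ≤ m.path.length

theorem Closed.mono {V V' : List Node} (hV : ∀ m ∈ V, m ∈ V') {n : Node} (h : Closed T V n) :
    Closed T V' n :=
  ⟨h.not_goal, fun r hr => let ⟨n₁, h₁, h₂⟩ := h.child r hr; ⟨n₁, hV _ h₁, h₂⟩⟩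

/-- A child need not be added, but some generated node has its state and bound. This suffices, since
`Good` does not see the path. -/
theorem ExpandInv.tryT {n : Node} {c : Config} {V : List Node} (H : ExpandInv T n c V)
    {α : Action a p} {j : ℕ} (hα : T.actions[j]? = some α) :
    ∃ V', (∀ m ∈ V, m ∈ V') ∧ ExpandInv T n (tryT T.o n c j α.encode).val V' ∧
      ∀ n₁, DEL.child T.o n α j = some n₁ →
        ∃ n₂ ∈ V', (n₂.state, n₂.bound) = (n₁.state, n₁.bound) := by
  rw [tryT_val]
  cases hc : DEL.child T.o n α j with
  | none => exact ⟨V, fun m hm => hm, H, by simp⟩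
  | some n₁ =>
    simp only [Option.some_inj, forall_eq']
    rw [pushT_val]
    split
    · rename_i hmem
      rw [H.visited] at hmem
      -- The duplicate is replaced by the older node, whose path is no longer, by `depth`.
      exact ⟨V, fun m hm => hm, H, List.mem_map.1 hmem⟩
    · obtain ⟨-, -, b', β, hn₁, -⟩ := child_spec (H.sound n H.mem).wf hc
      have hpath : n₁.path.length = n.path.length + 1 := by rw [hn₁]; simp
      refine ⟨n₁ :: V, fun m hm => by simp [hm], ⟨by simp [H.visited], ?_, by simp [H.mem], ?_, ?_,
        ?_, ?_, ?_⟩, n₁, by simp, rfl⟩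
      · intro m hm
        rcases List.mem_append.1 hm with hm | hm
        · simp [H.sub m hm]
        · simp_all
      · intro m hm
        rcases List.mem_cons.1 hm with rfl | hm
        · exact (H.sound n H.mem).child hα hc
        · exact H.sound m hm
      · intro m hm
        rcases List.mem_cons.1 hm with rfl | hm
        · exact .inl (by simp)
        · rcases H.closed m hm with h | h | h
          · exact .inl (by simp [h])
          · exact .inr (.inl h)
          · exact .inr (.inr (h.mono fun m hm => by simp [hm]))
      · rw [List.pairwise_append]
        refine ⟨H.sorted, List.pairwise_singleton _ _, fun x hx y hy => ?_⟩
        rw [List.mem_singleton.1 hy, hpath]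
        exact H.depth x (H.sub x hx)
      · intro m hm
        rcases List.mem_cons.1 hm with rfl | hm
        · exact hpath.le
        · exact H.depth m hm
      · intro m hm
        rcases List.mem_append.1 hm with hm | hm
        · exact H.front m hm
        · rw [List.mem_singleton.1 hm, hpath]
          omega

theorem ExpandInv.expandT {n : Node} {c : Config} {V : List Node} (H : ExpandInv T n c V)
    {l : List (Action a p)} {j : ℕ} (hl : ∀ k α, l[k]? = some α → T.actions[j + k]? = some α) :
    ∃ V', (∀ m ∈ V, m ∈ V') ∧ ExpandInv T n (expandT T.o n c j (l.map Action.encode)).val V' ∧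
      ∀ α ∈ l, ∃ k, ∀ n₁, DEL.child T.o n α k = some n₁ →
        ∃ n₂ ∈ V', (n₂.state, n₂.bound) = (n₁.state, n₁.bound) := by
  induction l generalizing j c V with
  | nil => exact ⟨V, fun m hm => hm, H, by simp⟩
  | cons α l ih =>
    obtain ⟨V₁, h₁, h₂, h₃⟩ := H.tryT (α := α) (j := j) (by simpa using hl 0 α)
    obtain ⟨V₂, h₄, h₅, h₆⟩ := ih h₂ (j := j + 1) fun k β hk => by
      have := hl (k + 1) β (by simpa using hk)
      rwa [show j + 1 + k = j + (k + 1) by omega]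
    refine ⟨V₂, fun m hm => h₄ _ (h₁ _ hm), h₅, fun β hβ => ?_⟩
    rcases List.mem_cons.1 hβ with rfl | hβ
    · refine ⟨j, fun n₁ hn₁ => ?_⟩
      obtain ⟨n₂, hn₂, heq⟩ := h₃ n₁ hn₁
      exact ⟨n₂, h₄ _ hn₂, heq⟩
    · exact h₆ β hβ

theorem Sound.good_zero_iff {n : Node} (hn : Sound T n) :
    Good T (n.state, n.bound) 0 ↔ (holdsT n.state T.goal).val = true := by
  rw [holdsT_iff _ hn.wf]
  constructor
  · rintro ⟨-, hd, αs, -, hlen, hach⟩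
    rw [List.length_eq_zero_iff] at hlen
    subst hlen
    exact hach
  · intro h
    exact ⟨by simpa using hn.bound, hn.wf.des, [], by simp, rfl, h⟩

theorem SearchInv.next {c c₁ : Config} {V : List Node} (H : SearchInv T c V)
    (h : (loopT T.encode c).val = .inr c₁) :
    ∃ V', (∀ m ∈ V, m ∈ V') ∧ SearchInv T c₁ V' := by
  obtain ⟨frontier, visited⟩ := c
  cases frontier with
  | nil => simp [loopT] at h
  | cons n rest =>
    simp only [loopT, Timed.bind_val] at h
    split at h
    · simp at h
    · rename_i hgoal
      simp only [Timed.bind_val, Timed.pure_val, Sum.inr.injEq, mdT_val] at h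
      have hnV : n ∈ V := H.sub n (by simp)
      have hsorted := List.pairwise_cons.1 H.sorted
      have hE : ExpandInv T n ⟨rest, visited⟩ V := by
        refine ⟨H.visited, fun m hm => H.sub m (by simp [hm]), hnV, H.sound, fun m hm => ?_,
          hsorted.2, H.depth n (by simp), hsorted.1⟩
        rcases H.closed m hm with h₁ | h₁
        · rcases List.mem_cons.1 h₁ with rfl | h₁
          · exact .inr (.inl rfl)
          · exact .inl h₁
        · exact .inr (.inr h₁)
      obtain ⟨V', h₁, h₂, h₃⟩ := hE.expandT (l := T.actions) (j := 0) (by simp)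
      change (DEL.expandT T.o n ⟨rest, visited⟩ 0 (T.actions.map Action.encode)).val = c₁ at h
      rw [h] at h₂
      refine ⟨V', h₁, h₂.visited, h₂.sub, h₂.sound, fun m hm => ?_, h₂.sorted, fun x hx m hm => ?_⟩
      · have hs := H.sound n hnV
        rcases h₂.closed m hm with h₄ | rfl | h₄
        · exact .inl h₄
        -- The expanded node becomes closed: it failed the goal test, and each good child, or an
        -- older node equal to it, is among the generated ones.
        · refine .inr ⟨fun hg => hgoal (hs.good_zero_iff.1 hg), fun r hr => ?_⟩
          obtain ⟨α, hα, hj⟩ := Good.child hs hr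
          obtain ⟨k, hk⟩ := h₃ α hα
          obtain ⟨n₁, h₅, h₆⟩ := hj k
          obtain ⟨n₂, h₇, h₈⟩ := hk n₁ h₅
          exact ⟨n₂, h₇, h₂.depth _ h₇, h₈ ▸ h₆⟩
        · exact .inr h₄
      · have h₄ := h₂.depth m hm
        have h₅ := h₂.front x hx
        omega

/-- From a good node on, some node on the frontier is good. -/
theorem SearchInv.exists_good {c : Config} {V : List Node} (H : SearchInv T c V) {n : Node}
    (hn : n ∈ V) {r : ℕ} (hr : Good T (n.state, n.bound) r) :
    ∃ m ∈ c.frontier, m.path.length ≤ n.path.length + r := by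
  induction r generalizing n with
  | zero =>
    rcases H.closed n hn with h | h
    · exact ⟨n, h, le_rfl⟩
    · exact absurd hr h.not_goal
  | succ r ih =>
    rcases H.closed n hn with h | h
    · exact ⟨n, h, by omega⟩
    · obtain ⟨n₁, h₁, h₂, h₃⟩ := h.child r hr
      obtain ⟨m, h₄, h₅⟩ := ih h₁ h₃
      exact ⟨m, h₄, by omega⟩

/-- Soundness is that of the node returned. For completeness, a good generated node always leaves a
good node on the frontier, so the search cannot fail before a plan is found. -/
theorem LoopRun.correct {c : Config} {t : ℕ} {out : Option (List ℕ)}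
    (hrun : LoopRun T.encode c t out) {V : List Node} (H : SearchInv T c V) :
    (∀ π, out = some π → T.IsSolution π) ∧
    ∀ n ∈ V, ∀ r, Good T (n.state, n.bound) r →
      ∃ π, out = some π ∧ π.length ≤ n.path.length + r := by
  induction hrun generalizing V with
  | halt c out h =>
    obtain ⟨frontier, visited⟩ := c
    cases frontier with
    | nil =>
      simp only [loopT, Timed.bind_val, Timed.pure_val, Sum.inl.injEq] at h
      subst h
      refine ⟨by simp, fun n hn r hr => ?_⟩
      obtain ⟨m, hm, -⟩ := H.exists_good hn hr
      simp at hm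
    | cons n rest =>
      simp only [loopT, Timed.bind_val] at h
      split at h
      · rename_i hgoal
        simp only [Timed.bind_val, Timed.pure_val, Sum.inl.injEq, revT_val, List.append_nil] at h
        subst h
        have hs := H.sound n (H.sub n (by simp))
        refine ⟨?_, fun m hm r hr => ⟨_, rfl, ?_⟩⟩
        · rintro π hπ
          obtain rfl := Option.some.inj hπ
          obtain ⟨αs, t, h₁, h₂, h₃, -⟩ := hs.reached
          refine ⟨αs, h₁, ?_⟩
          have hg := (holdsT_iff _ hs.wf _).1 hgoal
          have := h₂ [] ((h₃.sat_iff hs.bound).1 hg)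
          rwa [List.append_nil] at this
        -- The node returned is the head of a queue sorted by path length, so its path is no longer
        -- than that of `x`.
        · obtain ⟨x, hx, hlen⟩ := H.exists_good hm hr
          rw [List.length_reverse]
          refine le_trans ?_ hlen
          rcases List.mem_cons.1 hx with rfl | hx
          · exact le_rfl
          · exact (List.pairwise_cons.1 H.sorted).1 x hx
      · simp at h
  | next c c₁ t out h h₁ ih =>
    obtain ⟨V', h₂, h₃⟩ := H.next h
    obtain ⟨h₄, h₅⟩ := ih h₃
    exact ⟨h₄, fun n hn => h₅ n (h₂ n hn)⟩

theorem sound_root {s : DState} {b : ℕ} (hb : T.o ≤ b) (hs : s.WF a p)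
    (H : ∀ h, (s.state a p hs.des).NBis T.init h) :
    Sound T ⟨s.contract b, b, (bisimT (s.contract b) s).val, []⟩ := by
  have h₁ := (contract_nbis hs (b := b)).trans (H b)
  refine ⟨hb, contract_wf hs b, [], T.init, .nil, fun βs h => h, h₁, ?_⟩
  intro hβ h
  dsimp only at hβ ⊢
  exact State.NBis.trans (bisimT_sound (contract_wf hs b) hs hβ h) (H h)

theorem searchInv_start {b : ℕ} (hb : T.o ≤ b) :
    ∃ n, n.path = [] ∧ SearchInv T (startT T.encode b).val [n] ∧
      ∀ αs : List (Action a p), (∀ α ∈ αs, α ∈ T.actions) → T.init.Achieves T.goal αs →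
        T.c * αs.length + T.o ≤ b → Good T (n.state, n.bound) αs.length := by
  have hwf := T.encode_wf
  obtain ⟨n, hn⟩ : ∃ n, n = (initNodeT T.encode.init b true []).val := ⟨_, rfl⟩
  have hstart : (startT T.encode b).val = ⟨[n], [(n.state, n.bound)]⟩ := by rw [hn]; rfl
  rw [initNodeT_val, Bool.true_and] at hn
  rw [hstart]
  refine ⟨n, by rw [hn], ⟨rfl, fun n hn => hn, ?_, fun n hn => .inl hn,
    List.pairwise_singleton _ _, ?_⟩, ?_⟩
  · simp only [List.mem_singleton, forall_eq]
    rw [hn]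
    exact sound_root hb hwf T.encode_nbis
  · simp
  · intro αs hαs hach hle
    rw [hn]
    refine ⟨hle, (contract_wf hwf b).des, αs, hαs, rfl, ?_⟩
    have h := (contract_nbis hwf (b := b)).trans (T.encode_nbis b)
    exact State.NBis.achieves (fun β hβ => md_le_c (hαs β hβ))
      (show State.NBis _ _ b from DEL.NBis.symm h) hle hach

theorem mem_actions_of_forall₂ {π : List ℕ} {αs : List (Action a p)}
    (h : List.Forall₂ (fun j α => T.actions[j]? = some α) π αs) : ∀ α ∈ αs, α ∈ T.actions := by
  induction h with
  | nil => simp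
  | cons h _ ih =>
    intro α hα
    rcases List.mem_cons.1 hα with rfl | hα
    · exact List.mem_of_getElem? h
    · exact ih α hα

/-- The assumption on `b` lets the goal transfer from the contracted state to the state reached.
Comparing lengths matters: a plan that the bound covers must not be superseded by a longer one,
which would then be rejected. -/
theorem BoundedGraphSearch.correct {b t : ℕ} {out : Option (List ℕ)}
    (h : BoundedGraphSearch T b t out) (hb : T.o ≤ b) :
    (∀ π, out = some π → T.IsSolution π) ∧
    ∀ π, T.IsSolution π → T.c * π.length + T.o ≤ b →
      ∃ π', out = some π' ∧ π'.length ≤ π.length := by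
  obtain ⟨t₁, hrun, -⟩ := h
  obtain ⟨n, hn, hinv, hgood⟩ := searchInv_start (T := T) hb
  obtain ⟨h₁, h₂⟩ := hrun.correct hinv
  refine ⟨h₁, fun π ⟨αs, hαs, hach⟩ hle => ?_⟩
  have hlen := hαs.length_eq
  have := h₂ n (by simp) _ (hgood αs (mem_actions_of_forall₂ hαs) hach (by rw [← hlen]; exact hle))
  rw [hn, ← hlen] at this
  simpa using this

end Search

end DEL

namespace DEL

variable {a p M : ℕ}

/-! ### Times of model checking, product updates and bisimilarity -/

/-- The state has at most `M` worlds, agents and atoms. -/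
structure Small (M : ℕ) (s : DState) : Prop where
  lab : MatLe M s.lab
  rel : s.rel.length ≤ M
  mats : ∀ r ∈ s.rel, MatLe M r
  des : s.des ≤ M

theorem DState.WF.small {s : DState} (hs : s.WF a p) (hn : s.lab.length ≤ M) (ha : a ≤ M)
    (hp : p ≤ M) : Small M s where
  lab := ⟨hn, fun l hl => (hs.lab l hl).trans_le hp⟩
  rel := hs.rel.trans_le ha
  mats r hr := ⟨(hs.rows r hr).trans_le hn, fun row h => (hs.cols r hr row h).trans_le hn⟩
  des := hs.des.le.trans hn

/-- The action has at most `M` events, agents and atoms, and formulas of size at most `M`. -/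
structure SmallAction (M : ℕ) (α : DAction a p) : Prop where
  pre : α.pre.length ≤ M
  pre_size : ∀ φ ∈ α.pre, φ.size ≤ M
  post : MatLe M α.post
  post_size : ∀ l ∈ α.post, ∀ φ ∈ l, φ.size ≤ M
  mats : ∀ r ∈ α.rel, MatLe M r
  des : α.des ≤ M

theorem Form.md_le_size (φ : Form a p) : φ.md ≤ φ.size := by
  induction φ with
  | top => simp [md]
  | atom q => simp [md]
  | neg φ ih => simp only [md, size]; omega
  | and φ ψ ih₁ ih₂ => simp only [md, size]; omega
  | box i φ ih => simp only [md, size]; omega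

variable (hM : 4 ≤ M)

include hM

theorem small_le_pow {x k : ℕ} (hx : x ≤ M + 3) : x ≤ M ^ (k + 2) := by
  have h₁ : 1 ≤ M ^ k := Nat.one_le_pow _ _ (by omega)
  have h₂ : M ^ (k + 2) = M ^ k * (M * M) := by ring
  nlinarith [Nat.mul_le_mul_right (M * M) h₁]

theorem leT_time_le {n : ℕ} (m : ℕ) (hn : n ≤ M) : (leT m n).time ≤ M ^ 2 :=
  (leT_time_le_right m n).trans (small_le_pow hM (k := 0) (by omega))

theorem eqNatT_time_le {n : ℕ} (m : ℕ) (hn : n ≤ M) : (eqNatT m n).time ≤ M ^ 2 :=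
  (eqNatT_time_le_right m n).trans (small_le_pow hM (k := 0) (by omega))

theorem maxT_time_le {n : ℕ} (m : ℕ) (hn : n ≤ M) : (maxT m n).time ≤ M ^ 2 :=
  (maxT_time_le_right m n).trans (small_le_pow hM (k := 0) (by omega))

theorem mdT_time_le {φ : Form a p} (hφ : φ.size ≤ M) : (mdT φ).time ≤ M ^ 4 := by
  have key : ∀ φ : Form a p, φ.size ≤ M → (mdT φ).time ≤ φ.size * (M ^ 2 + 1) := by
    intro φ
    have h₀ := Nat.zero_le (M ^ 2)
    induction φ with
    | top => intro _; simp [mdT, Form.size]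
    | atom q => intro _; simp [mdT, Form.size]
    | neg φ ih =>
      intro h
      simp only [Form.size] at h
      have := ih (by omega)
      simp only [mdT, Form.size, Timed.bind_time, tick_time]
      linarith
    | and φ ψ ih₁ ih₂ =>
      intro h
      simp only [Form.size] at h
      have h₁ := ih₁ (by omega)
      have h₂ := ih₂ (by omega)
      have h₃ := maxT_time_le hM φ.md (n := ψ.md) (ψ.md_le_size.trans (by omega))
      simp only [mdT, Form.size, Timed.bind_time, tick_time, mdT_val]
      linarith
    | box i φ ih =>
      intro h
      simp only [Form.size] at h
      have := ih (by omega)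
      simp only [mdT, Form.size, Timed.bind_time, tick_time, Timed.pure_time]
      linarith
  -- A syntax tree with at most `M` nodes is treated as a loop with one pass per node.
  exact loop_le_pow hM ((key φ hφ).trans (Nat.le_succ _)) hφ

theorem maxListT_time_le {l : List ℕ} (hl : l.length ≤ M) (h : ∀ x ∈ l, x ≤ M) :
    (maxListT l).time ≤ M ^ 5 := by
  unfold maxListT
  exact tick_bind_time_le hM (foldT_time_le hM (fun _ => True) (k := 2) hl trivial
    (fun _ _ _ _ => trivial) fun z _ x hx => maxT_time_le hM z (h x hx))

omit hM in
theorem maxListT_le_of_forall {l : List ℕ} (h : ∀ x ∈ l, x ≤ M) : (maxListT l).val ≤ M :=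
  (maxListT_le_iff l M).2 h

theorem actionMdT_time_le {α : DAction a p} (hα : SmallAction M α) :
    (actionMdT α).time ≤ M ^ 20 := by
  have hmd : ∀ {l : List (Form a p)}, (∀ φ ∈ l, φ.size ≤ M) → ∀ x ∈ (mapT mdT l).val, x ≤ M := by
    intro l hl x hx
    simp only [mapT_val, mdT_val, List.mem_map] at hx
    obtain ⟨φ, hφ, rfl⟩ := hx
    exact φ.md_le_size.trans (hl φ hφ)
  have hmap : ∀ {l : List (Form a p)}, l.length ≤ M → (∀ φ ∈ l, φ.size ≤ M) →
      (mapT mdT l).time ≤ M ^ 6 := fun h hl => mapT_time_le hM h fun φ hφ => mdT_time_le hM (hl φ hφ)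
  unfold actionMdT
  refine le_pow_mono hM (tick_bind_time_le hM (bind_time_le hM (hmap hα.pre hα.pre_size)
    (bind_time_le hM (maxListT_time_le hM (by simpa using hα.pre) (hmd hα.pre_size))
    (bind_time_le hM (mapT_time_le hM (k := 7) hα.post.1 fun l hl => ?_)
    (bind_time_le hM (maxListT_time_le hM (by simpa using hα.post.1) fun x hx => ?_)
    (maxT_time_le hM _ (maxListT_le_of_forall fun x hx => ?_))))))) (by decide)
  · exact le_pow_mono hM (bind_time_le hM (hmap (hα.post.2 l hl) (hα.post_size l hl))
      (maxListT_time_le hM (by simpa using hα.post.2 l hl) (hmd (hα.post_size l hl)))) (by decide)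
  all_goals
    rw [mapT_val, List.mem_map] at hx
    obtain ⟨l, hl, rfl⟩ := hx
    exact maxListT_le_of_forall (hmd (hα.post_size l hl))

/-! ### Model checking and product updates -/

section State

variable {s : DState} (hs : s.WF a p) (hS : Small M s)

include hs hS

theorem checkT_time_le {φ : Form a p} (hφ : φ.size ≤ M) : (checkT s φ).time ≤ M ^ 10 := by
  have key : ∀ φ : Form a p, (checkT s φ).time ≤ φ.size * (M ^ 8 + 1) := by
    intro φ
    have hlen : ∀ φ : Form a p, (checkT s φ).val.length ≤ M :=
      fun φ => (checkT_length s hs φ).trans_le hS.lab.1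
    induction φ with
    | top =>
      have := mapT_time_le hM (f := fun _ => (pure true : Timed Bool)) (k := 0) hS.lab.1 (by simp)
      have := le_pow_mono hM this (show 0 + 2 ≤ 8 by decide)
      simp only [checkT, Form.size, Timed.bind_time, tick_time]
      linarith
    | atom q =>
      have := mapT_time_le hM (f := fun l => nthT false l q) (k := 2) hS.lab.1 fun l hl =>
        nthT_time_le hM (hS.lab.2 l hl) _ _
      have := le_pow_mono hM this (show 2 + 2 ≤ 8 by decide)
      simp only [checkT, Form.size, Timed.bind_time, tick_time]
      linarith
    | neg φ ih =>
      have := mapT_time_le hM (f := fun c => (pure (!c) : Timed Bool)) (k := 0) (hlen φ) (by simp)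
      have := le_pow_mono hM this (show 0 + 2 ≤ 8 by decide)
      simp only [checkT, Form.size, Timed.bind_time, tick_time]
      linarith
    | and φ ψ ih₁ ih₂ =>
      have := zipWithT_time_le hM (f := fun c d => (pure (c && d) : Timed Bool)) (k := 0) (hlen φ)
        (m := (checkT s ψ).val) (by simp)
      have := le_pow_mono hM this (show 0 + 2 ≤ 8 by decide)
      simp only [checkT, Form.size, Timed.bind_time, tick_time]
      linarith
    | box i φ ih =>
      have hi := hs.getD_rel i
      have h₁ := bind_time_le (f := fun r : List (List Bool) => mapT (fun row => do
          let succ ← selectT row (checkT s φ).val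
          allT (fun c => pure c) succ) r) hM (nthT_time_le hM hS.rel [] i)
        (mapT_time_le hM (k := 3) (by rw [nthT_val]; exact (hS.mats _ hi).1) fun row _ =>
          bind_time_le hM (selectT_time_le hM row (hlen φ)) (allT_time_le hM (k := 0)
            (by rw [selectT_val]; exact (select_length_le _ _).trans (hlen φ)) (by simp)))
      have := le_pow_mono hM h₁ (show max 2 (3 + 2) + 1 ≤ 8 by decide)
      simp only [checkT, Form.size]
      simp only [Timed.bind_time, tick_time] at this ⊢
      linarith
  exact loop_le_pow hM ((key φ).trans (Nat.le_succ _)) hφ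

theorem holdsT_time_le {φ : Form a p} (hφ : φ.size ≤ M) : (holdsT s φ).time ≤ M ^ 12 := by
  unfold holdsT
  exact le_pow_mono hM (tick_bind_time_le hM (bind_time_le hM (checkT_time_le hM hs hS hφ)
    (nthT_time_le hM ((checkT_length s hs φ).trans_le hS.lab.1) _ _))) (by decide)

theorem applicableT_time_le {α : DAction a p} (hα : SmallAction M α) :
    (applicableT s α).time ≤ M ^ 14 := by
  unfold applicableT
  refine tick_bind_time_le hM (bind_time_le hM (nthT_time_le hM hα.pre _ _)
    (holdsT_time_le hM hs hS ?_))
  rw [nthT_val]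
  rcases getD_mem_or α.pre α.des .top with h | h
  · exact hα.pre_size _ h
  · rw [h]
    simp only [Form.size]
    omega

/-- Pairs of worlds and events are listed before they are filtered, so it is the product of both
numbers that has to be at most `M`. -/
theorem updateT_time_le {α : DAction a p} (hα : SmallAction M α)
    (hprod : s.lab.length * α.pre.length ≤ M) : (updateT s α).time ≤ M ^ 30 := by
  have hpres : MatLe M (mapT (checkT s) α.pre).val := by
    refine ⟨by simpa using hα.pre, fun r hr => ?_⟩
    rw [mapT_val, List.mem_map] at hr
    obtain ⟨φ, -, rfl⟩ := hr
    exact (checkT_length s hs φ).trans_le hS.lab.1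
  have hposts : ∀ l ∈ (mapT (mapT (checkT s)) α.post).val, MatLe M l := by
    intro l hl
    rw [mapT_val, List.mem_map] at hl
    obtain ⟨φs, hφs, rfl⟩ := hl
    refine ⟨by simpa using hα.post.2 φs hφs, fun r hr => ?_⟩
    rw [mapT_val, List.mem_map] at hr
    obtain ⟨φ, -, rfl⟩ := hr
    exact (checkT_length s hs φ).trans_le hS.lab.1
  have hpairs : (flatMapT (fun w => mapT (fun e => (pure (w, e) : Timed (ℕ × ℕ)))
      (idxT α.pre 0).val) (idxT s.lab 0).val).val.length ≤ M := by
    simpa [List.length_flatMap] using hprod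
  unfold updateT
  have hworlds : (filterT (fun x => nth₂T false (mapT (checkT s) α.pre).val x.2 x.1)
      (flatMapT (fun w => mapT (fun e => (pure (w, e) : Timed (ℕ × ℕ)))
      (idxT α.pre 0).val) (idxT s.lab 0).val).val).val.length ≤ M := by
    rw [filterT_val]
    exact (List.length_filter_le _ _).trans hpairs
  refine le_pow_mono hM (tick_bind_time_le hM
    (bind_time_le hM (mapT_time_le hM hα.pre fun φ hφ => checkT_time_le hM hs hS
      (hα.pre_size φ hφ))
    (bind_time_le hM (mapT_time_le hM hα.post.1 fun l hl =>
      mapT_time_le hM (hα.post.2 l hl) fun φ hφ => checkT_time_le hM hs hS (hα.post_size l hl φ hφ))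
    (bind_time_le hM (idxT_time_le hM hS.lab.1 0)
    (bind_time_le hM (idxT_time_le hM hα.pre 0)
    (bind_time_le hM (flatMapT_time_le hM (k := 2) (by simpa using hS.lab.1)
      (fun w _ => mapT_time_le hM (k := 0) (by simpa using hα.pre) (by simp))
      (fun w _ => by simpa using hα.pre))
    (bind_time_le hM (filterT_time_le hM hpairs fun x _ => nth₂T_time_le hM hpres _ _ _)
    (bind_time_le hM (mapT_time_le hM (k := 5) hworlds fun x _ => ?_)
    (bind_time_le hM (zipWithT_time_le hM (k := 10) hS.rel fun r hr q hq => ?_)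
    (bind_time_le hM (findT_time_le hM (k := 4) hworlds (fun x _ => ?_) 0)
      (pure_time_le _)))))))))))
    (by decide)
  · refine le_pow_mono hM (bind_time_le hM (nthT_time_le hM (by simpa using hα.post.1) _ _) ?_
      (j := 4)) (by decide)
    have : MatLe M (nthT [] (mapT (mapT (checkT s)) α.post).val x.2).val := by
      rw [nthT_val]
      rcases getD_mem_or (mapT (mapT (checkT s)) α.post).val x.2 [] with h | h
      · exact hposts _ h
      · rw [h]; exact ⟨by simp, by simp⟩
    exact mapT_time_le hM this.1 fun v hv => nthT_time_le hM (this.2 v hv) _ _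
  · exact mapT_time_le hM (k := 8) hworlds fun x _ => mapT_time_le hM (k := 6) hworlds fun y _ =>
      le_pow_mono hM (bind_time_le hM (nth₂T_time_le hM (hS.mats r hr) _ _ _)
        (bind_time_le hM (nth₂T_time_le hM (hα.mats q hq) _ _ _) (pure_time_le _))) (by decide)
  · exact le_pow_mono hM (bind_time_le hM (eqNatT_time_le hM _ hS.des)
      (bind_time_le hM (eqNatT_time_le hM _ hα.des) (pure_time_le _))) (by decide)

end State

/-! ### The bisimilarity test -/

section Bisim

variable {s t : DState} (hS : Small M s) (hT : Small M t)

include hS hT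

theorem refineT_time_le {Z : List (List Bool)} (hZ : MatLe M Z) :
    (refineT s t Z).time ≤ M ^ 25 := by
  have hws : (idxT s.lab 0).val.length ≤ M := by simpa using hS.lab.1
  have hvs : (idxT t.lab 0).val.length ≤ M := by simpa using hT.lab.1
  unfold refineT
  refine le_pow_mono hM (tick_bind_time_le hM (bind_time_le hM (idxT_time_le hM hS.lab.1 0)
    (bind_time_le hM (idxT_time_le hM hT.lab.1 0)
    (mapT_time_le hM hws fun w _ => mapT_time_le hM hvs fun v _ =>
      bind_time_le hM (nth₂T_time_le hM hZ _ _ _)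
      (bind_time_le hM (zipWithT_time_le hM (k := 12) hS.rel fun r hr q hq => ?_)
      (bind_time_le hM (allT_time_le hM (k := 0) ?_ (by simp)) (pure_time_le _))))))) (by decide)
  · have h₁ : (filterT (fun w₁ => nth₂T false r w w₁) (idxT s.lab 0).val).val.length ≤ M := by
      rw [filterT_val]; exact (List.length_filter_le _ _).trans hws
    have h₂ : (filterT (fun v₁ => nth₂T false q v v₁) (idxT t.lab 0).val).val.length ≤ M := by
      rw [filterT_val]; exact (List.length_filter_le _ _).trans hvs
    exact le_pow_mono hM (bind_time_le hM (filterT_time_le hM hws fun x _ => nth₂T_time_le hM (hS.mats r hr) _ _ _)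
      (bind_time_le hM (filterT_time_le hM hvs fun x _ => nth₂T_time_le hM (hT.mats q hq) _ _ _)
      (bind_time_le hM (allT_time_le hM h₁ fun x _ => anyT_time_le hM h₂ fun y _ =>
        nth₂T_time_le hM hZ _ _ _)
      (bind_time_le hM (allT_time_le hM h₂ fun x _ => anyT_time_le hM h₁ fun y _ =>
        nth₂T_time_le hM hZ _ _ _) (pure_time_le _))))) (by decide)
  · rw [zipWithT_val, List.length_zipWith]
    exact (min_le_left _ _).trans hS.rel

omit hM in
theorem matLe_refineT {Z : List (List Bool)} : MatLe M (refineT s t Z).val := by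
  rw [refineT_val]
  refine ⟨by simpa using hS.lab.1, fun r hr => ?_⟩
  obtain ⟨w, -, rfl⟩ := List.mem_map.1 hr
  simpa using hT.lab.1

/-- Refinement keeps the dimensions of the matrix, which is the invariant of both folds; each loop
adds two to the exponent of one refinement. -/
theorem bisimT_time_le : (bisimT s t).time ≤ M ^ 40 := by
  have hZ : MatLe M (mapT (fun l => mapT (fun k => eqListT eqBoolT l k) t.lab) s.lab).val := by
    refine ⟨by simpa using hS.lab.1, fun r hr => ?_⟩
    rw [mapT_val, List.mem_map] at hr
    obtain ⟨w, -, rfl⟩ := hr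
    simpa using hT.lab.1
  have hinner : ∀ Y, MatLe M Y → MatLe M (foldT (fun X _ => refineT s t X) Y t.lab).val := by
    intro Y hY
    rw [foldT_val]
    generalize t.lab = l
    induction l generalizing Y with
    | nil => exact hY
    | cons x l ih => exact ih _ (matLe_refineT hS hT)
  have houter : ∀ Y, MatLe M Y → MatLe M (foldT (fun Y _ => foldT (fun X _ => refineT s t X) Y t.lab)
      Y s.lab).val := by
    intro Y hY
    rw [foldT_val]
    generalize s.lab = l
    induction l generalizing Y with
    | nil => exact hY
    | cons x l ih => exact ih _ (hinner Y hY)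
  unfold bisimT
  refine le_pow_mono hM (tick_bind_time_le hM
    (bind_time_le hM (mapT_time_le hM hS.lab.1 fun l hl => mapT_time_le hM (k := 3) hT.lab.1
      fun k _ => ?_)
    (bind_time_le hM (foldT_time_le hM (MatLe M) hS.lab.1 hZ (fun Y hY _ _ => hinner Y hY)
      fun Y hY _ _ => foldT_time_le hM (MatLe M) hT.lab.1 hY
        (fun X _ _ _ => matLe_refineT hS hT) fun X hX _ _ => refineT_time_le hM hS hT hX)
    (nth₂T_time_le hM (houter _ hZ) _ _ _)))) (by decide)
  refine eqListT_time_le hM (k := 1) (hS.lab.2 l hl) fun x _ y _ => ?_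
  simp only [eqBoolT, Timed.bind_time, tick_time, Timed.pure_time, pow_one]
  omega

end Bisim

end DEL

namespace DEL

variable {a p M : ℕ}

/-! ### Times of signatures and contractions -/

/-- Each recursive call enters a different subterm of `x`, so the size of one argument is enough. -/
theorem cmpT_time_le' (x y : SExp) : (cmpT x y).time ≤ 2 * x.size + 1 := by
  induction x generalizing y with
  | nil => cases y <;> simp [cmpT, SExp.size]
  | cons x₁ x₂ ih₁ ih₂ =>
    cases y with
    | nil => simp [cmpT]
    | cons y₁ y₂ =>
      have h₁ := ih₁ y₁
      have h₂ := ih₂ y₂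
      simp only [cmpT, Timed.bind_time, tick_time, SExp.size]
      split
      · omega
      all_goals simp only [Timed.pure_time]; omega

theorem bitsT_time (l : List Bool) : (bitsT l).time = l.length + 1 := by
  induction l with
  | nil => simp [bitsT]
  | cons x l ih => simp [bitsT, ih]; omega

theorem ofListT_time (l : List SExp) : (ofListT l).time = l.length + 1 := by
  induction l with
  | nil => simp [ofListT]
  | cons x l ih => simp [ofListT, ih]; omega

/-- For a recursion whose depth is not a constant the costs must be added up level by level; one
exponent per level would not give a fixed power. -/
theorem recursion_time_le (hM : 4 ≤ M) {f : ℕ → ℕ} {k n : ℕ} (h₀ : f 0 ≤ M ^ k)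
    (hf : ∀ r < n, f (r + 1) ≤ f r + M ^ k) (hn : n ≤ M) : f n ≤ M ^ (k + 2) := by
  have key : ∀ r ≤ n, f r ≤ (r + 1) * M ^ k := by
    intro r
    induction r with
    | zero => intro _; simpa using h₀
    | succ r ih =>
      intro hr
      have h₁ := ih (by omega)
      have h₂ := hf r (by omega)
      have h₃ : (r + 1 + 1) * M ^ k = (r + 1) * M ^ k + M ^ k := by ring
      omega
  refine (key n le_rfl).trans ?_
  rw [pow_add, mul_comm]
  exact Nat.mul_le_mul_left _ (by nlinarith)

variable (hM : 4 ≤ M)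

include hM

theorem cmpT_time_le {x : SExp} (hx : x.size ≤ M) (y : SExp) : (cmpT x y).time ≤ M ^ 2 := by
  have := cmpT_time_le' x y
  nlinarith

theorem eqSExpT_time_le {x : SExp} (hx : x.size ≤ M) (y : SExp) : (eqSExpT x y).time ≤ M ^ 4 := by
  unfold eqSExpT
  refine le_pow_mono hM (tick_bind_time_le hM (bind_time_le hM (cmpT_time_le hM hx y) (j := 0) ?_))
    (by decide)
  split <;> exact pure_time_le _

theorem insertT_time_le {x : SExp} (hx : x.size ≤ M) {l : List SExp} (hl : l.length ≤ M) :
    (insertT x l).time ≤ M ^ 4 := by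
  refine loop_le_pow hM (n := l.length) (k := 2) ?_ hl
  clear hl
  induction l with
  | nil => simp [insertT]
  | cons y l ih =>
    have := cmpT_time_le hM hx y
    have h₁ : 0 ≤ l.length * (M ^ 2 + 1) := Nat.zero_le _
    simp only [insertT, Timed.bind_time, tick_time, List.length_cons]
    split <;> simp only [Timed.bind_time, Timed.pure_time] <;> linarith

/-- The accumulator has no repetitions and only members of `l`, so it is never longer than `l`. -/
theorem sortT_time_le {l : List SExp} (hl : l.length ≤ M) (hsize : ∀ x ∈ l, x.size ≤ M) :
    (sortT l).time ≤ M ^ 7 := by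
  unfold sortT
  refine tick_bind_time_le hM (foldT_time_le hM
    (fun acc => acc.Pairwise SExp.Lt ∧ ∀ y ∈ acc, y ∈ l) (k := 4) hl ⟨List.Pairwise.nil, by simp⟩ ?_ ?_)
  · rintro acc ⟨h₁, h₂⟩ x hx
    refine ⟨pairwise_insertT h₁, fun y hy => ?_⟩
    rcases mem_insertT.1 hy with rfl | hy
    · exact hx
    · exact h₂ y hy
  · rintro acc ⟨h₁, h₂⟩ x hx
    refine insertT_time_le hM (hsize x hx) (le_trans ?_ hl)
    refine (List.Nodup.subperm (h₁.imp fun {x y} h => ?_) h₂).length_le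
    rintro rfl
    exact SExp.lt_irrefl _ h

omit hM in
theorem sortS_length_le (l : List SExp) : (sortS l).length ≤ l.length :=
  ((sortS_nodup l).subperm fun _ hy => mem_sortS.1 hy).length_le

/-! ### Signatures, bounds of worlds and contractions -/

section Contract

variable {s : DState} (hs : s.WF a p) (hS : Small M s)

include hs in
omit hM in
theorem sigT_size_le {h : ℕ} (hsig : sigBound (a + p) h ≤ M) {x : SExp}
    (hx : x ∈ (sigT s h).val) : x.size ≤ M := by
  obtain ⟨w, hw, rfl⟩ := List.mem_iff_getElem.1 hx
  have hw' : w < s.lab.length := by rwa [sigT_length] at hw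
  refine (size_le_of_mem_sigSet ?_).trans hsig
  have := DState.sig_mem_sigSet hs h hw'
  rwa [DState.sig, List.getD_eq_getElem _ _ hw] at this

include hs hS

/-- Signatures are written out in full, so handling them costs their size; this is why `sigBound`
also bounds sizes and why it has to be below `M`. -/
theorem sigT_time_le {h : ℕ} (hh : h ≤ M) (hsig : sigBound (a + p) h ≤ M) :
    (sigT s h).time ≤ M ^ 22 := by
  have hbits : ∀ l ∈ s.lab, (bitsT l).time ≤ M ^ 2 := fun l hl =>
    (bitsT_time l).le.trans (small_le_pow hM (k := 0) (by have := hS.lab.2 l hl; omega))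
  refine recursion_time_le hM (f := fun h => (sigT s h).time) (k := 20) ?_ (fun r hr => ?_) hh
  · simp only [sigT]
    exact le_pow_mono hM (tick_bind_time_le hM (mapT_time_le hM hS.lab.1 fun l hl =>
      bind_time_le hM (hbits l hl) (pure_time_le _))) (by decide)
  · have hsize : ∀ x ∈ (sigT s r).val, x.size ≤ M := fun x hx =>
      sigT_size_le hs ((sigBound_mono _ hr.le).trans hsig) hx
    have hlen : (sigT s r).val.length ≤ M := by rw [sigT_length]; exact hS.lab.1
    have h₁ : ∀ row : List Bool, (select row (sigT s r).val).length ≤ M := fun row =>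
      (select_length_le _ _).trans hlen
    -- The time `x` of the recursive call stays a plain summand; only the remaining work is
    -- estimated by a power of `M`.
    have comb : ∀ {x y z : ℕ}, y ≤ M ^ 2 → z ≤ M ^ 17 → 1 + (x + (y + z)) ≤ x + M ^ 20 := by
      intro x y z hy hz
      have := le_pow_mono hM (linear_le_pow hM (add_le_pow hM hy hz))
        (show max 2 17 + 1 + 1 ≤ 20 by decide)
      omega
    simp only [sigT]
    rw [Timed.bind_time, Timed.bind_time, Timed.bind_time, tick_time]
    refine comb (idxT_time_le hM hS.lab.1 0) ?_
    refine le_pow_mono hM (zipWithT_time_le hM hS.lab.1 fun l hl w _ =>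
      bind_time_le hM (hbits l hl) (bind_time_le hM (mapT_time_le hM hS.rel fun r' hr' =>
        bind_time_le hM (nthT_time_le hM (hS.mats r' hr').1 _ _)
        (bind_time_le hM (selectT_time_le hM _ hlen)
        (bind_time_le hM (sortT_time_le hM ?_ ?_) (j := 2) ?_)))
        (bind_time_le hM (i := 2) ?_ (pure_time_le _)))) (by decide)
    · rw [selectT_val]; exact h₁ _
    · intro x hx
      rw [selectT_val] at hx
      obtain ⟨j, -, hj⟩ := mem_select.1 hx
      exact hsize x (List.mem_of_getElem? hj)
    · rw [ofListT_time]
      refine small_le_pow hM (k := 0) ?_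
      have h₂ := sortS_length_le (select (nthT [] r' w).val (sigT s r).val)
      have h₃ := h₁ (nthT [] r' w).val
      simp only [selectT_val]
      change (sortS _).length + 1 ≤ _
      omega
    · rw [ofListT_time]
      refine small_le_pow hM (k := 0) ?_
      have := hS.rel
      simp only [mapT_val, List.length_map]
      omega

omit hs in
theorem boundsGoT_time_le {r : ℕ} (hr : r ≤ M) {cur : List (Option ℕ)} (hcur : cur.length ≤ M) :
    (boundsGoT s r cur).time ≤ M ^ 22 := by
  have key : ∀ r, ∀ cur : List (Option ℕ), cur.length ≤ M →
      (boundsGoT s r cur).time ≤ (r + 1) * M ^ 16 := by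
    intro r
    induction r with
    | zero =>
      intro cur _
      simp only [boundsGoT, Timed.bind_time, tick_time, Timed.pure_time]
      have := Nat.one_le_pow 16 M (by omega)
      omega
    | succ r ih =>
      intro cur hcur
      have comb : ∀ {x y z : ℕ}, x ≤ M ^ 2 → y ≤ M ^ 12 → z ≤ (r + 1) * M ^ 16 →
          1 + (x + (y + z)) ≤ (r + 1 + 1) * M ^ 16 := by
        intro x y z hx hy hz
        have := le_pow_mono hM (linear_le_pow hM (add_le_pow hM hx hy))
          (show max 2 12 + 1 + 1 ≤ 16 by decide)
        rw [add_mul, one_mul]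
        omega
      simp only [boundsGoT]
      rw [Timed.bind_time, Timed.bind_time, Timed.bind_time, tick_time]
      refine comb (idxT_time_le hM hS.lab.1 0) (le_pow_mono hM (zipWithT_time_le hM (k := 10) hcur
        fun o _ w _ => ?_) (by decide)) (ih _ ?_)
      · cases o with
        | some h => exact le_pow_mono hM (pure_time_le _) (by decide)
        | none =>
          refine le_pow_mono hM (bind_time_le hM (anyT_time_le hM hS.rel fun rel hrel =>
            bind_time_le hM (zipWithT_time_le hM (k := 2) hcur fun o _ row hrow => ?_)
              (anyT_time_le hM (k := 0) ?_ (by simp))) (pure_time_le _)) (by decide)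
          · cases o with
            | some h => exact nthT_time_le hM ((hS.mats rel hrel).2 row hrow) _ _
            | none => exact le_pow_mono hM (pure_time_le _) (by decide)
          · rw [zipWithT_val, List.length_zipWith]
            exact (min_le_left _ _).trans hcur
      · rw [zipWithT_val, List.length_zipWith]
        exact (min_le_left _ _).trans hcur
  refine (key r cur hcur).trans (le_trans (Nat.mul_le_mul_right _ (show r + 1 ≤ M ^ 2 from
    small_le_pow hM (k := 0) (by omega))) ?_)
  rw [← pow_add]
  exact Nat.pow_le_pow_right (by omega) (by decide)

omit hs in
theorem boundsT_time_le {b : ℕ} (hb : b ≤ M) : (boundsT s b).time ≤ M ^ 30 := by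
  unfold boundsT
  refine le_pow_mono hM (tick_bind_time_le hM (bind_time_le hM (idxT_time_le hM hS.lab.1 0)
    (bind_time_le hM (mapT_time_le hM (by simpa using hS.lab.1) fun w _ =>
      bind_time_le hM (eqNatT_time_le hM w hS.des) (pure_time_le _))
    (boundsGoT_time_le hM hS hb (by simpa using hS.lab.1))))) (by decide)

omit hM in
theorem bounds_length_le (b : ℕ) : (s.bounds b).length ≤ M := by
  rw [(bounds_inv hs b).len]; exact hS.lab.1

omit hM in
theorem reps_length_le (b : ℕ) : (s.reps b).length ≤ M := by
  refine le_trans ?_ (bounds_length_le hs hS b)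
  simp only [DState.reps, repsT, Timed.bind_val, flatMapT_val, zipWithT_val, Timed.pure_val,
    idxT_val, List.length_flatMap]
  refine (List.sum_le_card_nsmul _ 1 fun n hn => ?_).trans (by simp)
  obtain ⟨l, hl, rfl⟩ := List.mem_map.1 hn
  obtain ⟨w, -, o, -, rfl⟩ := exists_of_mem_zipWith hl
  cases o <;> simp

theorem repsT_time_le {b : ℕ} (hsigs : MatLe M (s.sigs b)) :
    (repsT (s.sigs b) (s.bounds b)).time ≤ M ^ 20 := by
  have hb := bounds_length_le hs hS b
  unfold repsT
  refine le_pow_mono hM (tick_bind_time_le hM (bind_time_le hM (idxT_time_le hM hb 0)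
    (bind_time_le hM (zipWithT_time_le hM (k := 5) (by simpa using hb) fun w _ o _ => ?_)
    (flatMapT_time_le hM (k := 0) ?_ (by simp) fun l hl => ?_)))) (by decide)
  · cases o with
    | some h => exact bind_time_le hM (nth₂T_time_le hM hsigs _ _ _) (pure_time_le _)
    | none => exact le_pow_mono hM (pure_time_le _) (by decide)
  · rw [zipWithT_val, List.length_zipWith]
    exact (min_le_right _ _).trans hb
  · rw [zipWithT_val] at hl
    obtain ⟨w, -, o, -, rfl⟩ := exists_of_mem_zipWith hl
    cases o with
    | none => exact Nat.zero_le _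
    | some h => exact (show 1 ≤ M by omega)

omit hs hS in
theorem sameSigT_time_le {sigs : List (List SExp)} (hsigs : MatLe M sigs)
    (hsize : ∀ l ∈ sigs, ∀ x ∈ l, x.size ≤ M) (h u v : ℕ) :
    (sameSigT sigs h u v).time ≤ M ^ 10 := by
  unfold sameSigT
  refine le_pow_mono hM (tick_bind_time_le hM (bind_time_le hM (nth₂T_time_le hM hsigs _ _ _)
    (bind_time_le hM (nth₂T_time_le hM hsigs _ _ _) (eqSExpT_time_le hM ?_ _)))) (by decide)
  rw [nth₂T_val]
  rcases getD_mem_or (sigs.getD h []) u .nil with h₁ | h₁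
  · rcases getD_mem_or sigs h [] with h₂ | h₂
    · exact hsize _ h₂ _ h₁
    · rw [h₂] at h₁; simp at h₁
  · rw [h₁]; simp [SExp.size]

omit hM hs hS in
theorem maxReps_length_le (s : DState) (b : ℕ) : (s.maxReps b).length ≤ (s.reps b).length :=
  List.length_filter_le _ _

omit hM in
theorem repSigs_length_le (b : ℕ) : (s.repSigs b).length ≤ M := by
  refine (sortS_length_le _).trans ?_
  rw [List.length_map]
  exact (maxReps_length_le s b).trans (reps_length_le hs hS b)

omit hM in
theorem repWorlds_length_le (b : ℕ) : (s.repWorlds b).length ≤ M := by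
  rw [repWorlds_length]
  exact repSigs_length_le hs hS b

-- It replaces an intermediate value by its name, which keeps the goals readable along the many
-- steps of the contraction.
omit hs hS in
theorem bind_time_le_of_val {α β : Type} {x : Timed α} {f : α → Timed β} {v : α} {i j : ℕ}
    (hx : x.time ≤ M ^ i) (hv : x.val = v) (hf : (f v).time ≤ M ^ j) :
    (x >>= f).time ≤ M ^ (max i j + 1) := bind_time_le hM hx (by rw [hv]; exact hf)

/-- Every list that occurs has at most `M` entries: representatives are worlds of `s`, heights range
over `b + 1` values, and each signature compared has size at most `sigBound (a + p) b`. -/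
theorem contractT_time_le {b : ℕ} (hb : b + 1 ≤ M) (hsig : sigBound (a + p) b ≤ M) :
    (contractT s b).time ≤ M ^ 60 := by
  have hsigs : MatLe M (s.sigs b) := by
    refine ⟨by simpa [DState.sigs] using hb, fun l hl => ?_⟩
    obtain ⟨h, -, rfl⟩ := List.mem_map.1 hl
    rw [sigT_length]
    exact hS.lab.1
  have hsize : ∀ l ∈ s.sigs b, ∀ x ∈ l, x.size ≤ M := by
    intro l hl x hx
    obtain ⟨h, hh, rfl⟩ := List.mem_map.1 hl
    exact sigT_size_le hs ((sigBound_mono _ (by simpa [Nat.lt_succ_iff] using hh)).trans hsig) hx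
  have hsame := sameSigT_time_le hM hsigs hsize
  have hreps := reps_length_le hs hS b
  have hmax := (maxReps_length_le s b).trans hreps
  have hsorted := repSigs_length_le hs hS b
  have hworlds := repWorlds_length_le hs hS b
  have hmaxsize : ∀ x ∈ (s.maxReps b).map Rep.sig, x.size ≤ M := by
    intro z hz
    obtain ⟨x, hx, rfl⟩ := List.mem_map.1 hz
    have hx' := ((mem_maxReps hs).1 hx).1
    rw [rep_sig hs hx']
    exact (size_le_of_mem_sigSet (DState.sig_mem_sigSet hs _ (rep_lt hs hx'))).trans
      ((sigBound_mono _ (rep_bound_le hs hx')).trans hsig)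
  have hbound : ∀ y ∈ s.repWorlds b, y.bound ≤ M := by
    intro y hy
    obtain ⟨j, hj, rfl⟩ := List.mem_iff_getElem.1 hy
    have := rep_bound_le hs (repWorlds_mem hs hj)
    omega
  unfold contractT
  -- The exponent granted to the rest of the program falls by one with each step that is split off.
  refine le_pow_mono hM (tick_bind_time_le hM (j := 58) ?_) (by decide)
  refine le_pow_mono hM (bind_time_le hM (i := 2) (j := 57)
    ((downT_time b).trans_le (small_le_pow hM (k := 0) (by omega))) ?_) (by decide)
  refine le_pow_mono hM (bind_time_le hM (i := 2) (j := 56)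
    ((revT_time _ _).trans_le (small_le_pow hM (k := 0) (by simp; omega))) ?_) (by decide)
  refine le_pow_mono hM (bind_time_le_of_val hM (i := 24) (j := 55)
    (mapT_time_le hM (by simpa using hb) fun h hh => ?_) (sigs_val s b) ?_) (by decide)
  · have hh' : h ≤ b := by simpa [Nat.lt_succ_iff] using hh
    exact sigT_time_le hM hs hS (by omega) ((sigBound_mono _ hh').trans hsig)
  refine le_pow_mono hM (bind_time_le_of_val hM (i := 30) (j := 54) (v := s.bounds b)
    (boundsT_time_le hM hS (by omega)) rfl ?_) (by decide)
  refine le_pow_mono hM (bind_time_le_of_val hM (i := 20) (j := 53) (v := s.reps b)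
    (repsT_time_le hM hs hS hsigs) rfl ?_) (by decide)
  refine le_pow_mono hM (bind_time_le_of_val hM (i := 20) (j := 52)
    (filterT_time_le hM (k := 18) hreps fun x hx => le_pow_mono hM
      (bind_time_le hM (i := 16) (j := 0) (anyT_time_le hM hreps fun y hy => le_pow_mono hM
        (bind_time_le hM (leT_time_le hM _ ((rep_bound_le hs hy).trans (by omega)))
        (bind_time_le hM (hsame _ _ _) (pure_time_le _))) (by decide))
      (pure_time_le _)) (by decide)) (maxReps_val s b) ?_) (by decide)
  refine le_pow_mono hM (bind_time_le_of_val hM (i := 2) (j := 51)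
    (mapT_time_le hM (k := 0) hmax (by simp))
    (mapT_val (fun x : Rep => (pure x.sig : Timed SExp)) (s.maxReps b)) ?_) (by decide)
  refine le_pow_mono hM (bind_time_le_of_val hM (i := 7) (j := 50)
    (sortT_time_le hM (by simpa using hmax) hmaxsize) (repSigs_val s b) ?_) (by decide)
  refine le_pow_mono hM (bind_time_le_of_val hM (i := 12) (j := 49)
    (mapT_time_le hM (k := 10) hsorted fun z hz => le_pow_mono hM
      (bind_time_le hM (i := 6) (j := 2)
        (findT_time_le hM hmax (fun x _ => eqSExpT_time_le hM (hmaxsize z (mem_sortS.1 hz)) _) 0)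
        (nthT_time_le hM hmax _ _)) (by decide)) (repWorlds_val s b) ?_) (by decide)
  have hids : (idxT (s.repWorlds b) 0).val.length ≤ M := by simpa using hworlds
  have hvs : (idxT s.lab 0).val.length ≤ M := by simpa using hS.lab.1
  refine le_pow_mono hM (bind_time_le hM (j := 48) (idxT_time_le hM hworlds 0) ?_) (by decide)
  refine le_pow_mono hM (bind_time_le hM (j := 47) (idxT_time_le hM hS.lab.1 0) ?_) (by decide)
  refine le_pow_mono hM (bind_time_le hM (j := 46) (mapT_time_le hM hworlds fun x _ =>
    nthT_time_le hM hS.lab.1 _ _) ?_) (by decide)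
  refine le_pow_mono hM (bind_time_le hM (i := 34) (j := 30) (mapT_time_le hM hS.rel fun r hr =>
    mapT_time_le hM (k := 30) hworlds fun x hx => ?_) ?_) (by decide)
  · rcases hxb : x.bound with _ | h
    · exact le_pow_mono hM (mapT_time_le hM (k := 0) hids (by simp)) (by decide)
    · refine le_pow_mono hM (bind_time_le hM (filterT_time_le hM hvs fun v _ =>
          nth₂T_time_le hM (hS.mats r hr) _ _ _)
        (bind_time_le hM (mapT_time_le hM ?_ fun v _ => findT_time_le hM hworlds (fun y hy =>
          bind_time_le hM (leT_time_le hM _ (hbound y hy))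
          (bind_time_le hM (hsame _ _ _) (pure_time_le _))) 0)
        (mapT_time_le hM hids fun j hj => anyT_time_le hM ?_ fun t _ =>
          eqNatT_time_le hM _ ?_))) (by decide)
      · rw [filterT_val]
        exact (List.length_filter_le _ _).trans hvs
      · rw [mapT_val, List.length_map, filterT_val]
        exact (List.length_filter_le _ _).trans hvs
      · rw [idxT_val, ← List.range_eq_range', List.mem_range] at hj
        omega
  refine le_pow_mono hM (bind_time_le hM (nth₂T_time_le hM hsigs _ _ _)
    (bind_time_le hM (findT_time_le hM hsorted (fun z _ => eqSExpT_time_le hM ?_ _) 0)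
    (pure_time_le _))) (by decide)
  rw [nth₂T_val, s.getD_sigs le_rfl]
  exact (size_le_of_mem_sigSet (DState.sig_mem_sigSet hs _ hs.des)).trans hsig

end Contract

end DEL

namespace DEL

variable {a p M : ℕ}

/-! ### Time of the search -/

/-- All numbers that matter in the search are at most `M`. -/
structure Limits (T : Task a p) (b M : ℕ) : Prop where
  four : 4 ≤ M
  agents : a ≤ M
  atoms : p ≤ M
  sigs : (b + 1) * sigBound (a + p) b ≤ M
  worlds : T.n ≤ M
  actions : T.actions.length ≤ M
  goal : T.goal.size ≤ M
  small : ∀ α ∈ T.actions, SmallAction M α.encode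
  prod : ∀ α ∈ T.actions, (b + 1) * sigBound (a + p) b * α.m ≤ M

section

variable {T : Task a p} {b : ℕ} (hT : Limits T b M)

include hT

theorem Limits.bound_lt {b' : ℕ} (hb : b' ≤ b) : b' + 1 ≤ M := by
  have h₁ := hT.sigs
  have h₂ := Nat.le_mul_of_pos_right (b + 1) (one_le_sigBound (a + p) b)
  omega

theorem Limits.sigBound_le {b' : ℕ} (hb : b' ≤ b) : sigBound (a + p) b' ≤ M :=
  (sigBound_mono _ hb).trans ((Nat.le_mul_of_pos_left _ (Nat.succ_pos b)).trans hT.sigs)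

omit hT in
theorem contract_length_le_of_le {s : DState} (hs : s.WF a p) {b' : ℕ} (hb : b' ≤ b) :
    (s.contract b').lab.length ≤ (b + 1) * sigBound (a + p) b :=
  (contract_length_le hs b').trans (Nat.mul_le_mul (by omega) (sigBound_mono _ hb))

theorem Limits.small_contract {s : DState} (hs : s.WF a p) {b' : ℕ} (hb : b' ≤ b) :
    Small M (s.contract b') :=
  (contract_wf hs b').small ((contract_length_le_of_le hs hb).trans hT.sigs) hT.agents hT.atoms

theorem initNodeT_time_le {s : DState} (hs : s.WF a p) (hn : s.lab.length ≤ M) {b' : ℕ}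
    (hb : b' ≤ b) (β : Bool) (path : List ℕ) : (initNodeT s b' β path).time ≤ M ^ 65 := by
  have hM := hT.four
  have hS := hs.small hn hT.agents hT.atoms
  unfold initNodeT
  exact le_pow_mono hM (tick_bind_time_le hM (bind_time_le hM
    (contractT_time_le hM hs hS (hT.bound_lt hb) (hT.sigBound_le hb))
    (bind_time_le hM (bisimT_time_le hM (hT.small_contract hs hb) hS) (pure_time_le _))))
    (by decide)

theorem eqStateT_time_le {s : DState} (hS : Small M s) {t : DState} (hd : t.des ≤ M) :
    (eqStateT s t).time ≤ M ^ 15 := by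
  have hM := hT.four
  have hmat : ∀ {X : List (List Bool)}, MatLe M X → ∀ Y, (eqMatT X Y).time ≤ M ^ 6 := by
    intro X hX Y
    unfold eqMatT
    refine le_pow_mono hM (tick_bind_time_le hM (eqListT_time_le hM hX.1 fun l hl m _ =>
      eqListT_time_le hM (k := 1) (hX.2 l hl) fun x _ y _ => ?_)) (by decide)
    simp only [eqBoolT, Timed.bind_time, tick_time, Timed.pure_time, pow_one]
    omega
  unfold eqStateT
  exact le_pow_mono hM (tick_bind_time_le hM (bind_time_le hM (hmat hS.lab _)
    (bind_time_le hM (eqListT_time_le hM hS.rel fun r hr q _ => hmat (hS.mats r hr) _)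
    (bind_time_le hM (eqNatT_time_le hM _ hd) (pure_time_le _))))) (by decide)

omit hT in
theorem ContractPair.wf {x : DState × ℕ} (hx : ContractPair a p b x) : x.1.WF a p := by
  obtain ⟨-, s, hs, h⟩ := hx
  rw [h]
  exact contract_wf hs _

omit hT in
theorem ContractPair.length_le {x : DState × ℕ} (hx : ContractPair a p b x) :
    x.1.lab.length ≤ (b + 1) * sigBound (a + p) b := by
  obtain ⟨hb, s, hs, h⟩ := hx
  rw [h]
  exact contract_length_le_of_le hs hb

theorem Limits.small_of_contractPair {x : DState × ℕ} (hx : ContractPair a p b x) :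
    Small M x.1 := by
  obtain ⟨hb, s, hs, h⟩ := hx
  rw [h]
  exact hT.small_contract hs hb

/-- Applicability is required because only then is the updated state well-formed: otherwise its
designated pair is not among its worlds. -/
theorem childNodeT_time_le {n : Node} (hn : ContractPair a p b (n.state, n.bound))
    {α : Action a p} (hα : α ∈ T.actions)
    (happ : (n.state.state a p hn.wf.des).Applicable α) (j m dg : ℕ) :
    (childNodeT n α.encode j m dg).time ≤ M ^ 75 := by
  have hM := hT.four
  have hS := hT.small_of_contractPair hn
  have hb := hT.bound_lt hn.1
  have hprod : n.state.lab.length * α.m ≤ M :=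
    (Nat.mul_le_mul_right _ hn.length_le).trans (hT.prod α hα)
  have hup : (updateT n.state α.encode).time ≤ M ^ 30 :=
    updateT_time_le hM hn.wf hS (hT.small α hα) (by simpa [Action.encode] using hprod)
  have hinit : ∀ b' ≤ n.bound, ∀ β path,
      (initNodeT (updateT n.state α.encode).val b' β path).time ≤ M ^ 65 := by
    intro b' hb' β path
    refine initNodeT_time_le hT (updateT_wf hn.wf α happ) ?_ (hb'.trans hn.1) β path
    rw [updateT_lab_length]
    exact (updateWorlds_length_le _ _).trans hprod
  unfold childNodeT
  refine le_pow_mono hM (tick_bind_time_le hM (ite_time_le hM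
    (bind_time_le hM hup (bind_time_le hM (hinit _ le_rfl _ _) (pure_time_le _)))
    (bind_time_le hM (i := 2) ((subT_time_le _ _).trans (small_le_pow hM (k := 0) (by omega)))
    (bind_time_le hM (leT_time_le hM _ ?_) (ite_time_le hM
    (bind_time_le hM hup (bind_time_le hM (hinit _ ?_ _ _) (pure_time_le _)))
    (pure_time_le _)))))) (by decide)
  · rw [subT_val]; omega
  · rw [subT_val]; omega

/-- The invariant of the search by which its time is estimated. -/
structure TimeInv (a p b : ℕ) (c : Config) : Prop where
  nodup : c.visited.Nodup
  pair : ∀ x ∈ c.visited, ContractPair a p b x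
  front : ∀ n ∈ c.frontier, (n.state, n.bound) ∈ c.visited ∧ n.path.length < c.visited.length
  length : c.frontier.length ≤ c.visited.length

theorem TimeInv.visited_le {c : Config} (H : TimeInv a p b c) : c.visited.length ≤ M :=
  (length_le_of_contractPair H.nodup H.pair).trans hT.sigs

theorem pushT_time_le {c : Config} (H : TimeInv a p b c) {n : Node}
    (hn : ContractPair a p b (n.state, n.bound)) : (pushT c n).time ≤ M ^ 25 := by
  have hM := hT.four
  have hS := hT.small_of_contractPair hn
  have hb := hT.bound_lt hn.1
  unfold pushT
  refine le_pow_mono hM (tick_bind_time_le hM (bind_time_le hM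
    (anyT_time_le hM (H.visited_le hT) fun x hx =>
      bind_time_le hM (eqStateT_time_le hT (hT.small_of_contractPair (H.pair x hx)) hS.des)
      (bind_time_le hM (eqNatT_time_le hM _ (by omega)) (pure_time_le _)))
    (ite_time_le hM (pure_time_le _) (bind_time_le hM (i := 2) ?_ (pure_time_le _)))))
    (by decide)
  rw [appendT_time]
  exact small_le_pow hM (k := 0) (by have := H.visited_le hT; have := H.length; omega)

omit hT in
theorem child_contractPair {n n₁ : Node} (hn : ContractPair a p b (n.state, n.bound))
    {α : Action a p} {dg j : ℕ} (h : child dg n α j = some n₁) :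
    ContractPair a p b (n₁.state, n₁.bound) ∧ n₁.path.length = n.path.length + 1 := by
  obtain ⟨happ, hmd, b', β, rfl, hb⟩ := child_spec hn.wf h
  refine ⟨⟨?_, _, updateT_wf hn.wf α happ, rfl⟩, by simp⟩
  have := hn.1
  dsimp only at this ⊢
  rcases hb with ⟨rfl, -⟩ | ⟨hb, -⟩ <;> omega

/-- The invariant of the expansion of the node `n` in the configuration `c₀`. -/
structure ExpandTimeInv (a p b : ℕ) (n : Node) (c₀ c : Config) : Prop extends
    TimeInv a p b c where
  mem : (n.state, n.bound) ∈ c.visited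
  path : n.path.length < c.visited.length
  diff : c.frontier.length + c₀.visited.length = c₀.frontier.length + c.visited.length

-- A new child lengthens queue and list of visited states by one each, and its path is one longer
-- than that of its parent; so paths stay shorter than the list of visited states.
omit hT in
theorem ExpandTimeInv.tryT {n : Node} {c₀ c : Config} (H : ExpandTimeInv a p b n c₀ c)
    (dg j : ℕ) (α : Action a p) : ExpandTimeInv a p b n c₀ (tryT dg n c j α.encode).val := by
  rw [tryT_val]
  cases hc : child dg n α j with
  | none => exact H
  | some n₁ =>
    obtain ⟨h₁, h₂⟩ := child_contractPair (H.pair _ H.mem) hc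
    simp only [pushT_val]
    split
    · exact H
    · rename_i hnew
      have h₃ := H.path
      have h₄ := H.length
      have h₅ := H.diff
      refine ⟨⟨List.nodup_cons.2 ⟨hnew, H.nodup⟩, ?_, ?_, ?_⟩, ?_, ?_, ?_⟩
      · intro x hx
        rcases List.mem_cons.1 hx with rfl | hx
        · exact h₁
        · exact H.pair x hx
      · intro m hm
        rcases List.mem_append.1 hm with hm | hm
        · obtain ⟨h₆, h₇⟩ := H.front m hm
          exact ⟨List.mem_cons_of_mem _ h₆, h₇.trans (Nat.lt_succ_self _)⟩
        · rw [List.mem_singleton.1 hm]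
          exact ⟨List.mem_cons_self, by simp only [List.length_cons]; omega⟩
      · simpa using h₄
      · exact List.mem_cons_of_mem _ H.mem
      · simp only [List.length_cons]; omega
      · simp only [List.length_cons, List.length_append, List.length_nil]; omega

theorem tryT_time_le {n : Node} {c₀ c : Config} (H : ExpandTimeInv a p b n c₀ c)
    (dg j : ℕ) {α : Action a p} (hα : α ∈ T.actions) :
    (tryT dg n c j α.encode).time ≤ M ^ 80 := by
  have hM := hT.four
  have hn := H.pair _ H.mem
  have hS := hT.small_of_contractPair hn
  have hb := hT.bound_lt hn.1
  unfold DEL.tryT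
  refine le_pow_mono hM (tick_bind_time_le hM (bind_time_le hM
    (applicableT_time_le hM hn.wf hS (hT.small α hα))
    (bind_time_le hM (actionMdT_time_le hM (hT.small α hα))
    (bind_time_le hM (leT_time_le hM _ (show n.bound ≤ M by omega)) (j := 76) ?_)))) (by decide)
  split
  · rename_i hc
    rw [leT_val, actionMdT_val, Bool.and_eq_true, applicableT_iff _ hn.wf] at hc
    refine bind_time_le hM (i := 75) (j := 25) (childNodeT_time_le hT hn hα hc.1 _ _ _) ?_
    cases hch : (childNodeT n α.encode j (actionMdT α.encode).val dg).val with
    | none => exact le_pow_mono hM (pure_time_le _) (by decide)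
    | some n₁ =>
      refine pushT_time_le hT H.toTimeInv (child_contractPair hn (α := α) (dg := dg) (j := j) ?_).1
      rw [child, ← hch, actionMdT_val, if_pos]
      rw [Bool.and_eq_true, applicableT_iff _ hn.wf]
      exact hc
  · exact le_pow_mono hM (pure_time_le _) (by decide)

theorem expandT_time_le {n : Node} {c₀ c : Config} (H : ExpandTimeInv a p b n c₀ c)
    (dg j : ℕ) {l : List (Action a p)} (hl : ∀ α ∈ l, α ∈ T.actions) :
    (expandT dg n c j (l.map Action.encode)).time ≤ l.length * (M ^ 80 + 1) + 1 ∧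
    ExpandTimeInv a p b n c₀ (expandT dg n c j (l.map Action.encode)).val := by
  induction l generalizing c j with
  | nil => exact ⟨by simp [expandT], H⟩
  | cons α l ih =>
    have h₁ := tryT_time_le hT H dg j (hl α (by simp))
    obtain ⟨h₂, h₃⟩ := ih (H.tryT dg j α) (j + 1) fun β hβ => hl β (by simp [hβ])
    refine ⟨?_, h₃⟩
    simp only [List.map_cons, expandT, Timed.bind_time, tick_time, List.length_cons]
    linarith

/-- Reversing the path is affordable because a path is shorter than the list of visited states. A
pass removes one node from the queue and otherwise lengthens both lists equally, which is the
equation for their lengths. -/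
theorem loopT_time_le {c : Config} (H : TimeInv a p b c) :
    (loopT T.encode c).time ≤ M ^ 90 ∧ ∀ c₁, (loopT T.encode c).val = .inr c₁ →
      TimeInv a p b c₁ ∧
        c₁.frontier.length + c.visited.length + 1 = c.frontier.length + c₁.visited.length := by
  have hM := hT.four
  obtain ⟨frontier, visited⟩ := c
  cases frontier with
  | nil =>
    simp only [loopT, Timed.bind_time, Timed.bind_val, tick_time, Timed.pure_time, Timed.pure_val]
    exact ⟨Nat.one_le_pow _ _ (by omega), by simp⟩
  | cons n rest =>
    obtain ⟨h₁, h₂⟩ := H.front n (by simp)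
    have hlen := H.visited_le hT
    have hlen' := H.length
    simp only [List.length_cons] at h₂ hlen hlen'
    have hn := H.pair _ h₁
    have hE : ExpandTimeInv a p b n ⟨rest, visited⟩ ⟨rest, visited⟩ :=
      ⟨⟨H.nodup, H.pair, fun m hm => H.front m (by simp [hm]), by dsimp only; omega⟩, h₁, h₂, rfl⟩
    obtain ⟨h₃, h₄⟩ := expandT_time_le hT hE T.goal.md 0 (l := T.actions) fun α hα => hα
    have h₃ := loop_le_pow hM h₃ hT.actions
    constructor
    · unfold loopT
      refine le_pow_mono hM (tick_bind_time_le hM (bind_time_le hM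
        (holdsT_time_le hM hn.wf (hT.small_of_contractPair hn) hT.goal)
        (ite_time_le hM (bind_time_le hM (i := 2) ?_ (pure_time_le _))
        (bind_time_le hM (mdT_time_le hM hT.goal) (bind_time_le hM (i := 82) ?_
          (pure_time_le _)))))) (by decide)
      · rw [revT_time]
        exact small_le_pow hM (k := 0) (by omega)
      · rw [mdT_val]
        exact h₃
    · intro c₁ hc
      simp only [loopT, Timed.bind_val] at hc
      split at hc
      · simp at hc
      · simp only [Timed.bind_val, Timed.pure_val, Sum.inr.injEq, mdT_val] at hc
        change (expandT T.goal.md n ⟨rest, visited⟩ 0 (T.actions.map Action.encode)).val = c₁ at hc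
        rw [hc] at h₄
        refine ⟨h₄.toTimeInv, ?_⟩
        have := h₄.diff
        simp only [List.length_cons] at this ⊢
        omega

/-- The potential is the length of the queue plus the number of pairs that may still be generated.
Each pass that goes on lowers it by one. -/
theorem exists_loopRun {c : Config} (H : TimeInv a p b c) {r : ℕ}
    (hr : c.frontier.length + (b + 1) * sigBound (a + p) b ≤ r + c.visited.length) :
    ∃ t out, LoopRun T.encode c t out ∧ t ≤ (r + 1) * M ^ 90 := by
  induction r generalizing c with
  | zero =>
    obtain ⟨h₁, h₂⟩ := loopT_time_le hT H
    cases hc : (loopT T.encode c).val with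
    | inl out => exact ⟨_, out, .halt c out hc, by simpa using h₁⟩
    | inr c₁ =>
      obtain ⟨h₃, h₄⟩ := h₂ c₁ hc
      have := length_le_of_contractPair h₃.nodup h₃.pair
      omega
  | succ r ih =>
    obtain ⟨h₁, h₂⟩ := loopT_time_le hT H
    have h₅ : (r + 1 + 1) * M ^ 90 = M ^ 90 + (r + 1) * M ^ 90 := by ring
    cases hc : (loopT T.encode c).val with
    | inl out => exact ⟨_, out, .halt c out hc, by omega⟩
    | inr c₁ =>
      obtain ⟨h₃, h₄⟩ := h₂ c₁ hc
      obtain ⟨t, out, h₆, h₇⟩ := ih h₃ (by omega)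
      exact ⟨_, out, .next c c₁ t out hc h₆, by omega⟩

theorem exists_boundedGraphSearch : ∃ t out, BoundedGraphSearch T b t out ∧ t ≤ M ^ 100 := by
  have hM := hT.four
  have hwf := T.encode_wf
  have hN := hT.sigs
  have hlen : T.encode.init.lab.length ≤ M := by simpa [Task.encode] using hT.worlds
  have hinv : TimeInv a p b (startT T.encode b).val := by
    simp only [startT, Timed.bind_val, Timed.pure_val, initNodeT_val]
    refine ⟨List.nodup_singleton _, ?_, ?_, le_rfl⟩
    · simp only [List.mem_singleton, forall_eq]
      exact ⟨le_rfl, _, hwf, rfl⟩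
    · simp
  -- At the start both lists have length one, so the potential is within the total number of pairs.
  obtain ⟨t, out, h₁, h₂⟩ := exists_loopRun hT hinv (r := (b + 1) * sigBound (a + p) b)
    (by simp [startT]; omega)
  refine ⟨_, out, ⟨t, h₁, rfl⟩, ?_⟩
  have h₃ : (startT T.encode b).time ≤ M ^ 70 := by
    unfold startT
    exact le_pow_mono hM (tick_bind_time_le hM (bind_time_le hM
      (initNodeT_time_le hT hwf hlen le_rfl _ _) (pure_time_le _))) (by decide)
  have h₄ : t ≤ M ^ 92 := by
    refine h₂.trans ((Nat.mul_le_mul_right _ (small_le_pow hM (k := 0) (by omega))).trans ?_)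
    rw [← pow_add]
  exact le_pow_mono hM (add_le_pow hM h₃ h₄) (by decide)

end

end DEL

namespace DEL

variable {a p M : ℕ}

/-! ### Sizes of tasks -/

theorem Action.limits (α : Action a p) : α.m ≤ α.size ∧ (∀ e, (α.pre e).size ≤ α.size) ∧
    ∀ e q, (α.post e q).size ≤ α.size := by
  unfold Action.size
  refine ⟨by omega, fun e => ?_, fun e q => ?_⟩
  · have := Finset.single_le_sum (f := fun e => (α.pre e).size) (fun _ _ => Nat.zero_le _)
      (Finset.mem_univ e)
    omega
  · have h₁ := Finset.single_le_sum (f := fun q => (α.post e q).size) (fun _ _ => Nat.zero_le _)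
      (Finset.mem_univ q)
    have h₂ := Finset.single_le_sum (f := fun e => ∑ q, (α.post e q).size)
      (fun _ _ => Nat.zero_le _) (Finset.mem_univ e)
    omega

theorem Action.one_le_size (α : Action a p) : 1 ≤ α.size :=
  (Nat.succ_le_of_lt (Nat.zero_lt_of_lt α.des.2)).trans α.limits.1

theorem Action.smallAction (α : Action a p) (hα : α.size ≤ M) (hp : p ≤ M) :
    SmallAction M α.encode := by
  obtain ⟨h₁, h₂, h₃⟩ := α.limits
  have hm := h₁.trans hα
  refine ⟨by simpa [encode] using hm, ?_, ⟨by simpa [encode] using hm, ?_⟩, ?_, ?_,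
    α.des.2.le.trans hm⟩
  · simp only [encode, List.forall_mem_ofFn_iff]
    exact fun e => (h₂ e).trans hα
  · simp only [encode, List.forall_mem_ofFn_iff, List.length_ofFn]
    exact fun _ => hp
  · simp only [encode, List.forall_mem_ofFn_iff]
    exact fun e q => (h₃ e q).trans hα
  · simp only [encode, List.forall_mem_ofFn_iff]
    refine fun i => ⟨by simpa using hm, ?_⟩
    simp only [List.forall_mem_ofFn_iff, List.length_ofFn]
    exact fun _ => hm

theorem Form.one_le_size (φ : Form a p) : 1 ≤ φ.size := by
  cases φ <;> simp [size]

theorem Task.n_le_size (T : Task a p) : T.n + T.goal.size ≤ T.size := by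
  unfold Task.size
  omega

theorem Task.two_le_size (T : Task a p) : 2 ≤ T.size := by
  have h₁ := T.goal.one_le_size
  have h₂ := T.n_le_size
  have h₃ := Nat.zero_lt_of_lt T.des.2
  omega

theorem Task.actions_le_size (T : Task a p) :
    T.actions.length ≤ T.size ∧ ∀ α ∈ T.actions, α.size ≤ T.size := by
  have h₁ : (T.actions.map Action.size).sum ≤ T.size := by
    unfold Task.size
    omega
  refine ⟨le_trans ?_ h₁, fun α hα => le_trans (List.single_le_sum (by simp) _ (List.mem_map_of_mem hα)) h₁⟩
  have := List.card_nsmul_le_sum (T.actions.map Action.size) 1 (by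
    simp only [List.mem_map, forall_exists_index, and_imp, forall_apply_eq_imp_iff₂]
    exact fun α _ => α.one_le_size)
  simpa using this

/-- The factor `a + p + 1` is needed because `|T|` counts edges and true atoms, and so bounds
neither the number of agents nor that of atoms. The product of `|T|` and the number of contracted
worlds covers updated states. -/
theorem Task.limits (T : Task a p) {b : ℕ}
    (hM : 4 * T.size * (a + p + 1) * ((b + 1) * sigBound (a + p) b) ≤ M) : Limits T b M := by
  set N := (b + 1) * sigBound (a + p) b with hN
  have hN' : 1 ≤ N := Nat.mul_pos (Nat.succ_pos b) (one_le_sigBound _ _)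
  have hS := T.two_le_size
  obtain ⟨h₁, h₂⟩ := T.actions_le_size
  have h₃ := T.n_le_size
  have h₄ : T.size ≤ M ∧ 4 ≤ M := by
    have : 4 * T.size * 1 * 1 ≤ 4 * T.size * (a + p + 1) * N :=
      Nat.mul_le_mul (Nat.mul_le_mul_left _ (by omega)) hN'
    omega
  have h₅ : a + p + 1 ≤ M := by
    have : 1 * (a + p + 1) * 1 ≤ 4 * T.size * (a + p + 1) * N :=
      Nat.mul_le_mul (Nat.mul_le_mul_right _ (by omega)) hN'
    omega
  have h₆ : N * T.size ≤ M := by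
    refine le_trans ?_ hM
    rw [mul_comm]
    refine Nat.mul_le_mul_right _ ?_
    have : 4 * T.size * 1 ≤ 4 * T.size * (a + p + 1) := Nat.mul_le_mul_left _ (by omega)
    omega
  refine ⟨h₄.2, by omega, by omega, ?_, by omega, by omega, by omega, fun α hα =>
    α.smallAction ((h₂ α hα).trans h₄.1) (by omega), fun α hα => ?_⟩
  · exact (Nat.le_mul_of_pos_right _ (by omega)).trans h₆
  · exact (Nat.mul_le_mul_left _ (α.limits.1.trans (h₂ α hα))).trans h₆

/-! ### Time bound for the search -/

-- With `q = (b+1)/200` one has `b + 1 < 200(q+1) ≤ 2^8·2^q`, whose hundredth power is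
-- `2^800·2^(100q)` with `100q ≤ b`; and the tower of height `b` is at least `b`, even over 0.
set_option exponentiation.threshold 1000 in
theorem succ_pow_le_exp2 (b x : ℕ) : (b + 1) ^ 100 ≤ 2 ^ 800 * exp2 (b + 1) x := by
  set q := (b + 1) / 200 with hq
  have h₁ : b + 1 ≤ 2 ^ 8 * 2 ^ q := by
    have h₂ : q < 2 ^ q := Nat.lt_two_pow_self
    have h₃ : b + 1 < 200 * (q + 1) := by omega
    omega
  calc (b + 1) ^ 100 ≤ (2 ^ 8 * 2 ^ q) ^ 100 := Nat.pow_le_pow_left h₁ _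
    _ = 2 ^ 800 * 2 ^ (q * 100) := by rw [mul_pow, ← pow_mul, ← pow_mul]
    _ ≤ 2 ^ 800 * 2 ^ exp2 b x :=
        Nat.mul_le_mul_left _ (Nat.pow_le_pow_right (by omega) (le_trans (by omega) (le_exp2 b x)))

-- All three factors are compared with one tower `E`: they contribute 100, 1 and 100 to its exponent
-- 201, and `201·12 = 2412`.
set_option exponentiation.threshold 1000 in
theorem bound_le_exp2 (x b : ℕ) :
    (x + 1) ^ 100 * (b + 1) ^ 100 * sigBound x b ^ 100 ≤ 2 ^ 800 * exp2 (b + 1) (2412 * x) := by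
  -- Powers can be moved into the argument of a tower only if it is positive; without agents and
  -- atoms, `sigBound` is 1 and only the factor `b + 1` is left.
  rcases Nat.eq_zero_or_pos x with rfl | hx
  · have h : sigBound 0 b = 1 := by cases b <;> simp [sigBound]
    simpa [h] using succ_pow_le_exp2 b 0
  · set E := exp2 (b + 1) (12 * x) with hE
    have h₁ : x + 1 ≤ E := by
      have h₂ : ∀ n y, y ≤ exp2 n y := fun n y => by
        induction n with
        | zero => exact le_rfl
        | succ n ih => exact ih.trans (exp2_le_succ n y)
      have := h₂ (b + 1) (12 * x)
      omega
    calc (x + 1) ^ 100 * (b + 1) ^ 100 * sigBound x b ^ 100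
        ≤ E ^ 100 * (2 ^ 800 * E) * E ^ 100 :=
          Nat.mul_le_mul (Nat.mul_le_mul (Nat.pow_le_pow_left h₁ _) (succ_pow_le_exp2 b _))
            (Nat.pow_le_pow_left (sigBound_le_exp2 x b) _)
      _ = 2 ^ 800 * E ^ 201 := by ring
      _ ≤ 2 ^ 800 * exp2 (b + 1) (201 * (12 * x)) :=
          Nat.mul_le_mul_left _ (exp2_pow_le b (by omega) 201)
      _ = _ := by rw [← mul_assoc 201, show 201 * 12 = 2412 by rfl]

-- The exponent 1100 is `3·100`, from `(4|T|)^100`, plus 800, from the constant `2^800 ≤ |T|^800`.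
set_option exponentiation.threshold 1000 in
theorem boundedGraphSearch_time (T : Task a p) (b : ℕ) : ∃ t out, BoundedGraphSearch T b t out ∧
    t ≤ T.size ^ 1100 * exp2 (b + 1) (2412 * (a + p)) := by
  obtain ⟨t, out, h₁, h₂⟩ := exists_boundedGraphSearch (T.limits (b := b) le_rfl)
  refine ⟨t, out, h₁, h₂.trans ?_⟩
  have h₃ : 2 ^ 2 * T.size ≤ T.size ^ 3 := by
    rw [pow_succ]
    exact Nat.mul_le_mul_right _ (Nat.pow_le_pow_left T.two_le_size 2)
  calc (4 * T.size * (a + p + 1) * ((b + 1) * sigBound (a + p) b)) ^ 100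
      = (2 ^ 2 * T.size) ^ 100 *
          ((a + p + 1) ^ 100 * (b + 1) ^ 100 * sigBound (a + p) b ^ 100) := by
        rw [mul_pow, mul_pow, mul_pow (b + 1), mul_assoc, mul_assoc (_ ^ 100)]; rfl
    _ ≤ (T.size ^ 3) ^ 100 * (T.size ^ 800 * exp2 (b + 1) (2412 * (a + p))) :=
        Nat.mul_le_mul (Nat.pow_le_pow_left h₃ _) ((bound_le_exp2 (a + p) b).trans
          (Nat.mul_le_mul_right _ (Nat.pow_le_pow_left T.two_le_size _)))
    _ = _ := by rw [← pow_mul, ← mul_assoc, ← pow_add]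

/-! ### Plans of bounded length -/

theorem shortT_val {α : Type} (l : List α) (u : ℕ) :
    (shortT l u).val = decide (l.length ≤ u) := by
  induction l generalizing u with
  | nil => simp [shortT]
  | cons x l ih => cases u <;> simp [shortT, ih]

theorem shortT_time_le {α : Type} (l : List α) (u : ℕ) : (shortT l u).time ≤ u + 1 := by
  induction l generalizing u with
  | nil => simp [shortT]
  | cons x l ih =>
    cases u with
    | zero => simp [shortT]
    | succ u =>
      have := ih u
      simp only [shortT, Timed.bind_time, tick_time]
      omega

theorem trimT_time_le (u : ℕ) (out : Option (List ℕ)) : (trimT u out).time ≤ u + 2 := by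
  cases out with
  | none => simp [trimT]
  | some π =>
    have := shortT_time_le π u
    simp only [trimT, Timed.bind_time, tick_time, Timed.pure_time]
    omega

theorem trimT_val_eq_some {u : ℕ} {out : Option (List ℕ)} {π : List ℕ} :
    (trimT u out).val = some π ↔ out = some π ∧ π.length ≤ u := by
  cases out with
  | none => simp [trimT]
  | some π' =>
    simp only [trimT, Timed.bind_val, Timed.pure_val, shortT_val, decide_eq_true_eq]
    split
    · simp only [Option.some_inj]
      exact ⟨fun h => ⟨h, h ▸ ‹_›⟩, fun h => h.1⟩
    · simp only [reduceCtorEq, Option.some_inj, false_iff, not_and]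
      rintro rfl
      assumption

/-- If a solution of length at most `u` exists, the depth bound covers it, so the search returns a
plan that is no longer and passes the length check. -/
theorem PlanWithin.correct {T : Task a p} {u t : ℕ} {out : Option (List ℕ)}
    (h : PlanWithin T u t out) : (∀ π, out = some π → T.IsSolution π ∧ π.length ≤ u) ∧
      (out = none → ¬ ∃ π, T.IsSolution π ∧ π.length ≤ u) := by
  obtain ⟨t₁, out₁, hrun, rfl, -⟩ := h
  rw [depthBoundT_val] at hrun
  obtain ⟨h₁, h₂⟩ := hrun.correct (Nat.le_add_left _ _)
  refine ⟨fun π hπ => ?_, ?_⟩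
  · rw [trimT_val_eq_some] at hπ
    exact ⟨h₁ π hπ.1, hπ.2⟩
  · rintro hnone ⟨π, hπ, hlen⟩
    obtain ⟨π', h₃, h₄⟩ := h₂ π hπ (Nat.add_le_add_right (Nat.mul_le_mul_left _ hlen) _)
    rw [trimT_val_eq_some.2 ⟨h₃, h₄.trans hlen⟩] at hnone
    simp at hnone

/-! ### Time and computability for plans of bounded length -/

theorem Limits.depthBoundT_time_le {T : Task a p} {b u : ℕ} (hT : Limits T b M) (hu : u ≤ M) :
    (depthBoundT T.encode u).time ≤ M ^ 40 := by
  have hM := hT.four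
  have hlen : T.encode.actions.length ≤ M := by simpa [Task.encode] using hT.actions
  have hmem : ∀ α ∈ T.encode.actions, SmallAction M α := by
    simp only [Task.encode, List.forall_mem_map]
    exact hT.small
  have hmd : ∀ x ∈ (mapT actionMdT T.encode.actions).val, x ≤ M := by
    simp only [mapT_val, Task.encode, List.map_map, List.forall_mem_map, Function.comp,
      actionMdT_val]
    intro α hα
    have h := hT.small α hα
    refine max_le (Finset.sup_le fun e _ => (Form.md_le_size _).trans (h.pre_size _ ?_))
      (Finset.sup_le fun e _ => Finset.sup_le fun q _ => (Form.md_le_size _).trans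
        (h.post_size (List.ofFn (α.post e)) ?_ _ ?_))
    · exact (List.mem_ofFn' _ _).2 ⟨e, rfl⟩
    · exact (List.mem_ofFn' _ _).2 ⟨e, rfl⟩
    · exact (List.mem_ofFn' _ _).2 ⟨q, rfl⟩
  unfold depthBoundT
  refine le_pow_mono hM (tick_bind_time_le hM (bind_time_le hM
    (mapT_time_le hM hlen fun α hα => actionMdT_time_le hM (hmem α hα))
    (bind_time_le hM (maxListT_time_le hM (by simpa using hlen) hmd)
    (bind_time_le hM (mdT_time_le hM hT.goal)
    (bind_time_le hM (i := 4) ((mulT_time_le _ _).trans ?_) (j := 2) ?_))))) (by decide)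
  · have := maxListT_le_of_forall hmd
    calc u * ((maxListT (mapT actionMdT T.encode.actions).val).val + 2) + 1
        ≤ M * (M + 2) + 1 := by gcongr
      _ ≤ 4 * M ^ 2 := by nlinarith
      _ ≤ M ^ 4 := by nlinarith [Nat.mul_le_mul_right (M ^ 2) (show 4 ≤ M ^ 2 by nlinarith)]
  · rw [addT_time, mdT_val]
    exact small_le_pow hM (k := 0)
      (by have := (T.goal.md_le_size).trans hT.goal; exact Nat.add_le_add this (by omega))

/-- The factor, depending on the parameters only, in the time bound for bounded plans. -/
def planFactor (x : ℕ × ℕ × ℕ × ℕ × ℕ) : ℕ :=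
  (4 * (x.1 + x.2.2.2.1 + 1) *
    ((x.2.1 * x.2.2.2.2 + x.2.2.1 + 1) *
      sigBound (x.1 + x.2.2.2.1) (x.2.1 * x.2.2.2.2 + x.2.2.1)) * (x.2.2.2.2 + 1)) ^ 102

theorem primrec_pow : Primrec₂ ((· ^ ·) : ℕ → ℕ → ℕ) := Primrec₂.unpaired'.1 Nat.Primrec.pow

/-- The recursion on the height is primitive, and a computable factor is all that is wanted; so no
comparison with towers is needed here. -/
theorem primrec_sigBound : Primrec₂ sigBound := by
  have h₁ : Primrec fun x : ℕ => 2 ^ (4 * x) :=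
    primrec_pow.comp (.const 2) (Primrec.nat_mul.comp (.const 4) .id)
  have h₂ : Primrec₂ fun (x : ℕ) (y : ℕ × ℕ) => 2 ^ (4 * x * y.2) :=
    primrec_pow.comp₂ (Primrec₂.const 2) (Primrec.nat_mul.comp₂
      (Primrec.nat_mul.comp₂ (Primrec₂.const 4) Primrec₂.left)
      (Primrec.snd.comp₂ Primrec₂.right))
  refine (Primrec.nat_rec h₁ h₂).of_eq fun x h => ?_
  induction h with
  | zero => rfl
  | succ h ih => exact congrArg (fun y => 2 ^ (4 * x * y)) ih

theorem primrec_planFactor : Primrec planFactor := by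
  have ha : Primrec fun x : ℕ × ℕ × ℕ × ℕ × ℕ => x.1 := .fst
  have hc : Primrec fun x : ℕ × ℕ × ℕ × ℕ × ℕ => x.2.1 := Primrec.fst.comp .snd
  have h₂ : Primrec fun x : ℕ × ℕ × ℕ × ℕ × ℕ => x.2.2 := Primrec.snd.comp .snd
  have ho : Primrec fun x : ℕ × ℕ × ℕ × ℕ × ℕ => x.2.2.1 := Primrec.fst.comp h₂
  have h₃ : Primrec fun x : ℕ × ℕ × ℕ × ℕ × ℕ => x.2.2.2 := Primrec.snd.comp h₂
  have hp : Primrec fun x : ℕ × ℕ × ℕ × ℕ × ℕ => x.2.2.2.1 := Primrec.fst.comp h₃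
  have hu : Primrec fun x : ℕ × ℕ × ℕ × ℕ × ℕ => x.2.2.2.2 := Primrec.snd.comp h₃
  have hap := Primrec.nat_add.comp ha hp
  have hb := Primrec.nat_add.comp (Primrec.nat_mul.comp hc hu) ho
  exact primrec_pow.comp (Primrec.nat_mul.comp (Primrec.nat_mul.comp
    (Primrec.nat_mul.comp (.const 4) (Primrec.nat_add.comp hap (.const 1)))
    (Primrec.nat_mul.comp (Primrec.nat_add.comp hb (.const 1)) (primrec_sigBound.comp hap hb)))
    (Primrec.nat_add.comp hu (.const 1))) (.const 102)

/-- The bound `M^102` is multiplicative in `M`, and `M` is `|T|` times an expression in the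
parameters; so the power splits into the two required factors. -/
theorem planWithin_time (T : Task a p) (u : ℕ) : ∃ t out, PlanWithin T u t out ∧
    t ≤ planFactor (a, T.c, T.o, p, u) * T.size ^ 102 := by
  set b := T.c * u + T.o with hb
  -- The extra factor `u + 1` pays for handling the unary number `u`, which the other factors need
  -- not bound.
  obtain ⟨M, hMdef⟩ : ∃ M, M = 4 * T.size * (a + p + 1) * ((b + 1) * sigBound (a + p) b) *
    (u + 1) := ⟨_, rfl⟩
  have hT : Limits T b M := T.limits (by rw [hMdef]; exact Nat.le_mul_of_pos_right _ (by omega))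
  have hM := hT.four
  have hu : u + 1 ≤ M := by
    rw [hMdef]
    refine Nat.le_mul_of_pos_left _ (Nat.pos_of_ne_zero fun h => ?_)
    rw [h] at hMdef
    omega
  obtain ⟨t, out, h₁, h₂⟩ := exists_boundedGraphSearch hT
  refine ⟨_, _, ⟨t, out, by rwa [depthBoundT_val], rfl, rfl⟩, ?_⟩
  have h₃ : (depthBoundT T.encode u).time + t + (trimT u out).time ≤ M ^ 102 :=
    le_pow_mono hM (add_le_pow hM (add_le_pow hM (hT.depthBoundT_time_le (by omega)) h₂)
      ((trimT_time_le u out).trans (small_le_pow hM (k := 0) (by omega)))) (by decide)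
  refine h₃.trans (le_of_eq ?_)
  rw [planFactor, ← mul_pow, hMdef]
  congr 1
  ring

end DEL

/-! ### The two claims -/

theorem mainTheorem3 :
    (∃ C k : ℕ, ∀ (a p : ℕ) (T : DEL.Task a p) (b : ℕ),
      ∃ (t : ℕ) (out : Option (List ℕ)), DEL.BoundedGraphSearch T b t out ∧
        t ≤ T.size ^ k * DEL.exp2 (b + 1) (C * (a + p))) ∧
    (∃ f : ℕ × ℕ × ℕ × ℕ × ℕ → ℕ, Computable f ∧ ∃ k : ℕ,
      ∀ (a p : ℕ) (T : DEL.Task a p) (u : ℕ),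
        ∃ (t : ℕ) (out : Option (List ℕ)), DEL.PlanWithin T u t out ∧
          t ≤ f (a, T.c, T.o, p, u) * T.size ^ k ∧
          (∀ π, out = some π → T.IsSolution π ∧ π.length ≤ u) ∧
          (out = none → ¬ ∃ π, T.IsSolution π ∧ π.length ≤ u)) := by
  refine ⟨⟨2412, 1100, fun a p T b => DEL.boundedGraphSearch_time T b⟩, DEL.planFactor,
    DEL.primrec_planFactor.to_comp, 102, fun a p T u => ?_⟩
  obtain ⟨t, out, h₁, h₂⟩ := DEL.planWithin_time T u
  exact ⟨t, out, h₁, h₂, h₁.correct⟩
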